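/- **Setting.** Let $(M,\omega)$ be a symplectic manifold, $\omega$ not necessarily exact, which is convex at infinity: for a closed contact manifold $(\Sigma,\alpha)$ and some $c>0$ there is a symplectic diffeomorphism $\psi$ of $(\Sigma\times(c,\infty),\,d(R\alpha))$ onto an open subset of $M$ such that, for every $b>c$, the complement of $\psi(\Sigma\times[b,\infty))$ is a relatively compact open subset of $M$. Here $R$ is the coordinate on $(c,\infty)$, regarded as a function on $M$ by setting $R=c$ off the image of $\psi$. Let $Y$ be the Reeb vector field of $\alpha$ (so $\alpha(Y)=1$, $d\alpha(Y,\cdot)=0$) and $Z=R\partial_R$. For smooth $H:M\to\mathbb R$ let $X_H$ be defined by $\omega(\cdot,X_H)=dH$; a $1$-orbit of $H$ is a smooth loop $x:S^1=\mathbb R/\mathbb Z\to M$ with $\dot x=X_H(x)$. A Reeb period is the period of a closed Reeb orbit (multiples included). Fix $R_0>c$. A pair $(H,J)$ is *admissible* if $J$ is an $\omega$-compatible almost complex structure with $JZ=Y$ for $R\ge R_0$; $H$ is smooth with $H=h(R)$ for $R\ge R_0$, $h$ smooth; $h'(R_0)>0$ is smaller than every Reeb period; $h''(R_0)>0$, $h''\ge0$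 on $[R_0,\infty)$; $h'(R)$ is not a Reeb period whenever $R\ge R_0$ and $h''(R)=0$; and for large $R$, $h'(R)$ is a constant that is not a Reeb period. An *admissible homotopy* is a smooth family $(H_s,J_s)_{s\in\mathbb R}$ of admissible pairs with $H_s=h_s(R)$ and $\partial_s h_s'\le 0$ on $R\ge R_0$; it goes from $(H_-,J_-)$ to $(H_+,J_+)$ if it equals these pairs for $s\ll0$ and $s\gg0$ respectively. Let $\phi:\mathbb R\to[0,1]$ be smooth and non-decreasing with $\phi=0$ on $(-\infty,R_0]$, $\phi>0$ on $(R_0,\infty)$, and $\phi=1$ for large $R$. Put $\eta=d(\phi(R)\alpha)=\phi(R)\,d\alpha+\phi'(R)\,dR\wedge\alpha$ (extended by zero), $f(R)=\int_0^R\phi'(\tau)h'(\tau)\,d\tau$, and on the free loop space $\mathcal LM=C^\infty(S^1,M)$ $$F(x)=-\int_{S^1}x^*(\phi\alpha)+\int_{S^1}f(R\circ x)\,dt,\qquad \Omega_\eta(\xi)=-\int_{S^1}\eta(\xi,\partial_tx-X_H)\,dt .$$ For a homotopy, $F_s$ denotes the functional defined with $h_s$. A Floer trajectory is a smooth $u:\mathbb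 R\times S^1\to M$ with $\partial_su+J(\partial_tu-X_H)=0$; a continuation solution is a smooth $u$ with $\partial_su+J_s(\partial_tu-X_{H_s})=0$. Such $u$ travels from $x_-$ to $x_+$ if $u(s,\cdot)\to x_\pm$ uniformly as $s\to\pm\infty$. The *Floer complex* is taken in its Morse–Bott form. Fix an auxiliary flow on the space of $1$-orbits with smooth flow lines (for example the gradient flow of a Morse function on the manifold of $1$-orbits, or the stationary flow). $CF(H)$ is the free $\Lambda$-module on its rest points, $\Lambda$ a commutative topological ring. The coefficient of $p$ in $\partial q$ is a weighted count of cascades from $p$ to $q$ (lines of the auxiliary flow alternating with Floer trajectories modulo translation), where the weights are arbitrary and encode rigidity, orientation signs and Novikov weights. The continuation map $\kappa:CF(H_+)\to CF(H_-)$ is the analogous weighted count of cascades from $p$ (a generator for $H_-$) to $q$ (a generator for $H_+$) that contain exactly one continuation solution. (In the case of the stationary flow the generators are all the $1$-orbits, and for suitable weights $\partial$ counts Floer trajectories.) **Theorem.** Let $(H,J)$ be admissible. 1. *Exactness.* $F$ is a primitive of $\Omega_\eta$: along every smooth curve of loops, $F$ is differentiable and $dF\cdot\xi=-\int_{S^1}\eta(\xi,\partial_tx-X_H)\,dt$.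 2. *Negativity.* $dF\cdot\partial_su\le0$ for every Floer trajectory $u$; hence $F(x_-)\ge F(x_+)$ if $u$ travels from the $1$-orbit $x_-$ to the $1$-orbit $x_+$. 3. *Separation.* $F=0$ on all loops in $R\le R_0$, and $F<0$ on all $1$-orbits in $R\ge R_0$. 4. *Compatibility.* For every admissible homotopy and every continuation solution $u$, $s\mapsto F_s(u(s,\cdot))$ is differentiable with derivative $\le0$; if the homotopy goes from $(H_-,J_-)$ to $(H_+,J_+)$ and $u$ travels from a $1$-orbit $x_-$ of $H_-$ to a $1$-orbit $x_+$ of $H_+$, then $F_{H_-}(x_-)\ge F_{H_+}(x_+)$. 5. *Strictness.* Suppose moreover that for some $R_1$, $\phi'>0$ on $(R_0,R_1)$ and $h'$ is constant on $[R_1,\infty)$. Then $F(x_-)>F(x_+)$ for every Floer trajectory travelling between distinct $1$-orbits $x_-$, $x_+$ with $x_+$ contained in $R\ge R_0$. Consequently, the submodules $CF(H)_{F\ge a}$ spanned by the generators with $F\ge a$ ($a\in\mathbb R$) form a decreasing exhaustive filtration of $CF(H)$ with $\partial(CF(H)_{F\ge a})\subseteq CF(H)_{F\ge a}$, and every continuation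 map $\kappa:CF(H_+)\to CF(H_-)$ of an admissible homotopy satisfies $\kappa(CF(H_+)_{F\ge a})\subseteq CF(H_-)_{F\ge a}$. -/

import Mathlib

open Set Filter Topology Manifold ContDiff

noncomputable section

namespace FloerFiltration

/-! ## Differential forms and endomorphisms in charts -/

section Forms

variable {E : Type*} [NormedAddCommGroup E] [NormedSpace ℝ E]
  {X : Type*} [TopologicalSpace X] [ChartedSpace E X]

/-- A (not necessarily smooth) 1-form on a manifold modelled on `E`. -/
abbrev OneForm (E : Type*) [NormedAddCommGroup E] [NormedSpace ℝ E]
    (X : Type*) [TopologicalSpace X] [ChartedSpace E X] : Type _ :=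
  ∀ x : X, TangentSpace 𝓘(ℝ, E) x →L[ℝ] ℝ

/-- A (not necessarily smooth or alternating) field of bilinear forms. -/
abbrev BilinForm (E : Type*) [NormedAddCommGroup E] [NormedSpace ℝ E]
    (X : Type*) [TopologicalSpace X] [ChartedSpace E X] : Type _ :=
  ∀ x : X, TangentSpace 𝓘(ℝ, E) x →L[ℝ] TangentSpace 𝓘(ℝ, E) x →L[ℝ] ℝ

/-- A (not necessarily smooth) field of endomorphisms of the tangent spaces. -/
abbrev EndoField (E : Type*) [NormedAddCommGroup E] [NormedSpace ℝ E]
    (X : Type*) [TopologicalSpace X] [ChartedSpace E X] : Type _ :=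
  ∀ x : X, TangentSpace 𝓘(ℝ, E) x →L[ℝ] TangentSpace 𝓘(ℝ, E) x

/-- The differential at `y` of the inverse of the preferred chart at `x₀`. -/
def chartInvD (x₀ : X) (y : E) :
    E →L[ℝ] TangentSpace 𝓘(ℝ, E) ((extChartAt 𝓘(ℝ, E) x₀).symm y) :=
  mfderiv 𝓘(ℝ, E) 𝓘(ℝ, E) (extChartAt 𝓘(ℝ, E) x₀).symm y

/-- The differential at `x` of the preferred chart at `x₀`. -/
def chartD (x₀ x : X) : TangentSpace 𝓘(ℝ, E) x →L[ℝ] E :=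
  mfderiv 𝓘(ℝ, E) 𝓘(ℝ, E) (extChartAt 𝓘(ℝ, E) x₀) x

/-- The coordinate expression of a 1-form in the preferred chart at `x₀`. -/
def OneForm.rep (α : OneForm E X) (x₀ : X) (y : E) : E →L[ℝ] ℝ :=
  (α ((extChartAt 𝓘(ℝ, E) x₀).symm y)).comp (chartInvD x₀ y)

/-- The coordinate expression of a field of bilinear forms in the preferred chart at `x₀`. -/
def BilinForm.rep (om : BilinForm E X) (x₀ : X) (y : E) : E →L[ℝ] E →L[ℝ] ℝ :=
  let B : E →L[ℝ] E →L[ℝ] ℝ := om ((extChartAt 𝓘(ℝ, E) x₀).symm y)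
  let D : E →L[ℝ] E := chartInvD x₀ y
  B.bilinearComp D D

/-- The coordinate expression of a field of endomorphisms in the preferred chart at `x₀`. -/
def EndoField.rep (J : EndoField E X) (x₀ : X) (y : E) : E →L[ℝ] E :=
  (chartD x₀ ((extChartAt 𝓘(ℝ, E) x₀).symm y)).comp
    ((J ((extChartAt 𝓘(ℝ, E) x₀).symm y)).comp (chartInvD x₀ y))

/-- The exterior derivative of a 1-form, `dα(v, w) = D_v α(w) - D_w α(v)`, computed at `x`
in the preferred chart at `x`. -/
def OneForm.d (α : OneForm E X) (x : X) (v w : TangentSpace 𝓘(ℝ, E) x) : ℝ :=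
  fderiv ℝ (α.rep x) (extChartAt 𝓘(ℝ, E) x x) (chartD x x v) (chartD x x w)
    - fderiv ℝ (α.rep x) (extChartAt 𝓘(ℝ, E) x x) (chartD x x w) (chartD x x v)

/-- `α` is a (smooth) contact form: it vanishes nowhere and `dα` is nondegenerate on `ker α`. -/
structure IsContactForm (α : OneForm E X) : Prop where
  smooth : ∀ x₀ : X, ContDiffOn ℝ ∞ (α.rep x₀) (extChartAt 𝓘(ℝ, E) x₀).target
  ne_zero : ∀ x, α x ≠ 0
  nondegenerate : ∀ x (v : TangentSpace 𝓘(ℝ, E) x), α x v = 0 →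
    (∀ w : TangentSpace 𝓘(ℝ, E) x, α x w = 0 → α.d x v w = 0) → v = 0

/-- `om` is a symplectic form: a smooth, alternating, nondegenerate, closed 2-form. -/
structure IsSymplecticForm (om : BilinForm E X) : Prop where
  smooth : ∀ x₀ : X, ContDiffOn ℝ ∞ (om.rep x₀) (extChartAt 𝓘(ℝ, E) x₀).target
  alternating : ∀ x (v : TangentSpace 𝓘(ℝ, E) x), om x v v = 0
  nondegenerate : ∀ x (v : TangentSpace 𝓘(ℝ, E) x),
    (∀ w : TangentSpace 𝓘(ℝ, E) x, om x v w = 0) → v = 0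
  closed : ∀ x₀ : X, ∀ y ∈ (extChartAt 𝓘(ℝ, E) x₀).target, ∀ u v w : E,
    fderiv ℝ (om.rep x₀) y u v w + fderiv ℝ (om.rep x₀) y v w u
      + fderiv ℝ (om.rep x₀) y w u v = 0

/-- `J` is a smooth almost complex structure compatible with `om`:
`J² = -1`, `om(J·, J·) = om` and `om(·, J·)` is positive definite. -/
structure IsCompatible (om : BilinForm E X) (J : EndoField E X) : Prop where
  smooth : ∀ x₀ : X, ContDiffOn ℝ ∞ (J.rep x₀) (extChartAt 𝓘(ℝ, E) x₀).target
  sq : ∀ x (v : TangentSpace 𝓘(ℝ, E) x), J x (J x v) = -v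
  invariant : ∀ x (v w : TangentSpace 𝓘(ℝ, E) x), om x (J x v) (J x w) = om x v w
  pos : ∀ x (v : TangentSpace 𝓘(ℝ, E) x), v ≠ 0 → 0 < om x v (J x v)

/-- The differential of a real function. -/
def dFun (H : X → ℝ) (p : X) : TangentSpace 𝓘(ℝ, E) p →L[ℝ] ℝ :=
  mfderiv 𝓘(ℝ, E) 𝓘(ℝ, ℝ) H p

/-- A nondegenerate alternating form on a finite-dimensional space represents every differential
in exactly one way, so Hamiltonian vector fields exist and are unique. -/
theorem existsUnique_hamiltonian [FiniteDimensional ℝ E] {om : BilinForm E X}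
    (hom : IsSymplecticForm om) (H : X → ℝ) (p : X) :
    ∃! Z : TangentSpace 𝓘(ℝ, E) p, ∀ v : TangentSpace 𝓘(ℝ, E) p, om p v Z = dFun H p v := by
  have : FiniteDimensional ℝ (TangentSpace 𝓘(ℝ, E) p) := inferInstanceAs (FiniteDimensional ℝ E)
  have hskew : ∀ v w : TangentSpace 𝓘(ℝ, E) p, om p v w = - om p w v := by
    intro v w
    have h := hom.alternating p (v + w)
    simp only [map_add, _root_.add_apply, hom.alternating] at h
    linarith
  let L : TangentSpace 𝓘(ℝ, E) p →ₗ[ℝ] Module.Dual ℝ (TangentSpace 𝓘(ℝ, E) p) :=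
    { toFun := fun v => (om p v).toLinearMap
      map_add' := by intro a b; ext c; simp
      map_smul' := by intro a b; ext c; simp }
  have hinj : Function.Injective L := by
    rw [injective_iff_map_eq_zero]
    intro v hv
    exact hom.nondegenerate p v (fun w => by simpa [L] using LinearMap.congr_fun hv w)
  have hsurj : Function.Surjective L :=
    (LinearMap.injective_iff_surjective_of_finrank_eq_finrank
      (Subspace.dual_finrank_eq (K := ℝ) (V := TangentSpace 𝓘(ℝ, E) p)).symm).1 hinj
  obtain ⟨Z, hZ⟩ := hsurj (-(dFun H p)).toLinearMap
  have key : ∀ v : TangentSpace 𝓘(ℝ, E) p, om p Z v = -(dFun H p v) := fun v => by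
    simpa [L] using LinearMap.congr_fun hZ v
  refine ⟨Z, fun v => by rw [hskew, key, neg_neg], fun Z' hZ' => ?_⟩
  have : Z' - Z = 0 := hom.nondegenerate p _ (fun w => by
    have h1 := hZ' w
    have h2 := key w
    rw [hskew] at h1
    rw [map_sub, _root_.sub_apply, h2]
    linarith)
  exact sub_eq_zero.1 this

open Classical in
/-- The Hamiltonian vector field of `H`, determined by `om(·, X_H) = dH`
(see `existsUnique_hamiltonian`). -/
def hamiltonianField (om : BilinForm E X) (H : X → ℝ) (p : X) : TangentSpace 𝓘(ℝ, E) p :=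
  if h : ∃ Z : TangentSpace 𝓘(ℝ, E) p, ∀ v : TangentSpace 𝓘(ℝ, E) p, om p v Z = dFun H p v
  then h.choose else 0

theorem hamiltonianField_spec [FiniteDimensional ℝ E] {om : BilinForm E X}
    (hom : IsSymplecticForm om) (H : X → ℝ) (p : X) (v : TangentSpace 𝓘(ℝ, E) p) :
    om p v (hamiltonianField om H p) = dFun H p v := by
  have h := (existsUnique_hamiltonian hom H p).exists
  rw [hamiltonianField, dif_pos h]
  exact h.choose_spec v

/-- The velocity of a curve in a manifold. -/
def velocity (x : ℝ → X) (t : ℝ) : TangentSpace 𝓘(ℝ, E) (x t) :=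
  mfderiv 𝓘(ℝ, ℝ) 𝓘(ℝ, E) x t (1 : ℝ)

/-- `Y` is the value at `σ` of the Reeb vector field of `α`: `α(Y) = 1`, `dα(Y, ·) = 0`. -/
def IsReebVector (α : OneForm E X) (σ : X) (Y : TangentSpace 𝓘(ℝ, E) σ) : Prop :=
  α σ Y = 1 ∧ ∀ w : TangentSpace 𝓘(ℝ, E) σ, α.d σ Y w = 0

/-- `τ` is a Reeb period: the period of a closed Reeb orbit (multiples included). -/
def IsReebPeriod (α : OneForm E X) (τ : ℝ) : Prop :=
  0 < τ ∧ ∃ γ : ℝ → X, ContMDiff 𝓘(ℝ, ℝ) 𝓘(ℝ, E) ∞ γ ∧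
    (∀ t, IsReebVector α (γ t) (velocity γ t)) ∧ ∀ t, γ (t + τ) = γ t

end Forms

/-! ## Convex symplectic manifolds -/

/-- A convex symplectic structure on `M` with contact manifold `(S, α)` at infinity. The collar
`ψ` identifies `S × (c, ∞)` symplectically, with the form `d(rα) = dr ∧ α + r dα`, with an open
subset of `M`, and the complement of each `ψ(S × [b, ∞))` is a bounded open subset of `M`.
The symplectic form `om` is not assumed to be exact on `M`. -/
structure ConvexSymplecticManifold
    (E : Type*) [NormedAddCommGroup E] [NormedSpace ℝ E]
    (E' : Type*) [NormedAddCommGroup E'] [NormedSpace ℝ E']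
    (M : Type*) [TopologicalSpace M] [ChartedSpace E M]
    (S : Type*) [TopologicalSpace S] [ChartedSpace E' S] where
  om : BilinForm E M
  symplectic : IsSymplecticForm om
  α : OneForm E' S
  contact : IsContactForm α
  c : ℝ
  c_pos : 0 < c
  ψ : PartialDiffeomorph (𝓘(ℝ, E').prod 𝓘(ℝ, ℝ)) 𝓘(ℝ, E) (S × ℝ) M ∞
  source_eq : ψ.source = univ ×ˢ Ioi c
  pullback_eq : ∀ (σ : S) (r : ℝ), c < r →
    ∀ (v w : TangentSpace 𝓘(ℝ, E') σ) (a b : ℝ),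
      om (ψ (σ, r)) (mfderiv (𝓘(ℝ, E').prod 𝓘(ℝ, ℝ)) 𝓘(ℝ, E) ψ (σ, r) (v, a))
          (mfderiv (𝓘(ℝ, E').prod 𝓘(ℝ, ℝ)) 𝓘(ℝ, E) ψ (σ, r) (w, b))
        = (a * α σ w - b * α σ v) + r * α.d σ v w
  isClosed_end : ∀ b, c < b → IsClosed (ψ '' (univ ×ˢ Ici b))
  bounded_domain : ∀ b, c < b → IsCompact (closure (ψ '' (univ ×ˢ Ici b))ᶜ)

section Loops

variable {E : Type*} [NormedAddCommGroup E] [NormedSpace ℝ E]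
  {M : Type*} [TopologicalSpace M] [ChartedSpace E M]

/-- A smooth loop `ℝ/ℤ → M`, as a smooth 1-periodic map `ℝ → M`. -/
structure Loop (E : Type*) [NormedAddCommGroup E] [NormedSpace ℝ E]
    (M : Type*) [TopologicalSpace M] [ChartedSpace E M] where
  toFun : ℝ → M
  smooth : ContMDiff 𝓘(ℝ, ℝ) 𝓘(ℝ, E) ∞ toFun
  periodic : ∀ t, toFun (t + 1) = toFun t

instance : CoeFun (Loop E M) fun _ => ℝ → M := ⟨Loop.toFun⟩

/-- A smooth curve `s ↦ u(s, ·)` in the free loop space, that is a smooth map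
`u : ℝ × ℝ/ℤ → M`. -/
structure LoopCurve (E : Type*) [NormedAddCommGroup E] [NormedSpace ℝ E]
    (M : Type*) [TopologicalSpace M] [ChartedSpace E M] where
  toFun : ℝ → Loop E M
  smooth : ContMDiff 𝓘(ℝ, ℝ × ℝ) 𝓘(ℝ, E) ∞ fun q : ℝ × ℝ => toFun q.1 q.2

instance : CoeFun (LoopCurve E M) fun _ => ℝ → Loop E M := ⟨LoopCurve.toFun⟩

/-- `∂_t x`. -/
def Loop.dt (x : Loop E M) (t : ℝ) : TangentSpace 𝓘(ℝ, E) (x t) := velocity x.toFun t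

/-- `∂_s u`, the velocity at `s` of a curve in the loop space, a vector field along the loop
`u(s, ·)`. -/
def LoopCurve.ds (u : LoopCurve E M) (s t : ℝ) : TangentSpace 𝓘(ℝ, E) (u s t) :=
  velocity (fun s' => u s' t) s

/-- A 1-form `Θ` on the loop space (evaluated on vector fields along loops) has `F` as a
primitive: `F` is differentiable along every smooth curve of loops, with `dF · ∂_s u = Θ(∂_s u)`. -/
def IsPrimitive (F : Loop E M → ℝ)
    (Θ : ∀ x : Loop E M, (∀ t, TangentSpace 𝓘(ℝ, E) (x t)) → ℝ) : Prop :=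
  ∀ (u : LoopCurve E M) (s : ℝ), HasDerivAt (fun s' => F (u s')) (Θ (u s) (u.ds s)) s

/-- Convergence `u(s, ·) → x` along `l`, uniformly in `t` (compact-open topology). -/
def LoopTendsto (u : ℝ → Loop E M) (l : Filter ℝ) (x : Loop E M) : Prop :=
  ∀ t, Tendsto (fun q : ℝ × ℝ => u q.1 q.2) (l ×ˢ 𝓝 t) (𝓝 (x t))

/-- `u` travels from `x` (at `s = -∞`) to `y` (at `s = +∞`). -/
def Joins (u : LoopCurve E M) (x y : Loop E M) : Prop :=
  LoopTendsto u atBot x ∧ LoopTendsto u atTop y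

end Loops

section Convex

variable {E : Type*} [NormedAddCommGroup E] [NormedSpace ℝ E]
  {E' : Type*} [NormedAddCommGroup E'] [NormedSpace ℝ E']
  {M : Type*} [TopologicalSpace M] [ChartedSpace E M]
  {S : Type*} [TopologicalSpace S] [ChartedSpace E' S]

namespace ConvexSymplecticManifold

variable (C : ConvexSymplecticManifold E E' M S)

open Classical in
/-- The radial coordinate, extended by the constant `c` (the infimum of its values) to the
complement of the collar. -/
def R (p : M) : ℝ := if p ∈ C.ψ.target then (C.ψ.symm p).2 else C.c

/-- The `S`-component of the collar coordinates. -/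
def proj (p : M) : S := (C.ψ.symm p).1

/-- The differential of `proj` (meaningful on the collar). -/
def dProj (p : M) (v : TangentSpace 𝓘(ℝ, E) p) : TangentSpace 𝓘(ℝ, E') (C.proj p) :=
  (mfderiv 𝓘(ℝ, E) (𝓘(ℝ, E').prod 𝓘(ℝ, ℝ)) C.ψ.symm p v).1

/-- The differential of `R` (meaningful on the collar). -/
def dR (p : M) (v : TangentSpace 𝓘(ℝ, E) p) : ℝ :=
  (mfderiv 𝓘(ℝ, E) (𝓘(ℝ, E').prod 𝓘(ℝ, ℝ)) C.ψ.symm p v).2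

/-- `J` is of contact type for `R ≥ R₀`: `J Z = Y` there, with `Z = R ∂_R` and `Y` the Reeb
vector field. -/
def IsContactType (J : EndoField E M) (R₀ : ℝ) : Prop :=
  ∀ (σ : S) (r : ℝ), R₀ ≤ r → ∀ Y : TangentSpace 𝓘(ℝ, E') σ, IsReebVector C.α σ Y →
    J (C.ψ (σ, r)) (mfderiv (𝓘(ℝ, E').prod 𝓘(ℝ, ℝ)) 𝓘(ℝ, E) C.ψ (σ, r) (0, r))
      = mfderiv (𝓘(ℝ, E').prod 𝓘(ℝ, ℝ)) 𝓘(ℝ, E) C.ψ (σ, r) (Y, 0)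

/-- A 1-orbit of `H`: a loop with `∂_t x = X_H(x)`. -/
def IsOneOrbit (H : M → ℝ) (x : Loop E M) : Prop :=
  ∀ t, x.dt t = hamiltonianField C.om H (x t)

open Classical in
/-- The 1-form `φ(R) α` on `M`, extended by zero. -/
def cutoffForm (φ : ℝ → ℝ) (p : M) (v : TangentSpace 𝓘(ℝ, E) p) : ℝ :=
  if p ∈ C.ψ.target then φ (C.R p) * C.α (C.proj p) (C.dProj p v) else 0

open Classical in
/-- The 2-form `η = d(φ(R) α) = φ(R) dα + φ'(R) dR ∧ α` on `M`, extended by zero. -/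
def eta (φ : ℝ → ℝ) (p : M) (v w : TangentSpace 𝓘(ℝ, E) p) : ℝ :=
  if p ∈ C.ψ.target then
    φ (C.R p) * C.α.d (C.proj p) (C.dProj p v) (C.dProj p w)
      + deriv φ (C.R p) * (C.dR p v * C.α (C.proj p) (C.dProj p w)
          - C.dR p w * C.α (C.proj p) (C.dProj p v))
  else 0

end ConvexSymplecticManifold

/-- An admissible pair `(H, J)`, with `H = h(R)` for `R ≥ R₀`. Only the values of `h` on
`[R₀, ∞)` matter. -/
structure AdmissiblePair (C : ConvexSymplecticManifold E E' M S) (R₀ : ℝ) where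
  H : M → ℝ
  J : EndoField E M
  h : ℝ → ℝ
  smooth_H : ContMDiff 𝓘(ℝ, E) 𝓘(ℝ, ℝ) ∞ H
  smooth_h : ContDiff ℝ ∞ h
  compatible : IsCompatible C.om J
  contactType : C.IsContactType J R₀
  radial : ∀ (σ : S) (r : ℝ), R₀ ≤ r → H (C.ψ (σ, r)) = h r
  slope_pos : 0 < deriv h R₀
  slope_lt : ∀ τ, IsReebPeriod C.α τ → deriv h R₀ < τ
  convex_pos : 0 < deriv (deriv h) R₀
  convex : ∀ r, R₀ ≤ r → 0 ≤ deriv (deriv h) r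
  slope_not_period : ∀ r, R₀ ≤ r → deriv (deriv h) r = 0 → ¬ IsReebPeriod C.α (deriv h r)
  final_slope : ∃ κ : ℝ, ¬ IsReebPeriod C.α κ ∧ ∀ᶠ r in atTop, deriv h r = κ

/-- An admissible homotopy `(H_s, J_s)`: a smooth family of admissible pairs with
`∂_s h_s' ≤ 0` on `[R₀, ∞)`. -/
structure AdmissibleHomotopy (C : ConvexSymplecticManifold E E' M S) (R₀ : ℝ) where
  pair : ℝ → AdmissiblePair C R₀
  smooth_H : ContMDiff (𝓘(ℝ, ℝ).prod 𝓘(ℝ, E)) 𝓘(ℝ, ℝ) ∞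
    fun q : ℝ × M => (pair q.1).H q.2
  smooth_h : ContDiff ℝ ∞ fun q : ℝ × ℝ => (pair q.1).h q.2
  smooth_J : ∀ x₀ : M, ContDiffOn ℝ ∞
    (fun q : ℝ × E => EndoField.rep (pair q.1).J x₀ q.2)
    (univ ×ˢ (extChartAt 𝓘(ℝ, E) x₀).target)
  slope_antitone : ∀ s r, R₀ ≤ r → deriv (fun s' => deriv (pair s').h r) s ≤ 0

/-- The homotopy goes from `An` to `Ap`: it is constant near `s = ±∞`. -/
def AdmissibleHomotopy.Connects {C : ConvexSymplecticManifold E E' M S} {R₀ : ℝ}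
    (B : AdmissibleHomotopy C R₀) (An Ap : AdmissiblePair C R₀) : Prop :=
  ∃ K : ℝ, (∀ s, s ≤ -K → B.pair s = An) ∧ ∀ s, K ≤ s → B.pair s = Ap

/-- A cut-off function. -/
structure IsCutoff (φ : ℝ → ℝ) (R₀ : ℝ) : Prop where
  smooth : ContDiff ℝ ∞ φ
  mem_Icc : ∀ r, φ r ∈ Icc (0 : ℝ) 1
  monotone : Monotone φ
  eq_zero : ∀ r, r ≤ R₀ → φ r = 0
  pos : ∀ r, R₀ < r → 0 < φ r
  eventually_one : ∀ᶠ r in atTop, φ r = 1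

/-- The additional condition on the cut-off function, needed for strictness only: for some `R₁`,
`φ' > 0` on `(R₀, R₁)` and `h'` is constant on `[R₁, ∞)`. -/
def IsStrictCutoff (φ : ℝ → ℝ) (R₀ : ℝ) (h : ℝ → ℝ) : Prop :=
  ∃ R₁ : ℝ, (∀ r, R₀ < r → r < R₁ → 0 < deriv φ r) ∧
    ∃ κ : ℝ, ∀ r, R₁ ≤ r → deriv h r = κ

namespace AdmissiblePair

variable {C : ConvexSymplecticManifold E E' M S} {R₀ : ℝ} (A : AdmissiblePair C R₀)

/-- `f(r) = ∫_0^r φ'(τ) h'(τ) dτ`. -/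
def f (φ : ℝ → ℝ) (r : ℝ) : ℝ := ∫ τ in (0 : ℝ)..r, deriv φ τ * deriv A.h τ

/-- The filtration functional `F(x) = -∫ x^*(φα) + ∫ f(R ∘ x) dt`. -/
def F (φ : ℝ → ℝ) (x : Loop E M) : ℝ :=
  -(∫ t in (0 : ℝ)..1, C.cutoffForm φ (x t) (x.dt t)) + ∫ t in (0 : ℝ)..1, A.f φ (C.R (x t))

/-- The 1-form `Ω_η(ξ) = -∫ η(ξ, ∂_t x - X_H) dt` on the loop space. -/
def Omega (φ : ℝ → ℝ) (x : Loop E M) (ξ : ∀ t, TangentSpace 𝓘(ℝ, E) (x t)) : ℝ :=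
  -(∫ t in (0 : ℝ)..1, C.eta φ (x t) (ξ t) (x.dt t - hamiltonianField C.om A.H (x t)))

/-- The 1-orbits of `H`. -/
def Orbit : Type _ := {x : Loop E M // C.IsOneOrbit A.H x}

/-- A Floer trajectory: `∂_s u + J(u)(∂_t u - X_H(u)) = 0`. -/
def IsFloerTrajectory (u : LoopCurve E M) : Prop :=
  ∀ s t, u.ds s t + A.J (u s t) ((u s).dt t - hamiltonianField C.om A.H (u s t)) = 0

end AdmissiblePair

/-- A Floer continuation solution: `∂_s u + J_s(u)(∂_t u - X_{H_s}(u)) = 0`. -/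
def AdmissibleHomotopy.IsContinuationSolution {C : ConvexSymplecticManifold E E' M S} {R₀ : ℝ}
    (B : AdmissibleHomotopy C R₀) (u : LoopCurve E M) : Prop :=
  ∀ s t, u.ds s t
    + (B.pair s).J (u s t) ((u s).dt t - hamiltonianField C.om (B.pair s).H (u s t)) = 0

/-! ## The Floer complex and continuation maps

Since `H` depends only on `R` at infinity, its non-constant 1-orbits come in families, and the Floer
complex is the Morse-Bott one: an auxiliary flow on the space of 1-orbits (the gradient flow of
a Morse function on the manifold of 1-orbits) is fixed, the generators are its rest points, and
the differential counts cascades, which alternate between flow lines of the auxiliary flow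
and Floer trajectories. For the stationary flow the generators are all the 1-orbits; giving
weight zero to all cascades with more than one Floer trajectory then yields the count of
Floer trajectories. The weights are arbitrary: they encode which cascades are rigid, their
orientation signs and their Novikov weights. -/

section Floer

variable {C : ConvexSymplecticManifold E E' M S} {R₀ : ℝ}

/-- An auxiliary flow on the space of 1-orbits, with smooth flow lines. -/
structure OrbitFlow (A : AdmissiblePair C R₀) where
  toFun : ℝ → A.Orbit → A.Orbit
  zero : ∀ x, toFun 0 x = x
  add : ∀ a b x, toFun (a + b) x = toFun a (toFun b x)
  smooth : ∀ x, ContMDiff 𝓘(ℝ, ℝ × ℝ) 𝓘(ℝ, E) ∞ fun q : ℝ × ℝ => (toFun q.1 x).1 q.2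

namespace OrbitFlow

variable {A : AdmissiblePair C R₀} (Ψ : OrbitFlow A)

/-- The generators of the Floer complex: the rest points of the auxiliary flow. -/
def Generator : Type _ := {x : A.Orbit // ∀ τ, Ψ.toFun τ x = x}

/-- `y` lies in the unstable set of `p`. -/
def InUnstable (p : Ψ.Generator) (y : A.Orbit) : Prop :=
  LoopTendsto (fun τ => (Ψ.toFun τ y).1) atBot p.1.1

/-- `y` lies in the stable set of `p`. -/
def InStable (p : Ψ.Generator) (y : A.Orbit) : Prop :=
  LoopTendsto (fun τ => (Ψ.toFun τ y).1) atTop p.1.1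

end OrbitFlow

/-- Floer trajectories from `x` to `y`. -/
def Trajectory (A : AdmissiblePair C R₀) (x y : A.Orbit) : Type _ :=
  {u : LoopCurve E M // A.IsFloerTrajectory u ∧ Joins u x.1 y.1}

/-- Translation in the variable `s`. -/
instance trajectorySetoid (A : AdmissiblePair C R₀) (x y : A.Orbit) :
    Setoid (Trajectory A x y) where
  r u v := ∃ a : ℝ, ∀ s, v.1 s = u.1 (s + a)
  iseqv :=
    { refl := fun u => ⟨0, fun s => by rw [add_zero]⟩
      symm := fun {u v} ⟨a, h⟩ => ⟨-a, fun s => by rw [h, neg_add_cancel_right]⟩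
      trans := fun {u v w} ⟨a, h⟩ ⟨b, k⟩ => ⟨b + a, fun s => by rw [k, h, add_assoc]⟩ }

/-- The moduli space of Floer trajectories from `x` to `y`, modulo translation. -/
def Moduli (A : AdmissiblePair C R₀) (x y : A.Orbit) : Type _ :=
  Quotient (trajectorySetoid A x y)

/-- The moduli space of continuation solutions from `x` to `y`. -/
def ContModuli (B : AdmissibleHomotopy C R₀) {An Ap : AdmissiblePair C R₀}
    (x : An.Orbit) (y : Ap.Orbit) : Type _ :=
  {u : LoopCurve E M // B.IsContinuationSolution u ∧ Joins u x.1 y.1}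

/-- The ways to travel from the generator `p` to a 1-orbit: leave `p` along the auxiliary flow,
then alternately follow a Floer trajectory and the auxiliary flow for a time `τ ≥ 0`. -/
inductive LeftLeg {A : AdmissiblePair C R₀} (Ψ : OrbitFlow A) (p : Ψ.Generator) :
    A.Orbit → Type _
  | start (y : A.Orbit) (hy : Ψ.InUnstable p y) : LeftLeg Ψ p y
  | step (x y : A.Orbit) (l : LeftLeg Ψ p x) (u : Moduli A x y) (τ : ℝ) (hτ : 0 ≤ τ) :
      LeftLeg Ψ p (Ψ.toFun τ y)

/-- The ways to travel from a 1-orbit to the generator `q`: alternately follow the auxiliary flow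
for a time `τ ≥ 0` and a Floer trajectory, then tend to `q` along the auxiliary flow. -/
inductive RightLeg {A : AdmissiblePair C R₀} (Ψ : OrbitFlow A) (q : Ψ.Generator) :
    A.Orbit → Type _
  | finish (y : A.Orbit) (hy : Ψ.InStable q y) : RightLeg Ψ q y
  | step (x y : A.Orbit) (τ : ℝ) (hτ : 0 ≤ τ) (u : Moduli A (Ψ.toFun τ x) y)
      (l : RightLeg Ψ q y) : RightLeg Ψ q x

/-- Cascades from the generator `p` to the generator `q`: either an (unparametrized) line of the
auxiliary flow, or a cascade containing Floer trajectories, the last of which is `u`. -/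
inductive Cascade {A : AdmissiblePair C R₀} (Ψ : OrbitFlow A) (p q : Ψ.Generator) : Type _
  | flowLine (L : Set A.Orbit)
      (hL : ∃ x, L = range (fun τ => Ψ.toFun τ x) ∧ Ψ.InUnstable p x ∧ Ψ.InStable q x) :
      Cascade Ψ p q
  | broken (x y : A.Orbit) (l : LeftLeg Ψ p x) (u : Moduli A x y) (hy : Ψ.InStable q y) :
      Cascade Ψ p q

/-- Continuation cascades from the generator `p` for `An` to the generator `q` for `Ap`, containing
exactly one continuation solution. -/
structure ContCascade (B : AdmissibleHomotopy C R₀) {An Ap : AdmissiblePair C R₀}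
    (Ψn : OrbitFlow An) (Ψp : OrbitFlow Ap) (p : Ψn.Generator) (q : Ψp.Generator) where
  x : An.Orbit
  y : Ap.Orbit
  left : LeftLeg Ψn p x
  u : ContModuli B x y
  right : RightLeg Ψp q y

/-- The Floer cochain module: the free module on the generators. -/
abbrev CF (Λ : Type*) [CommRing Λ] {A : AdmissiblePair C R₀} (Ψ : OrbitFlow A) : Type _ :=
  Ψ.Generator →₀ Λ

/-- `d` is the Floer differential for the weights `w`: the coefficient of `p` in `d q` is the
weighted count of the cascades from `p` to `q`. -/
def IsFloerDifferential {Λ : Type*} [CommRing Λ] [TopologicalSpace Λ]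
    {A : AdmissiblePair C R₀} (Ψ : OrbitFlow A)
    (w : ∀ p q : Ψ.Generator, Cascade Ψ p q → Λ) (d : CF Λ Ψ →ₗ[Λ] CF Λ Ψ) : Prop :=
  ∀ p q, d (Finsupp.single q 1) p = ∑' k : Cascade Ψ p q, w p q k

/-- `κ : CF(Ap) → CF(An)` is the Floer continuation map for the weights `w`: the coefficient
of `p` in `κ q` is the weighted count of the continuation cascades from `p` to `q`. -/
def IsContinuationMap {Λ : Type*} [CommRing Λ] [TopologicalSpace Λ]
    (B : AdmissibleHomotopy C R₀) {An Ap : AdmissiblePair C R₀}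
    (Ψn : OrbitFlow An) (Ψp : OrbitFlow Ap)
    (w : ∀ p q, ContCascade B Ψn Ψp p q → Λ) (κ : CF Λ Ψp →ₗ[Λ] CF Λ Ψn) : Prop :=
  ∀ p q, κ (Finsupp.single q 1) p = ∑' k : ContCascade B Ψn Ψp p q, w p q k

/-- The step of the filtration at level `a`: the span of the generators with `F ≥ a`. -/
def filtrationStep (Λ : Type*) [CommRing Λ] {A : AdmissiblePair C R₀} (Ψ : OrbitFlow A)
    (φ : ℝ → ℝ) (a : ℝ) : Submodule Λ (CF Λ Ψ) :=
  Submodule.span Λ {ξ | ∃ p : Ψ.Generator, a ≤ A.F φ p.1.1 ∧ ξ = Finsupp.single p 1}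

end Floer

end Convex

end FloerFiltration

end

/-!
The functional `F` is a primitive of `Ω_η` because `η = d(φ(R) α)` (`fderiv_cutoffAlong`),
because `X_H = h'(R) Y` on `R ≥ R₀`, where `Y` is the Reeb vector field (`XH_collar`), so that
`η(·, X_H) = φ'(R) h'(R) dR = d(f(R))`, and because the term `∂_t(φ α(∂_s u))` integrates to
zero over a period (`hasDerivAt_F`). For a Floer trajectory `Ω_η(∂_s u) = -∫ η(w, J w) dt` with
`w = ∂_t u - X_H`, and `η(w, J w) ≥ 0` since on the collar `dα(w, J w)` and `(dR ∧ α)(w, J w)`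
are both nonnegative (`J_collar`). Nothing here uses more about `φ` than that it is smooth,
nondecreasing and zero on `(-∞, R₀]` (`IsWeight`).

On a 1-orbit `F` equals `∫ g(R) dt` with `g = f - φ h' = -∫ φ h''` (`F_orbit`, `reduced_eq`). A
1-orbit in `R ≥ R₀` lies in a level set `R = r`, and `r > R₀` since otherwise `h'(R₀)` would be
a Reeb period. This gives separation.

The inequality between the values at the ends of a trajectory needs an argument, because `F`
involves `∂_t u` while `u(s, ·)` converges only uniformly. No elliptic regularity is used. For
any loop, `F` differs from `∫ g(R) dt`, which is continuous for uniform convergence, by at most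
the defect `m = ∫ |φ α(w)| dt`, so it suffices that `m(u(s, ·))` takes arbitrarily small values
(`frequently_defect_lt`). Let `D` be the functional with weight `χ = ∫_{R₀} φ` instead of `φ`.
Then `χ' = φ ≥ φ²` gives `D' ≤ -R₀ m²`, and `χ ≤ K φ` on bounded sets gives `|D - e| ≤ K m` with
`e` bounded. If `m` were bounded away from zero, `D` would tend to `-∞`, so `D' ≤ -c D²` from
some time on, and `D` would blow up in finite time (`frequently_lt_of_differential_inequality`).

For a homotopy, the derivative of `F_s(u(s, ·))` has the additional term `∫ (∂_s f_s)(R) dt ≤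
0`. If equality holds for a trajectory ending in `R₀ < R < R₁`, then `∂_s u = 0` wherever `u` is
in this region, so for each `t` the set of `s` at which `u(s, t)` takes its value at a late time
is open and closed (`F_lt_of_joins`). Finally `F` is constant along the auxiliary flow, where
`Ω_η` vanishes, so it does not increase along cascades, and a coefficient of a weighted count is
zero if there is nothing to count.
-/

noncomputable section

namespace FloerFiltration

variable {E : Type*} [NormedAddCommGroup E] [NormedSpace ℝ E]
  {E' : Type*} [NormedAddCommGroup E'] [NormedSpace ℝ E']
  {M : Type*} [TopologicalSpace M] [ChartedSpace E M]
  {S : Type*} [TopologicalSpace S] [ChartedSpace E' S]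

/-! ### Collar coordinates -/

namespace ConvexSymplecticManifold

variable (C : ConvexSymplecticManifold E E' M S)

theorem mem_source_iff {z : S × ℝ} : z ∈ C.ψ.source ↔ C.c < z.2 := by
  simp [C.source_eq]

theorem R_eq {p : M} (hp : p ∈ C.ψ.target) : C.R p = (C.ψ.symm p).2 := if_pos hp

theorem symm_mem {p : M} (hp : p ∈ C.ψ.target) : C.ψ.symm p ∈ C.ψ.source :=
  C.ψ.toPartialEquiv.map_target hp

theorem psi_symm {p : M} (hp : p ∈ C.ψ.target) : C.ψ (C.ψ.symm p) = p :=
  C.ψ.toPartialEquiv.right_inv hp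

theorem lt_R {p : M} (hp : p ∈ C.ψ.target) : C.c < C.R p := by
  rw [C.R_eq hp, ← C.mem_source_iff]
  exact C.symm_mem hp

theorem le_R (p : M) : C.c ≤ C.R p := by
  by_cases hp : p ∈ C.ψ.target
  · exact (C.lt_R hp).le
  · rw [R, if_neg hp]

theorem mem_target {p : M} (h : C.c < C.R p) : p ∈ C.ψ.target := by
  by_contra hp
  rw [R, if_neg hp] at h
  exact lt_irrefl _ h

theorem contMDiffAt_symm {p : M} (hp : p ∈ C.ψ.target) :
    ContMDiffAt 𝓘(ℝ, E) (𝓘(ℝ, E').prod 𝓘(ℝ, ℝ)) ∞ C.ψ.symm p :=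
  C.ψ.contMDiffOn_invFun.contMDiffAt (C.ψ.open_target.mem_nhds hp)

theorem contMDiffAt_psi {z : S × ℝ} (hz : z ∈ C.ψ.source) :
    ContMDiffAt (𝓘(ℝ, E').prod 𝓘(ℝ, ℝ)) 𝓘(ℝ, E) ∞ C.ψ z :=
  C.ψ.contMDiffOn_toFun.contMDiffAt (C.ψ.open_source.mem_nhds hz)

/-- The radial coordinate is continuous, also at the boundary of the collar: the set `R < b` is
open since the ends `ψ(S × [b, ∞))` are closed. -/
theorem continuous_R : Continuous C.R := by
  rw [continuous_iff_continuousAt]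
  intro p
  by_cases hp : p ∈ C.ψ.target
  · have h1 : ContinuousAt (fun q => (C.ψ.symm q).2) p :=
      (C.contMDiffAt_symm hp).continuousAt.snd
    refine h1.congr ?_
    filter_upwards [C.ψ.open_target.mem_nhds hp] with q hq
    exact (C.R_eq hq).symm
  · have hR : C.R p = C.c := by rw [R, if_neg hp]
    refine tendsto_order.2 ⟨fun a ha => ?_, fun b hb => ?_⟩
    · exact Eventually.of_forall fun q => lt_of_lt_of_le (hR ▸ ha) (C.le_R q)
    · rw [hR] at hb
      have hmem : p ∈ (C.ψ '' (univ ×ˢ Ici b))ᶜ := by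
        rintro ⟨z, hz, rfl⟩
        exact hp (C.ψ.toPartialEquiv.map_source (C.mem_source_iff.2 (lt_of_lt_of_le hb hz.2)))
      filter_upwards [(C.isClosed_end b hb).isOpen_compl.mem_nhds hmem] with q hq
      by_contra hle
      rw [not_lt] at hle
      have hqt : q ∈ C.ψ.target := C.mem_target (lt_of_lt_of_le hb hle)
      exact hq ⟨C.ψ.symm q, ⟨mem_univ _, by rw [C.R_eq hqt] at hle; exact hle⟩, C.psi_symm hqt⟩

/-- The differential of the collar parametrization at the point with image `p`. -/
def dPsi (p : M) (w : TangentSpace 𝓘(ℝ, E') (C.proj p)) (b : ℝ) : TangentSpace 𝓘(ℝ, E) p :=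
  mfderiv (𝓘(ℝ, E').prod 𝓘(ℝ, ℝ)) 𝓘(ℝ, E) C.ψ (C.ψ.symm p) (w, b)

theorem dPsi_dProj {p : M} (hp : p ∈ C.ψ.target) (v : TangentSpace 𝓘(ℝ, E) p) :
    C.dPsi p (C.dProj p v) (C.dR p v) = v := by
  have h1 := (C.contMDiffAt_symm hp).mdifferentiableAt (by simp)
  have h2 := (C.contMDiffAt_psi (C.symm_mem hp)).mdifferentiableAt (by simp)
  have h3 := mfderiv_comp p h2 h1
  have h4 : (C.ψ ∘ C.ψ.symm) =ᶠ[𝓝 p] id := by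
    filter_upwards [C.ψ.open_target.mem_nhds hp] with q hq
    exact C.psi_symm hq
  have h5 := h4.mfderiv_eq (I := 𝓘(ℝ, E)) (I' := 𝓘(ℝ, E))
  rw [mfderiv_id] at h5
  have h6 : (mfderiv 𝓘(ℝ, E) 𝓘(ℝ, E) (C.ψ ∘ C.ψ.symm) p : E →L[ℝ] E) v = v :=
    (congrArg (fun L : E →L[ℝ] E => L v) h5).trans rfl
  exact (congrArg (fun L : E →L[ℝ] E => L v) h3).symm.trans h6

theorem mfderiv_symm_dPsi {p : M} (hp : p ∈ C.ψ.target)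
    (w : TangentSpace 𝓘(ℝ, E') (C.proj p)) (b : ℝ) :
    (mfderiv 𝓘(ℝ, E) (𝓘(ℝ, E').prod 𝓘(ℝ, ℝ)) C.ψ.symm p (C.dPsi p w b) : E' × ℝ) = (w, b) := by
  have h1 := (C.contMDiffAt_symm hp).mdifferentiableAt (by simp)
  have h2 := (C.contMDiffAt_psi (C.symm_mem hp)).mdifferentiableAt (by simp)
  have h1' : MDifferentiableAt 𝓘(ℝ, E) (𝓘(ℝ, E').prod 𝓘(ℝ, ℝ)) C.ψ.symm
      (C.ψ (C.ψ.symm p)) := by rwa [C.psi_symm hp]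
  have h3 := mfderiv_comp (C.ψ.symm p) h1' h2
  have h4 : (C.ψ.symm ∘ C.ψ) =ᶠ[𝓝 (C.ψ.symm p)] id := by
    filter_upwards [C.ψ.open_source.mem_nhds (C.symm_mem hp)] with q hq
    exact C.ψ.toPartialEquiv.left_inv hq
  have h5 := h4.mfderiv_eq (I := 𝓘(ℝ, E').prod 𝓘(ℝ, ℝ)) (I' := 𝓘(ℝ, E').prod 𝓘(ℝ, ℝ))
  rw [mfderiv_id] at h5
  have key : ∀ q, q = p →
      (mfderiv 𝓘(ℝ, E) (𝓘(ℝ, E').prod 𝓘(ℝ, ℝ)) C.ψ.symm q : E →L[ℝ] E' × ℝ)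
        = mfderiv 𝓘(ℝ, E) (𝓘(ℝ, E').prod 𝓘(ℝ, ℝ)) C.ψ.symm p := by
    rintro q rfl; rfl
  rw [← key _ (C.psi_symm hp)]
  exact (congrArg (fun L : E' × ℝ →L[ℝ] E' × ℝ => L (w, b)) (h3.symm.trans h5)).trans rfl

theorem dProj_dPsi {p : M} (hp : p ∈ C.ψ.target)
    (w : TangentSpace 𝓘(ℝ, E') (C.proj p)) (b : ℝ) :
    C.dProj p (C.dPsi p w b) = w :=
  congrArg Prod.fst (C.mfderiv_symm_dPsi hp w b)

theorem dR_dPsi {p : M} (hp : p ∈ C.ψ.target)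
    (w : TangentSpace 𝓘(ℝ, E') (C.proj p)) (b : ℝ) :
    C.dR p (C.dPsi p w b) = b :=
  congrArg Prod.snd (C.mfderiv_symm_dPsi hp w b)

theorem dProj_add (p : M) (v w : TangentSpace 𝓘(ℝ, E) p) :
    C.dProj p (v + w) = C.dProj p v + C.dProj p w := by
  unfold dProj; rw [map_add]; rfl

theorem dProj_smul (p : M) (a : ℝ) (v : TangentSpace 𝓘(ℝ, E) p) :
    C.dProj p (a • v) = a • C.dProj p v := by
  unfold dProj; rw [map_smul]; rfl

theorem dR_add (p : M) (v w : TangentSpace 𝓘(ℝ, E) p) :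
    C.dR p (v + w) = C.dR p v + C.dR p w := by
  unfold dR; rw [map_add]; rfl

theorem dR_smul (p : M) (a : ℝ) (v : TangentSpace 𝓘(ℝ, E) p) :
    C.dR p (a • v) = a * C.dR p v := by
  unfold dR; rw [map_smul]; rfl

/-- The form `α`, lifted to the collar. -/
def theta (p : M) (v : TangentSpace 𝓘(ℝ, E) p) : ℝ := C.α (C.proj p) (C.dProj p v)

/-- The form `dα`, lifted to the collar. -/
def delta (p : M) (v w : TangentSpace 𝓘(ℝ, E) p) : ℝ :=
  C.α.d (C.proj p) (C.dProj p v) (C.dProj p w)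

theorem theta_add (p : M) (v w : TangentSpace 𝓘(ℝ, E) p) :
    C.theta p (v + w) = C.theta p v + C.theta p w := by
  unfold theta; rw [dProj_add, map_add]

theorem theta_smul (p : M) (a : ℝ) (v : TangentSpace 𝓘(ℝ, E) p) :
    C.theta p (a • v) = a * C.theta p v := by
  unfold theta; rw [dProj_smul, map_smul, smul_eq_mul]

end ConvexSymplecticManifold

theorem OneForm.d_swap (α : OneForm E' S) (σ : S) (v w : TangentSpace 𝓘(ℝ, E') σ) :
    α.d σ v w = -α.d σ w v := by
  unfold OneForm.d; ring

theorem OneForm.d_add_left (α : OneForm E' S) (σ : S) (v v' w : TangentSpace 𝓘(ℝ, E') σ) :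
    α.d σ (v + v') w = α.d σ v w + α.d σ v' w := by
  simp only [OneForm.d, map_add, _root_.add_apply]; ring

theorem OneForm.d_smul_left (α : OneForm E' S) (σ : S) (a : ℝ) (v w : TangentSpace 𝓘(ℝ, E') σ) :
    α.d σ (a • v) w = a * α.d σ v w := by
  simp only [OneForm.d, map_smul, _root_.smul_apply, smul_eq_mul]; ring

namespace ConvexSymplecticManifold

variable (C : ConvexSymplecticManifold E E' M S)

theorem delta_swap (p : M) (v w : TangentSpace 𝓘(ℝ, E) p) : C.delta p v w = -C.delta p w v :=
  C.α.d_swap _ _ _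

theorem delta_add_left (p : M) (v v' w : TangentSpace 𝓘(ℝ, E) p) :
    C.delta p (v + v') w = C.delta p v w + C.delta p v' w := by
  unfold delta; rw [dProj_add, OneForm.d_add_left]

theorem delta_smul_left (p : M) (a : ℝ) (v w : TangentSpace 𝓘(ℝ, E) p) :
    C.delta p (a • v) w = a * C.delta p v w := by
  unfold delta; rw [dProj_smul, OneForm.d_smul_left]

theorem delta_add_right (p : M) (v w w' : TangentSpace 𝓘(ℝ, E) p) :
    C.delta p v (w + w') = C.delta p v w + C.delta p v w' := by
  rw [C.delta_swap p v, delta_add_left, C.delta_swap p w v, C.delta_swap p w' v]; ring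

theorem delta_smul_right (p : M) (a : ℝ) (v w : TangentSpace 𝓘(ℝ, E) p) :
    C.delta p v (a • w) = a * C.delta p v w := by
  rw [C.delta_swap p v, delta_smul_left, C.delta_swap p w v]; ring

/-- On the collar, the symplectic form is `dR ∧ α + R dα`. -/
theorem om_eq {p : M} (hp : p ∈ C.ψ.target) (v w : TangentSpace 𝓘(ℝ, E) p) :
    C.om p v w = (C.dR p v * C.theta p w - C.dR p w * C.theta p v) + C.R p * C.delta p v w := by
  have key : ∀ q, q = p → ∀ a b : E,
      (C.om q : E →L[ℝ] E →L[ℝ] ℝ) a b = (C.om p : E →L[ℝ] E →L[ℝ] ℝ) a b := by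
    rintro q rfl a b; rfl
  have h := C.pullback_eq (C.ψ.symm p).1 (C.ψ.symm p).2
    (C.mem_source_iff.1 (C.symm_mem hp)) (C.dProj p v) (C.dProj p w) (C.dR p v) (C.dR p w)
  have h2 := key _ (C.psi_symm hp) (C.dPsi p (C.dProj p v) (C.dR p v))
    (C.dPsi p (C.dProj p w) (C.dR p w))
  rw [C.dPsi_dProj hp, C.dPsi_dProj hp] at h2
  rw [C.R_eq hp]
  exact h2.symm.trans ((congrArg₂ (fun a b : E => (C.om (C.ψ (C.ψ.symm p)) : E →L[ℝ] E →L[ℝ] ℝ) a b)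
    (C.dPsi_dProj hp v).symm (C.dPsi_dProj hp w).symm).trans h)

end ConvexSymplecticManifold

/-! ### The Hamiltonian vector field and the almost complex structure on the collar -/

namespace AdmissiblePair

variable {C : ConvexSymplecticManifold E E' M S} {R₀ : ℝ} (A : AdmissiblePair C R₀)

/-- The Hamiltonian vector field of the Hamiltonian of `A`. -/
def XH (p : M) : TangentSpace 𝓘(ℝ, E) p := hamiltonianField C.om A.H p

theorem differentiable_h : Differentiable ℝ A.h := A.smooth_h.differentiable (by simp)

theorem contDiff_deriv_h : ContDiff ℝ ∞ (deriv A.h) := A.smooth_h.deriv'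

theorem continuous_deriv_h : Continuous (deriv A.h) := A.contDiff_deriv_h.continuous

theorem deriv_h_mono {r : ℝ} (hr : R₀ ≤ r) : deriv A.h R₀ ≤ deriv A.h r := by
  have hmono : MonotoneOn (deriv A.h) (Ici R₀) := by
    refine monotoneOn_of_deriv_nonneg (convex_Ici _) A.continuous_deriv_h.continuousOn
      (A.contDiff_deriv_h.differentiable (by simp)).differentiableOn fun x hx => ?_
    rw [interior_Ici] at hx
    exact A.convex x (le_of_lt hx)
  exact hmono self_mem_Ici hr hr

theorem deriv_h_pos {r : ℝ} (hr : R₀ ≤ r) : 0 < deriv A.h r :=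
  A.slope_pos.trans_le (A.deriv_h_mono hr)

/-- `dH = h'(R) dR` for `R ≥ R₀`. At `R = R₀` only the one-sided derivative of `H` along the
collar is prescribed, which suffices as `H` is smooth. -/
theorem dFun_eq (hR₀ : C.c < R₀) {p : M} (hp : R₀ ≤ C.R p) (v : TangentSpace 𝓘(ℝ, E) p) :
    dFun A.H p v = deriv A.h (C.R p) * C.dR p v := by
  have hpt : p ∈ C.ψ.target := C.mem_target (hR₀.trans_le hp)
  set z := C.ψ.symm p with hz
  have hzs := C.symm_mem hpt
  have hzr : R₀ ≤ z.2 := by rwa [C.R_eq hpt] at hp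
  have hψ : MDifferentiableAt (𝓘(ℝ, E').prod 𝓘(ℝ, ℝ)) 𝓘(ℝ, E) C.ψ z :=
    (C.contMDiffAt_psi hzs).mdifferentiableAt (by simp)
  have hH : MDifferentiableAt 𝓘(ℝ, E) 𝓘(ℝ, ℝ) A.H (C.ψ z) :=
    (A.smooth_H _).mdifferentiableAt (by simp)
  have hB : MDifferentiableAt (𝓘(ℝ, E').prod 𝓘(ℝ, ℝ)) 𝓘(ℝ, ℝ) (A.H ∘ C.ψ) z := hH.comp z hψ
  have hcomp := mfderiv_comp z hH hψ
  -- the derivative along `S`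
  have hS : ∀ w : E', (mfderiv (𝓘(ℝ, E').prod 𝓘(ℝ, ℝ)) 𝓘(ℝ, ℝ) (A.H ∘ C.ψ) z : E' × ℝ →L[ℝ] ℝ)
      (w, 0) = 0 := by
    intro w
    have hi : MDifferentiableAt 𝓘(ℝ, E') (𝓘(ℝ, E').prod 𝓘(ℝ, ℝ)) (fun σ : S => (σ, z.2)) z.1 :=
      mdifferentiableAt_id.prodMk mdifferentiableAt_const
    have h1 := mfderiv_comp z.1 (hB : MDifferentiableAt _ _ (A.H ∘ C.ψ) (z.1, z.2)) hi
    have h2 : (A.H ∘ C.ψ) ∘ (fun σ : S => (σ, z.2)) = fun _ => A.h z.2 := by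
      funext σ; exact A.radial σ z.2 hzr
    rw [h2, mfderiv_const, mfderiv_prod_left] at h1
    exact (congrArg (fun L : E' →L[ℝ] ℝ => L w) h1).symm
  -- the derivative along the half-line
  have hL : ∀ b : ℝ, (mfderiv (𝓘(ℝ, E').prod 𝓘(ℝ, ℝ)) 𝓘(ℝ, ℝ) (A.H ∘ C.ψ) z : E' × ℝ →L[ℝ] ℝ)
      (0, b) = deriv A.h z.2 * b := by
    intro b
    have hi : MDifferentiableAt 𝓘(ℝ, ℝ) (𝓘(ℝ, E').prod 𝓘(ℝ, ℝ)) (fun r : ℝ => (z.1, r)) z.2 :=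
      mdifferentiableAt_const.prodMk mdifferentiableAt_id
    have hB' : MDifferentiableAt (𝓘(ℝ, E').prod 𝓘(ℝ, ℝ)) 𝓘(ℝ, ℝ) (A.H ∘ C.ψ) (z.1, z.2) := hB
    have h1 := mfderiv_comp z.2 hB' hi
    have h3 := (hB'.comp z.2 hi).differentiableAt
    rw [mfderiv_prod_right, mfderiv_eq_fderiv] at h1
    have h4 : HasDerivWithinAt ((A.H ∘ C.ψ) ∘ fun r : ℝ => (z.1, r)) (deriv A.h z.2) (Ici z.2)
        z.2 :=
      (A.differentiable_h z.2).hasDerivAt.hasDerivWithinAt.congr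
        (fun r hr => A.radial z.1 r (hzr.trans hr)) (A.radial z.1 z.2 hzr)
    have h5 := (uniqueDiffWithinAt_Ici z.2).eq_deriv _ h3.hasDerivAt.hasDerivWithinAt h4
    have h6 : (fderiv ℝ ((A.H ∘ C.ψ) ∘ fun r : ℝ => (z.1, r)) z.2 : ℝ →L[ℝ] ℝ) b
        = deriv A.h z.2 * b := by
      rw [← h5, fderiv_eq_smul_deriv, smul_eq_mul, mul_comm]
    exact (congrArg (fun L : ℝ →L[ℝ] ℝ => L b) h1).symm.trans h6
  have key : ∀ q, q = p → ∀ a : E,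
      (dFun A.H q : E →L[ℝ] ℝ) a = (dFun A.H p : E →L[ℝ] ℝ) a := by
    rintro q rfl a; rfl
  have hadd : ∀ (L : E' × ℝ →L[ℝ] ℝ) (k : ℝ), (∀ w, L (w, 0) = 0) → (∀ b, L (0, b) = k * b) →
      ∀ w b, L (w, b) = k * b := by
    intro L k h1 h2 w b
    rw [← h2, ← add_zero (L (0, b)), ← h1 w, ← map_add]; simp
  have h7 := key _ (C.psi_symm hpt) (C.dPsi p (C.dProj p v) (C.dR p v))
  have h8 : (mfderiv (𝓘(ℝ, E').prod 𝓘(ℝ, ℝ)) 𝓘(ℝ, ℝ) (A.H ∘ C.ψ) z : E' × ℝ →L[ℝ] ℝ)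
      (C.dProj p v, C.dR p v) = deriv A.h z.2 * C.dR p v :=
    hadd _ _ hS hL (C.dProj p v) (C.dR p v)
  have h9 := congrArg (fun L : E' × ℝ →L[ℝ] ℝ => L (C.dProj p v, C.dR p v)) hcomp
  rw [C.R_eq hpt]
  have h10 : (dFun A.H p : E →L[ℝ] ℝ) (C.dPsi p (C.dProj p v) (C.dR p v)) = dFun A.H p v :=
    congrArg (fun a : E => (dFun A.H p : E →L[ℝ] ℝ) a) (C.dPsi_dProj hpt v)
  exact h10.symm.trans (h7.symm.trans (h9.symm.trans h8))

section

variable [FiniteDimensional ℝ E]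

theorem om_XH (p : M) (v : TangentSpace 𝓘(ℝ, E) p) : C.om p v (A.XH p) = dFun A.H p v :=
  hamiltonianField_spec C.symplectic A.H p v

/-- On `R ≥ R₀` the Hamiltonian vector field is `h'(R)` times the Reeb vector field. -/
theorem XH_collar (hR₀ : C.c < R₀) {p : M} (hp : R₀ ≤ C.R p) :
    C.theta p (A.XH p) = deriv A.h (C.R p) ∧ C.dR p (A.XH p) = 0 ∧
      ∀ w : TangentSpace 𝓘(ℝ, E') (C.proj p), C.α.d (C.proj p) w (C.dProj p (A.XH p)) = 0 := by
  have hpt : p ∈ C.ψ.target := C.mem_target (hR₀.trans_le hp)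
  have hR : 0 < C.R p := C.c_pos.trans (C.lt_R hpt)
  have hh := A.deriv_h_pos hp
  have key : ∀ (w : TangentSpace 𝓘(ℝ, E') (C.proj p)) (b : ℝ),
      (b * C.theta p (A.XH p) - C.dR p (A.XH p) * C.α (C.proj p) w)
        + C.R p * C.α.d (C.proj p) w (C.dProj p (A.XH p)) = deriv A.h (C.R p) * b := by
    intro w b
    have h1 := A.om_XH p (C.dPsi p w b)
    rw [A.dFun_eq hR₀ hp, C.om_eq hpt, C.dR_dPsi hpt] at h1
    have h2 : C.theta p (C.dPsi p w b) = C.α (C.proj p) w := by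
      unfold ConvexSymplecticManifold.theta; rw [C.dProj_dPsi hpt]
    have h3 : C.delta p (C.dPsi p w b) (A.XH p) = C.α.d (C.proj p) w (C.dProj p (A.XH p)) := by
      unfold ConvexSymplecticManifold.delta; rw [C.dProj_dPsi hpt]
    rwa [h2, h3] at h1
  have hd0 : ∀ w, C.α.d (C.proj p) (0 : TangentSpace 𝓘(ℝ, E') (C.proj p)) w = 0 := by
    intro w
    simpa using C.α.d_smul_left (C.proj p) 0 0 w
  have h1 : C.theta p (A.XH p) = deriv A.h (C.R p) := by
    have := key 0 1
    rw [hd0, map_zero] at this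
    linarith
  have h2 : C.dR p (A.XH p) = 0 := by
    have h3 := key (C.dProj p (A.XH p)) 0
    have h4 := C.α.d_swap (C.proj p) (C.dProj p (A.XH p)) (C.dProj p (A.XH p))
    have h5 : C.α.d (C.proj p) (C.dProj p (A.XH p)) (C.dProj p (A.XH p)) = 0 := by linarith
    have h6 : C.α (C.proj p) (C.dProj p (A.XH p)) = deriv A.h (C.R p) := h1
    rw [h5, h6] at h3
    have h7 : C.dR p (A.XH p) * deriv A.h (C.R p) = 0 := by linarith
    exact (mul_eq_zero.1 h7).resolve_right hh.ne'
  refine ⟨h1, h2, fun w => ?_⟩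
  have h3 := key w 0
  rw [h2] at h3
  have h4 : C.R p * C.α.d (C.proj p) w (C.dProj p (A.XH p)) = 0 := by linarith
  exact (mul_eq_zero.1 h4).resolve_left hR.ne'

theorem isReebVector_XH (hR₀ : C.c < R₀) {p : M} (hp : R₀ ≤ C.R p) :
    IsReebVector C.α (C.proj p) ((deriv A.h (C.R p))⁻¹ • C.dProj p (A.XH p)) := by
  obtain ⟨h1, -, h3⟩ := A.XH_collar hR₀ hp
  have hh := A.deriv_h_pos hp
  refine ⟨?_, fun w => ?_⟩
  · rw [map_smul, smul_eq_mul]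
    have h4 : C.α (C.proj p) (C.dProj p (A.XH p)) = deriv A.h (C.R p) := h1
    rw [h4, inv_mul_cancel₀ hh.ne']
  · rw [OneForm.d_smul_left, OneForm.d_swap, h3]; simp

/-- Positivity of `η` on the collar. In terms of the decomposition of a tangent vector `w` into
its components along `Z = R ∂_R` and `Y` and the component `ξ` in `ker dR ∩ ker α`, which `J`
preserves, `dα(w, J w) = dα(ξ, J ξ)` and `dR ∧ α (w, J w) = dR(w)² / R + R α(w)²`. -/
theorem J_collar (hR₀ : C.c < R₀) {p : M} (hp : R₀ ≤ C.R p) (w : TangentSpace 𝓘(ℝ, E) p) :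
    C.dR p w * C.theta p (A.J p w) - C.dR p (A.J p w) * C.theta p w
        = C.dR p w ^ 2 / C.R p + C.R p * C.theta p w ^ 2 ∧
      0 ≤ C.delta p w (A.J p w) ∧
      (C.delta p w (A.J p w) = 0 → C.dR p w = 0 → C.theta p w = 0 → w = 0) := by
  have hpt : p ∈ C.ψ.target := C.mem_target (hR₀.trans_le hp)
  have hR : 0 < C.R p := C.c_pos.trans (C.lt_R hpt)
  set r := C.R p with hr
  -- `Z`, `Y` and the contact type condition
  obtain ⟨Z, Y, hZr, hZp, hYr, hYθ, hYd, hJZ⟩ : ∃ Z Y : TangentSpace 𝓘(ℝ, E) p,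
      C.dR p Z = r ∧ C.dProj p Z = 0 ∧ C.dR p Y = 0 ∧ C.theta p Y = 1 ∧
        (∀ w, C.delta p Y w = 0) ∧ A.J p Z = Y := by
    have hY := A.isReebVector_XH hR₀ hp
    set y := (deriv A.h (C.R p))⁻¹ • C.dProj p (A.XH p) with hy
    refine ⟨C.dPsi p 0 r, C.dPsi p y 0, C.dR_dPsi hpt _ _, C.dProj_dPsi hpt _ _,
      C.dR_dPsi hpt _ _, ?_, fun w => ?_, ?_⟩
    · unfold ConvexSymplecticManifold.theta; rw [C.dProj_dPsi hpt]; exact hY.1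
    · unfold ConvexSymplecticManifold.delta; rw [C.dProj_dPsi hpt]; exact hY.2 _
    · have hzr : R₀ ≤ (C.ψ.symm p).2 := by rwa [← C.R_eq hpt]
      have h1 := A.contactType (C.ψ.symm p).1 (C.ψ.symm p).2 hzr y hY
      have key : ∀ q, q = p → ∀ a : E, (A.J q : E →L[ℝ] E) a = (A.J p : E →L[ℝ] E) a := by
        rintro q rfl a; rfl
      rw [hr, C.R_eq hpt]
      exact (key _ (C.psi_symm hpt) _).symm.trans h1
  have hZθ : C.theta p Z = 0 := by
    unfold ConvexSymplecticManifold.theta; rw [hZp, map_zero]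
  have hZd : ∀ w, C.delta p Z w = 0 := by
    intro w
    unfold ConvexSymplecticManifold.delta
    rw [hZp]
    simpa using C.α.d_smul_left (C.proj p) 0 0 (C.dProj p w)
  have hJY : A.J p Y = (-1 : ℝ) • Z := by rw [← hJZ, A.compatible.sq, neg_one_smul]
  have hωZ : ∀ w, C.om p Z w = r * C.theta p w := by
    intro w
    rw [C.om_eq hpt, hZr, hZθ, hZd]; ring
  have hωY : ∀ w, C.om p Y w = -C.dR p w := by
    intro w
    rw [C.om_eq hpt, hYr, hYθ, hYd]; ring
  have hθJ : r * C.theta p (A.J p w) = C.dR p w := by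
    have h := A.compatible.invariant p Z (A.J p w)
    rw [hJZ, A.compatible.sq, map_neg, hωY, hωZ] at h
    linarith
  have hρJ : C.dR p (A.J p w) = -(r * C.theta p w) := by
    have h := A.compatible.invariant p Z w
    rw [hJZ, hωY, hωZ] at h
    linarith
  have hθJ' : C.theta p (A.J p w) = C.dR p w / r := by
    rw [eq_div_iff hR.ne', mul_comm]; exact hθJ
  -- the component of `w` in the contact planes
  set ξ : TangentSpace 𝓘(ℝ, E) p := w + ((-(C.dR p w / r)) • Z + (-C.theta p w) • Y) with hξ
  have hξr : C.dR p ξ = 0 := by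
    rw [hξ, C.dR_add, C.dR_add, C.dR_smul, C.dR_smul, hZr, hYr]
    field_simp; ring
  have hξθ : C.theta p ξ = 0 := by
    rw [hξ, C.theta_add, C.theta_add, C.theta_smul, C.theta_smul, hZθ, hYθ]; ring
  have hJξ : A.J p ξ = A.J p w + ((-(C.dR p w / r)) • Y + (C.theta p w) • Z) := by
    rw [hξ, map_add, map_add, map_smul, map_smul, hJZ, hJY, smul_smul]
    congr 3; ring
  have hδZ : ∀ w, C.delta p w Z = 0 := fun w => by rw [C.delta_swap, hZd, neg_zero]
  have hδY : ∀ w, C.delta p w Y = 0 := fun w => by rw [C.delta_swap, hYd, neg_zero]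
  have hδ : C.delta p w (A.J p w) = C.delta p ξ (A.J p ξ) := by
    rw [hJξ, hξ]
    simp only [C.delta_add_left, C.delta_add_right, C.delta_smul_left, C.delta_smul_right, hZd,
      hYd, hδZ, hδY]
    ring
  have hω : C.om p ξ (A.J p ξ) = r * C.delta p w (A.J p w) := by
    rw [hδ, C.om_eq hpt, hξr, hξθ]; ring
  have hpos : ξ ≠ 0 → 0 < r * C.delta p w (A.J p w) := fun h => hω ▸ A.compatible.pos p ξ h
  refine ⟨by rw [hθJ', hρJ]; ring, ?_, fun h0 h1 h2 => ?_⟩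
  · by_cases h : ξ = 0
    · rw [h, map_zero, map_zero] at hω
      rw [(mul_eq_zero.1 hω.symm).resolve_left hR.ne']
    · exact (pos_of_mul_pos_right (hpos h) hR.le).le
  · have h3 : ξ = 0 := by
      by_contra h
      have := hpos h
      rw [h0, mul_zero] at this
      exact lt_irrefl _ this
    rw [h1, h2] at hξ
    simpa [h3] using hξ.symm

end

end AdmissiblePair

/-! ### Pulling back forms along maps from a vector space -/

section Pullback

variable {W : Type*} [NormedAddCommGroup W] [NormedSpace ℝ W]

/-- The value of the pullback `σ^* α` of a 1-form on the constant vector field `e`. -/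
def OneForm.along (α : OneForm E' S) (σ : W → S) (e : W) (q : W) : ℝ :=
  α (σ q) (mfderiv 𝓘(ℝ, W) 𝓘(ℝ, E') σ q e)

theorem contDiffAt_chart {σ : W → S} {q₀ : W}
    (hσ : ContMDiffAt 𝓘(ℝ, W) 𝓘(ℝ, E') ∞ σ q₀) :
    ContDiffAt ℝ ∞ (fun q' => extChartAt 𝓘(ℝ, E') (σ q₀) (σ q')) q₀ :=
  contMDiffAt_iff_contDiffAt.1
    ((contMDiffAt_extChartAt (I := 𝓘(ℝ, E')) (x := σ q₀)).comp q₀ hσ)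

theorem OneForm.contDiffAt_rep {α : OneForm E' S}
    (hα : ∀ x₀ : S, ContDiffOn ℝ ∞ (α.rep x₀) (extChartAt 𝓘(ℝ, E') x₀).target) (σ₀ : S) :
    ContDiffAt ℝ ∞ (α.rep σ₀) (extChartAt 𝓘(ℝ, E') σ₀ σ₀) :=
  (hα σ₀).contDiffAt (extChartAt_target_mem_nhds σ₀)

variable [IsManifold 𝓘(ℝ, E') ∞ S]

theorem OneForm.along_eventuallyEq (α : OneForm E' S) {σ : W → S} {q₀ : W}
    (hσ : ∀ᶠ q in 𝓝 q₀, ContMDiffAt 𝓘(ℝ, W) 𝓘(ℝ, E') ∞ σ q) (e : W) :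
    α.along σ e =ᶠ[𝓝 q₀] fun q => α.rep (σ q₀) (extChartAt 𝓘(ℝ, E') (σ q₀) (σ q))
      (fderiv ℝ (fun q' => extChartAt 𝓘(ℝ, E') (σ q₀) (σ q')) q e) := by
  have hsrc : ∀ᶠ q in 𝓝 q₀, σ q ∈ (extChartAt 𝓘(ℝ, E') (σ q₀)).source :=
    hσ.self_of_nhds.continuousAt.eventually (extChartAt_source_mem_nhds (σ q₀))
  filter_upwards [hσ, hsrc, hsrc.eventually_nhds] with q hq hqs hqs'
  set y : W → E' := fun q' => extChartAt 𝓘(ℝ, E') (σ q₀) (σ q') with hy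
  have hyd : MDifferentiableAt 𝓘(ℝ, W) 𝓘(ℝ, E') y q := by
    have h1 : ContMDiffAt 𝓘(ℝ, E') 𝓘(ℝ, E') ∞ (extChartAt 𝓘(ℝ, E') (σ q₀)) (σ q) :=
      contMDiffAt_extChartAt' (by simpa using hqs)
    exact (h1.comp q hq).mdifferentiableAt (by simp)
  have hsd : MDifferentiableAt 𝓘(ℝ, E') 𝓘(ℝ, E') (extChartAt 𝓘(ℝ, E') (σ q₀)).symm (y q) := by
    have h1 := (contMDiffOn_extChartAt_symm (I := 𝓘(ℝ, E')) (n := ∞) (σ q₀)).contMDiffAt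
      ((isOpen_extChartAt_target (σ q₀)).mem_nhds
        ((extChartAt 𝓘(ℝ, E') (σ q₀)).map_source hqs))
    exact h1.mdifferentiableAt (by simp)
  have hcomp := mfderiv_comp q hsd hyd
  have heq : (extChartAt 𝓘(ℝ, E') (σ q₀)).symm ∘ y =ᶠ[𝓝 q] σ := by
    filter_upwards [hqs'] with q' hq'
    exact (extChartAt 𝓘(ℝ, E') (σ q₀)).left_inv hq'
  have h2 := heq.mfderiv_eq (I := 𝓘(ℝ, W)) (I' := 𝓘(ℝ, E'))
  rw [mfderiv_eq_fderiv] at hcomp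
  have key : ∀ p, p = σ q → ∀ a : E', (α p : E' →L[ℝ] ℝ) a = (α (σ q) : E' →L[ℝ] ℝ) a := by
    rintro p rfl a; rfl
  have h3 : (mfderiv 𝓘(ℝ, W) 𝓘(ℝ, E') σ q : W →L[ℝ] E') e
      = (mfderiv 𝓘(ℝ, E') 𝓘(ℝ, E') (extChartAt 𝓘(ℝ, E') (σ q₀)).symm (y q) : E' →L[ℝ] E')
        (fderiv ℝ y q e) :=
    congrArg (fun L : W →L[ℝ] E' => L e) (h2.symm.trans hcomp)
  exact (congrArg (fun a : E' => (α (σ q) : E' →L[ℝ] ℝ) a) h3).trans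
    (key _ heq.self_of_nhds _).symm

theorem OneForm.contDiffAt_along {α : OneForm E' S}
    (hα : ∀ x₀ : S, ContDiffOn ℝ ∞ (α.rep x₀) (extChartAt 𝓘(ℝ, E') x₀).target) {σ : W → S}
    {q₀ : W} (hσ : ∀ᶠ q in 𝓝 q₀, ContMDiffAt 𝓘(ℝ, W) 𝓘(ℝ, E') ∞ σ q) (e : W) :
    ContDiffAt ℝ ∞ (α.along σ e) q₀ := by
  refine ContDiffAt.congr_of_eventuallyEq ?_ (α.along_eventuallyEq hσ e)
  have hy := contDiffAt_chart hσ.self_of_nhds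
  have ha : ContDiffAt ℝ ∞ (α.rep (σ q₀) ∘ fun q => extChartAt 𝓘(ℝ, E') (σ q₀) (σ q)) q₀ :=
    (OneForm.contDiffAt_rep hα (σ q₀)).comp q₀ hy
  refine ContDiffAt.clm_apply ha ?_
  exact (hy.fderiv_right (m := ∞) (by simp)).clm_apply contDiffAt_const

/-- The exterior derivative is natural: on the constant vector fields `e₁`, `e₂` of a vector
space, `d(σ^*α)(e₁, e₂) = dα(dσ e₁, dσ e₂)`. -/
theorem OneForm.fderiv_along {α : OneForm E' S}
    (hα : ∀ x₀ : S, ContDiffOn ℝ ∞ (α.rep x₀) (extChartAt 𝓘(ℝ, E') x₀).target) {σ : W → S}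
    {q₀ : W} (hσ : ∀ᶠ q in 𝓝 q₀, ContMDiffAt 𝓘(ℝ, W) 𝓘(ℝ, E') ∞ σ q) (e₁ e₂ : W) :
    fderiv ℝ (α.along σ e₂) q₀ e₁ - fderiv ℝ (α.along σ e₁) q₀ e₂
      = α.d (σ q₀) (mfderiv 𝓘(ℝ, W) 𝓘(ℝ, E') σ q₀ e₁) (mfderiv 𝓘(ℝ, W) 𝓘(ℝ, E') σ q₀ e₂) := by
  set y : W → E' := fun q' => extChartAt 𝓘(ℝ, E') (σ q₀) (σ q') with hy
  have hyc : ContDiffAt ℝ ∞ y q₀ := contDiffAt_chart hσ.self_of_nhds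
  have hac := OneForm.contDiffAt_rep hα (σ q₀)
  have hy1 : HasFDerivAt y (fderiv ℝ y q₀) q₀ := (hyc.differentiableAt (by simp)).hasFDerivAt
  have hy2 : HasFDerivAt (fderiv ℝ y) (fderiv ℝ (fderiv ℝ y) q₀) q₀ :=
    ((hyc.fderiv_right (m := ∞) (by simp)).differentiableAt
      (by simp)).hasFDerivAt
  have ha : HasFDerivAt (α.rep (σ q₀)) (fderiv ℝ (α.rep (σ q₀)) (y q₀)) (y q₀) :=
    (hac.differentiableAt (by simp)).hasFDerivAt
  have hsymm : fderiv ℝ (fderiv ℝ y) q₀ e₁ e₂ = fderiv ℝ (fderiv ℝ y) q₀ e₂ e₁ :=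
    ((hyc.of_le (m := 2) (WithTop.coe_le_coe.2 (le_top : (2 : ℕ∞) ≤ ⊤))).isSymmSndFDerivAt
      (by simp)).eq e₁ e₂
  have hder : ∀ e e' : W, fderiv ℝ (α.along σ e) q₀ e'
      = fderiv ℝ (α.rep (σ q₀)) (y q₀) (fderiv ℝ y q₀ e') (fderiv ℝ y q₀ e)
        + α.rep (σ q₀) (y q₀) (fderiv ℝ (fderiv ℝ y) q₀ e' e) := by
    intro e e'
    rw [(α.along_eventuallyEq hσ e).fderiv_eq]
    have h1 := (ha.comp q₀ hy1).clm_apply (hy2.clm_apply (hasFDerivAt_const e q₀))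
    have h2 := congrArg (fun L : W →L[ℝ] ℝ => L e') h1.fderiv
    refine h2.trans ?_
    simp [add_comm]
  have hD : ∀ e : W, chartD (σ q₀) (σ q₀) (mfderiv 𝓘(ℝ, W) 𝓘(ℝ, E') σ q₀ e)
      = fderiv ℝ y q₀ e := by
    intro e
    have h1 := (contMDiffAt_extChartAt (I := 𝓘(ℝ, E')) (n := ∞)
      (x := σ q₀)).mdifferentiableAt (by simp)
    have h2 := mfderiv_comp q₀ h1 (hσ.self_of_nhds.mdifferentiableAt (by simp))
    have h3 : mfderiv 𝓘(ℝ, W) 𝓘(ℝ, E') (extChartAt 𝓘(ℝ, E') (σ q₀) ∘ σ) q₀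
        = fderiv ℝ y q₀ := mfderiv_eq_fderiv
    rw [h3] at h2
    exact (congrArg (fun L : W →L[ℝ] E' => L e) h2).symm
  rw [hder, hder, hsymm]
  unfold OneForm.d
  rw [hD, hD]
  ring

end Pullback

/-! ### Functions of the radial coordinate and the form `χ(R) α` -/

/-- A weight: a function that may replace the cut-off function in the definition of the filtration
functional, without affecting exactness and negativity. -/
structure IsWeight (χ : ℝ → ℝ) (R₀ : ℝ) : Prop where
  smooth : ContDiff ℝ ∞ χ
  monotone : Monotone χ
  eq_zero : ∀ r, r ≤ R₀ → χ r = 0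

theorem IsCutoff.isWeight {φ : ℝ → ℝ} {R₀ : ℝ} (h : IsCutoff φ R₀) : IsWeight φ R₀ :=
  ⟨h.smooth, h.monotone, h.eq_zero⟩

theorem deriv_eq_zero_of_eq_zero {g : ℝ → ℝ} {R₀ : ℝ} (hg : Differentiable ℝ g)
    (h : ∀ r, r ≤ R₀ → g r = 0) {r : ℝ} (hr : r ≤ R₀) : deriv g r = 0 := by
  have h1 : HasDerivWithinAt g 0 (Iic r) r :=
    (hasDerivWithinAt_const r (Iic r) (0 : ℝ)).congr (fun x hx => h x (le_trans hx hr)) (h r hr)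
  exact (uniqueDiffWithinAt_Iic r).eq_deriv _ (hg r).hasDerivAt.hasDerivWithinAt h1

theorem IsWeight.deriv_eq_zero {χ : ℝ → ℝ} {R₀ : ℝ} (h : IsWeight χ R₀) {r : ℝ} (hr : r ≤ R₀) :
    deriv χ r = 0 :=
  deriv_eq_zero_of_eq_zero (h.smooth.differentiable (by simp)) h.eq_zero hr

theorem IsWeight.deriv_nonneg {χ : ℝ → ℝ} {R₀ : ℝ} (h : IsWeight χ R₀) (r : ℝ) : 0 ≤ deriv χ r :=
  h.monotone.deriv_nonneg

theorem IsWeight.nonneg {χ : ℝ → ℝ} {R₀ : ℝ} (h : IsWeight χ R₀) (r : ℝ) : 0 ≤ χ r := by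
  rcases le_total r R₀ with hr | hr
  · exact (h.eq_zero r hr).ge
  · exact (h.eq_zero R₀ le_rfl).ge.trans (h.monotone hr)

namespace ConvexSymplecticManifold

variable (C : ConvexSymplecticManifold E E' M S) {R₀ : ℝ}

theorem contMDiffAt_R {p : M} (hp : p ∈ C.ψ.target) : ContMDiffAt 𝓘(ℝ, E) 𝓘(ℝ, ℝ) ∞ C.R p := by
  have h1 := (contMDiffAt_snd (I := 𝓘(ℝ, E')) (J := 𝓘(ℝ, ℝ)) (n := ∞)
    (p := C.ψ.symm p)).comp p (C.contMDiffAt_symm hp)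
  refine h1.congr_of_eventuallyEq ?_
  filter_upwards [C.ψ.open_target.mem_nhds hp] with q hq
  exact C.R_eq hq

theorem mfderiv_R {p : M} (hp : p ∈ C.ψ.target) (v : TangentSpace 𝓘(ℝ, E) p) :
    (mfderiv 𝓘(ℝ, E) 𝓘(ℝ, ℝ) C.R p v : ℝ) = C.dR p v := by
  have h1 := (C.contMDiffAt_symm hp).mdifferentiableAt (by simp)
  have h2 := mfderiv_comp p
    (mdifferentiableAt_snd (I := 𝓘(ℝ, E')) (I' := 𝓘(ℝ, ℝ)) (x := C.ψ.symm p)) h1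
  have h3 : C.R =ᶠ[𝓝 p] Prod.snd ∘ C.ψ.symm := by
    filter_upwards [C.ψ.open_target.mem_nhds hp] with q hq
    exact C.R_eq hq
  have h4 := h3.mfderiv_eq (I := 𝓘(ℝ, E)) (I' := 𝓘(ℝ, ℝ))
  rw [mfderiv_snd] at h2
  exact congrArg (fun L : E →L[ℝ] ℝ => L v) (h4.trans h2)

theorem contMDiffAt_proj {p : M} (hp : p ∈ C.ψ.target) :
    ContMDiffAt 𝓘(ℝ, E) 𝓘(ℝ, E') ∞ C.proj p :=
  (contMDiffAt_fst (I := 𝓘(ℝ, E')) (J := 𝓘(ℝ, ℝ)) (n := ∞)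
    (p := C.ψ.symm p)).comp p (C.contMDiffAt_symm hp)

theorem mfderiv_proj {p : M} (hp : p ∈ C.ψ.target) (v : TangentSpace 𝓘(ℝ, E) p) :
    mfderiv 𝓘(ℝ, E) 𝓘(ℝ, E') C.proj p v = C.dProj p v := by
  have h1 := (C.contMDiffAt_symm hp).mdifferentiableAt (by simp)
  have h2 := mfderiv_comp p
    (mdifferentiableAt_fst (I := 𝓘(ℝ, E')) (I' := 𝓘(ℝ, ℝ)) (x := C.ψ.symm p)) h1
  rw [mfderiv_fst] at h2
  exact congrArg (fun L : E →L[ℝ] E' => L v) h2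

theorem eventually_R_lt {p : M} {b : ℝ} (hp : C.R p < b) : ∀ᶠ q in 𝓝 p, C.R q < b :=
  C.continuous_R.continuousAt.eventually (gt_mem_nhds hp)

/-- A function of `R` that vanishes for `R ≤ R₀` is smooth on all of `M`. -/
theorem contMDiff_comp_R (hR₀ : C.c < R₀) {n : ℕ∞} {g : ℝ → ℝ} (hg : ContDiff ℝ n g)
    (h0 : ∀ r, r ≤ R₀ → g r = 0) : ContMDiff 𝓘(ℝ, E) 𝓘(ℝ, ℝ) n (g ∘ C.R) := by
  intro p
  by_cases hp : p ∈ C.ψ.target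
  · exact hg.contMDiff.contMDiffAt.comp p
      ((C.contMDiffAt_R hp).of_le (by exact_mod_cast le_top))
  · have hR : C.R p < R₀ := by rwa [R, if_neg hp]
    refine (contMDiffAt_const (c := (0 : ℝ))).congr_of_eventuallyEq ?_
    filter_upwards [C.eventually_R_lt hR] with q hq
    exact h0 _ hq.le

theorem mfderiv_comp_R (hR₀ : C.c < R₀) {g : ℝ → ℝ} (hg : Differentiable ℝ g)
    (h0 : ∀ r, r ≤ R₀ → g r = 0) (p : M) (v : TangentSpace 𝓘(ℝ, E) p) :
    (mfderiv 𝓘(ℝ, E) 𝓘(ℝ, ℝ) (g ∘ C.R) p v : ℝ) = deriv g (C.R p) * C.dR p v := by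
  by_cases hp : p ∈ C.ψ.target
  · have h1 := mfderiv_comp p (hg (C.R p)).mdifferentiableAt
      ((C.contMDiffAt_R hp).mdifferentiableAt (by simp))
    rw [mfderiv_eq_fderiv] at h1
    have h2 : (mfderiv 𝓘(ℝ, E) 𝓘(ℝ, ℝ) (g ∘ C.R) p v : ℝ)
        = fderiv ℝ g (C.R p) (mfderiv 𝓘(ℝ, E) 𝓘(ℝ, ℝ) C.R p v : ℝ) :=
      congrArg (fun L : E →L[ℝ] ℝ => L v) h1
    rw [h2, C.mfderiv_R hp, fderiv_eq_smul_deriv, smul_eq_mul, mul_comm]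
  · have hR : C.R p < R₀ := by rwa [R, if_neg hp]
    have h1 : g ∘ C.R =ᶠ[𝓝 p] fun _ => (0 : ℝ) := by
      filter_upwards [C.eventually_R_lt hR] with q hq
      exact h0 _ hq.le
    have h2 := h1.mfderiv_eq (I := 𝓘(ℝ, E)) (I' := 𝓘(ℝ, ℝ))
    rw [mfderiv_const] at h2
    rw [deriv_eq_zero_of_eq_zero hg h0 hR.le, zero_mul]
    exact congrArg (fun L : E →L[ℝ] ℝ => L v) h2

theorem cutoffForm_eq_zero {χ : ℝ → ℝ} (h0 : ∀ r, r ≤ R₀ → χ r = 0) {p : M} (hp : C.R p ≤ R₀)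
    (v : TangentSpace 𝓘(ℝ, E) p) : C.cutoffForm χ p v = 0 := by
  unfold cutoffForm
  rw [h0 _ hp]
  simp

theorem cutoffForm_eq {p : M} (hp : p ∈ C.ψ.target) (χ : ℝ → ℝ)
    (v : TangentSpace 𝓘(ℝ, E) p) : C.cutoffForm χ p v = χ (C.R p) * C.theta p v :=
  if_pos hp

theorem eta_eq {p : M} (hp : p ∈ C.ψ.target) (χ : ℝ → ℝ) (v w : TangentSpace 𝓘(ℝ, E) p) :
    C.eta χ p v w = χ (C.R p) * C.delta p v w
      + deriv χ (C.R p) * (C.dR p v * C.theta p w - C.dR p w * C.theta p v) :=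
  if_pos hp

theorem eta_eq_zero {χ : ℝ → ℝ} (hχ : IsWeight χ R₀) {p : M} (hp : C.R p ≤ R₀)
    (v w : TangentSpace 𝓘(ℝ, E) p) : C.eta χ p v w = 0 := by
  unfold eta
  rw [hχ.eq_zero _ hp, hχ.deriv_eq_zero hp]
  simp

section Pullback

variable {W : Type*} [NormedAddCommGroup W] [NormedSpace ℝ W]

/-- The value of the pullback `U^*(χ(R) α)` on the constant vector field `e`. -/
def cutoffAlong (χ : ℝ → ℝ) (U : W → M) (e : W) (q : W) : ℝ :=
  C.cutoffForm χ (U q) (mfderiv 𝓘(ℝ, W) 𝓘(ℝ, E) U q e)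

theorem mfderiv_proj_comp {U : W → M} (hU : ContMDiff 𝓘(ℝ, W) 𝓘(ℝ, E) ∞ U) {q : W}
    (hq : U q ∈ C.ψ.target) (e : W) :
    mfderiv 𝓘(ℝ, W) 𝓘(ℝ, E') (C.proj ∘ U) q e
      = C.dProj (U q) (mfderiv 𝓘(ℝ, W) 𝓘(ℝ, E) U q e) := by
  have h1 := mfderiv_comp q ((C.contMDiffAt_proj hq).mdifferentiableAt (by simp))
    ((hU q).mdifferentiableAt (by simp))
  rw [← C.mfderiv_proj hq]
  exact congrArg (fun L : W →L[ℝ] E' => L e) h1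

theorem fderiv_R_comp {U : W → M} (hU : ContMDiff 𝓘(ℝ, W) 𝓘(ℝ, E) ∞ U) {q : W}
    (hq : U q ∈ C.ψ.target) (e : W) :
    fderiv ℝ (C.R ∘ U) q e = C.dR (U q) (mfderiv 𝓘(ℝ, W) 𝓘(ℝ, E) U q e) := by
  have h1 := mfderiv_comp q ((C.contMDiffAt_R hq).mdifferentiableAt (by simp))
    ((hU q).mdifferentiableAt (by simp))
  rw [← C.mfderiv_R hq]
  rw [mfderiv_eq_fderiv] at h1
  exact congrArg (fun L : W →L[ℝ] ℝ => L e) h1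

theorem eventually_mem_target {U : W → M} (hU : ContMDiff 𝓘(ℝ, W) 𝓘(ℝ, E) ∞ U) {q₀ : W}
    (hq : U q₀ ∈ C.ψ.target) : ∀ᶠ q in 𝓝 q₀, U q ∈ C.ψ.target :=
  hU.continuous.continuousAt.eventually (C.ψ.open_target.mem_nhds hq)

theorem cutoffAlong_eventuallyEq {χ : ℝ → ℝ} {U : W → M}
    (hU : ContMDiff 𝓘(ℝ, W) 𝓘(ℝ, E) ∞ U) {q₀ : W} (hq : U q₀ ∈ C.ψ.target) (e : W) :
    C.cutoffAlong χ U e =ᶠ[𝓝 q₀] fun q => χ ((C.R ∘ U) q) * C.α.along (C.proj ∘ U) e q := by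
  filter_upwards [C.eventually_mem_target hU hq] with q hq'
  unfold cutoffAlong OneForm.along
  rw [C.cutoffForm_eq hq', C.mfderiv_proj_comp hU hq']
  rfl

theorem cutoffAlong_eventuallyEq_zero {χ : ℝ → ℝ} (h0 : ∀ r, r ≤ R₀ → χ r = 0) {U : W → M}
    (hU : ContMDiff 𝓘(ℝ, W) 𝓘(ℝ, E) ∞ U) {q₀ : W} (hq : C.R (U q₀) < R₀) (e : W) :
    C.cutoffAlong χ U e =ᶠ[𝓝 q₀] fun _ => 0 := by
  filter_upwards [hU.continuous.continuousAt.eventually (C.eventually_R_lt hq)] with q hq'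
  exact C.cutoffForm_eq_zero h0 hq'.le _

theorem contDiffAt_R_comp {U : W → M} (hU : ContMDiff 𝓘(ℝ, W) 𝓘(ℝ, E) ∞ U) {q₀ : W}
    (hq : U q₀ ∈ C.ψ.target) : ContDiffAt ℝ ∞ (C.R ∘ U) q₀ :=
  contMDiffAt_iff_contDiffAt.1 ((C.contMDiffAt_R hq).comp q₀ (hU q₀))

variable [IsManifold 𝓘(ℝ, E') ∞ S]

theorem contDiff_cutoffAlong (hR₀ : C.c < R₀) {χ : ℝ → ℝ} (hχ : IsWeight χ R₀) {U : W → M}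
    (hU : ContMDiff 𝓘(ℝ, W) 𝓘(ℝ, E) ∞ U) (e : W) : ContDiff ℝ ∞ (C.cutoffAlong χ U e) := by
  rw [contDiff_iff_contDiffAt]
  intro q₀
  by_cases hq : U q₀ ∈ C.ψ.target
  · refine ContDiffAt.congr_of_eventuallyEq ?_ (C.cutoffAlong_eventuallyEq hU hq e)
    refine (hχ.smooth.contDiffAt.comp q₀ (C.contDiffAt_R_comp hU hq)).mul
      (OneForm.contDiffAt_along C.contact.smooth ?_ e)
    filter_upwards [C.eventually_mem_target hU hq] with q hq'
    exact (C.contMDiffAt_proj hq').comp q (hU q)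
  · have hR : C.R (U q₀) < R₀ := by rwa [R, if_neg hq]
    exact contDiffAt_const.congr_of_eventuallyEq
      (C.cutoffAlong_eventuallyEq_zero hχ.eq_zero hU hR e)

/-- `η` is the exterior derivative of `χ(R) α`, evaluated along a map from a vector space. -/
theorem fderiv_cutoffAlong (hR₀ : C.c < R₀) {χ : ℝ → ℝ} (hχ : IsWeight χ R₀) {U : W → M}
    (hU : ContMDiff 𝓘(ℝ, W) 𝓘(ℝ, E) ∞ U) (e₁ e₂ : W) (q₀ : W) :
    fderiv ℝ (C.cutoffAlong χ U e₂) q₀ e₁ - fderiv ℝ (C.cutoffAlong χ U e₁) q₀ e₂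
      = C.eta χ (U q₀) (mfderiv 𝓘(ℝ, W) 𝓘(ℝ, E) U q₀ e₁) (mfderiv 𝓘(ℝ, W) 𝓘(ℝ, E) U q₀ e₂) := by
  by_cases hq : U q₀ ∈ C.ψ.target
  · have hσ : ∀ᶠ q in 𝓝 q₀, ContMDiffAt 𝓘(ℝ, W) 𝓘(ℝ, E') ∞ (C.proj ∘ U) q := by
      filter_upwards [C.eventually_mem_target hU hq] with q hq'
      exact (C.contMDiffAt_proj hq').comp q (hU q)
    have hR := ((C.contDiffAt_R_comp hU hq).differentiableAt (by simp)).hasFDerivAt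
    have hχd := (hχ.smooth.differentiable (by simp) ((C.R ∘ U) q₀)).hasDerivAt
    have hder : ∀ e e' : W, fderiv ℝ (C.cutoffAlong χ U e) q₀ e'
        = χ (C.R (U q₀)) * fderiv ℝ (C.α.along (C.proj ∘ U) e) q₀ e'
          + deriv χ (C.R (U q₀)) * fderiv ℝ (C.R ∘ U) q₀ e' * C.α.along (C.proj ∘ U) e q₀ := by
      intro e e'
      rw [(C.cutoffAlong_eventuallyEq hU hq e).fderiv_eq]
      have ha := ((OneForm.contDiffAt_along C.contact.smooth hσ e).differentiableAt
        (by simp)).hasFDerivAt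
      have h1 := (hχd.comp_hasFDerivAt q₀ hR).mul ha
      have h2 := congrArg (fun L : W →L[ℝ] ℝ => L e') h1.fderiv
      refine h2.trans ?_
      simp
      ring
    have hal : ∀ e, C.α.along (C.proj ∘ U) e q₀
        = C.theta (U q₀) (mfderiv 𝓘(ℝ, W) 𝓘(ℝ, E) U q₀ e) := by
      intro e
      unfold OneForm.along
      rw [C.mfderiv_proj_comp hU hq]
      rfl
    have hd := OneForm.fderiv_along C.contact.smooth hσ e₁ e₂
    rw [C.mfderiv_proj_comp hU hq, C.mfderiv_proj_comp hU hq] at hd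
    have hd' : fderiv ℝ (C.α.along (C.proj ∘ U) e₂) q₀ e₁
        - fderiv ℝ (C.α.along (C.proj ∘ U) e₁) q₀ e₂
        = C.delta (U q₀) (mfderiv 𝓘(ℝ, W) 𝓘(ℝ, E) U q₀ e₁)
          (mfderiv 𝓘(ℝ, W) 𝓘(ℝ, E) U q₀ e₂) := hd
    rw [C.eta_eq hq, hder, hder, hal, hal, ← hd', C.fderiv_R_comp hU hq, C.fderiv_R_comp hU hq]
    ring
  · have hR : C.R (U q₀) < R₀ := by rwa [R, if_neg hq]
    rw [(C.cutoffAlong_eventuallyEq_zero hχ.eq_zero hU hR e₁).fderiv_eq,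
      (C.cutoffAlong_eventuallyEq_zero hχ.eq_zero hU hR e₂).fderiv_eq,
      C.eta_eq_zero hχ hR.le]
    simp

end Pullback

end ConvexSymplecticManifold

/-! ### Exactness -/

theorem hasDerivAt_intervalIntegral {k k' : ℝ → ℝ → ℝ}
    (hk : ∀ s t, HasDerivAt (fun s' => k s' t) (k' s t) s)
    (hc : Continuous fun q : ℝ × ℝ => k q.1 q.2) (hc' : Continuous fun q : ℝ × ℝ => k' q.1 q.2)
    (a b s₀ : ℝ) :
    HasDerivAt (fun s => ∫ t in a..b, k s t) (∫ t in a..b, k' s₀ t) s₀ := by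
  have hsec : ∀ s, Continuous (k s) := fun s => hc.comp (by fun_prop : Continuous fun t => (s, t))
  have hsec' : ∀ s, Continuous (k' s) :=
    fun s => hc'.comp (by fun_prop : Continuous fun t => (s, t))
  obtain ⟨K, hK⟩ := ((isCompact_closedBall s₀ 1).prod
    (isCompact_uIcc (a := a) (b := b))).bddAbove_image hc'.norm.continuousOn
  refine (intervalIntegral.hasDerivAt_integral_of_dominated_loc_of_deriv_le (bound := fun _ => K)
    (F := k) (F' := k') (s := Metric.closedBall s₀ 1) (Metric.closedBall_mem_nhds s₀ one_pos)
    ?_ ?_ ?_ ?_ ?_ ?_).2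
  · exact Eventually.of_forall fun s => (hsec s).aestronglyMeasurable
  · exact (hsec s₀).intervalIntegrable _ _
  · exact (hsec' s₀).aestronglyMeasurable
  · refine Eventually.of_forall fun t ht s hs => ?_
    exact hK ⟨(s, t), ⟨hs, uIoc_subset_uIcc ht⟩, rfl⟩
  · exact intervalIntegrable_const
  · exact Eventually.of_forall fun t _ s _ => hk s t

namespace LoopCurve

variable (u : LoopCurve E M)

/-- The map `ℝ × ℝ → M` underlying a curve of loops. -/
def map (q : ℝ × ℝ) : M := u q.1 q.2

theorem smooth_map : ContMDiff 𝓘(ℝ, ℝ × ℝ) 𝓘(ℝ, E) ∞ u.map := u.smooth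

theorem ds_eq (s t : ℝ) :
    u.ds s t = mfderiv 𝓘(ℝ, ℝ × ℝ) 𝓘(ℝ, E) u.map (s, t) ((1, 0) : ℝ × ℝ) := by
  have hi : HasFDerivAt (fun s' : ℝ => (s', t)) (ContinuousLinearMap.inl ℝ ℝ ℝ) s :=
    hasFDerivAt_prodMk_left s t
  have h1 := mfderiv_comp s ((u.smooth_map (s, t)).mdifferentiableAt (by simp))
    hi.differentiableAt.mdifferentiableAt
  rw [mfderiv_eq_fderiv, hi.fderiv] at h1
  exact (congrArg (fun L : ℝ →L[ℝ] E => L 1) h1).trans rfl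

theorem dt_eq (s t : ℝ) :
    (u s).dt t = mfderiv 𝓘(ℝ, ℝ × ℝ) 𝓘(ℝ, E) u.map (s, t) ((0, 1) : ℝ × ℝ) := by
  have hi : HasFDerivAt (fun t' : ℝ => (s, t')) (ContinuousLinearMap.inr ℝ ℝ ℝ) t :=
    hasFDerivAt_prodMk_right s t
  have h1 := mfderiv_comp t ((u.smooth_map (s, t)).mdifferentiableAt (by simp))
    hi.differentiableAt.mdifferentiableAt
  rw [mfderiv_eq_fderiv, hi.fderiv] at h1
  exact (congrArg (fun L : ℝ →L[ℝ] E => L 1) h1).trans rfl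

theorem ds_periodic (C : ConvexSymplecticManifold E E' M S) (χ : ℝ → ℝ) (s t : ℝ) :
    C.cutoffForm χ (u s (t + 1)) (u.ds s (t + 1)) = C.cutoffForm χ (u s t) (u.ds s t) := by
  have h : (fun s' => u s' (t + 1)) = fun s' => u s' t := funext fun s' => (u s').periodic t
  exact congrArg (fun γ : ℝ → M => C.cutoffForm χ (γ s) (velocity γ s)) h

end LoopCurve

theorem hasDerivAt_fst_of_contDiff {n : WithTop ℕ∞} {k : ℝ × ℝ → ℝ} (hk : ContDiff ℝ n k)
    (hn : n ≠ 0) (s t : ℝ) :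
    HasDerivAt (fun s' => k (s', t)) (fderiv ℝ k (s, t) (1, 0)) s := by
  have h1 := (hk.differentiable hn (s, t)).hasFDerivAt
  have h2 := h1.comp_hasDerivAt s ((hasDerivAt_id s).prodMk (hasDerivAt_const s t))
  exact h2

theorem hasDerivAt_snd_of_contDiff {n : WithTop ℕ∞} {k : ℝ × ℝ → ℝ} (hk : ContDiff ℝ n k)
    (hn : n ≠ 0) (s t : ℝ) :
    HasDerivAt (fun t' => k (s, t')) (fderiv ℝ k (s, t) (0, 1)) t := by
  have h1 := (hk.differentiable hn (s, t)).hasFDerivAt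
  have h2 := h1.comp_hasDerivAt t ((hasDerivAt_const t s).prodMk (hasDerivAt_id t))
  exact h2

theorem continuous_fderiv_apply_of_contDiff {k : ℝ × ℝ → ℝ} (hk : ContDiff ℝ ∞ k) (e : ℝ × ℝ) :
    Continuous fun q => fderiv ℝ k q e :=
  (hk.continuous_fderiv (by simp)).clm_apply continuous_const

theorem continuous_fderiv_section {k : ℝ × ℝ → ℝ} (hk : ContDiff ℝ ∞ k) (e : ℝ × ℝ) (s : ℝ) :
    Continuous fun t => fderiv ℝ k (s, t) e :=
  (continuous_fderiv_apply_of_contDiff hk e).comp (by fun_prop : Continuous fun t : ℝ => (s, t))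

namespace AdmissiblePair

variable {C : ConvexSymplecticManifold E E' M S} {R₀ : ℝ} (A : AdmissiblePair C R₀)
  {χ : ℝ → ℝ}

theorem continuous_f_integrand (hχ : IsWeight χ R₀) :
    Continuous fun τ => deriv χ τ * deriv A.h τ :=
  (hχ.smooth.continuous_deriv (by simp)).mul A.continuous_deriv_h

theorem hasDerivAt_f (hχ : IsWeight χ R₀) (r : ℝ) :
    HasDerivAt (A.f χ) (deriv χ r * deriv A.h r) r :=
  intervalIntegral.integral_hasDerivAt_right
    ((A.continuous_f_integrand hχ).intervalIntegrable _ _)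
    ((A.continuous_f_integrand hχ).stronglyMeasurableAtFilter _ _)
    (A.continuous_f_integrand hχ).continuousAt

theorem deriv_f (hχ : IsWeight χ R₀) : deriv (A.f χ) = fun r => deriv χ r * deriv A.h r :=
  funext fun r => (A.hasDerivAt_f hχ r).deriv

theorem contDiff_f (hχ : IsWeight χ R₀) : ContDiff ℝ ∞ (A.f χ) := by
  rw [contDiff_infty_iff_deriv]
  refine ⟨fun r => (A.hasDerivAt_f hχ r).differentiableAt, ?_⟩
  rw [A.deriv_f hχ]
  exact hχ.smooth.deriv'.mul A.contDiff_deriv_h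

theorem f_eq_zero (hR₀ : C.c < R₀) (hχ : IsWeight χ R₀) (r : ℝ) (hr : r ≤ R₀) :
    A.f χ r = 0 := by
  have h0 : (0 : ℝ) ≤ R₀ := (C.c_pos.trans hR₀).le
  unfold f
  rw [intervalIntegral.integral_congr (g := fun _ => (0 : ℝ))]
  · simp
  · intro τ hτ
    have : τ ≤ R₀ := hτ.2.trans (max_le h0 hr)
    simp [hχ.deriv_eq_zero this]

theorem contDiff_f_comp (hR₀ : C.c < R₀) (hχ : IsWeight χ R₀) (u : LoopCurve E M) :
    ContDiff ℝ ∞ (A.f χ ∘ C.R ∘ u.map) :=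
  contMDiff_iff_contDiff.1 ((C.contMDiff_comp_R hR₀ (n := ⊤) (A.contDiff_f hχ)
    (A.f_eq_zero hR₀ hχ)).comp u.smooth_map)

/-- Differentiation of `∫ x^*(χ α)` along a curve of loops: the term `∂_t(χ α(∂_s u))` integrates to
zero over a period. -/
theorem hasDerivAt_integral_cutoffForm [IsManifold 𝓘(ℝ, E') ∞ S] (hR₀ : C.c < R₀) (hχ : IsWeight χ R₀)
    (u : LoopCurve E M) (s : ℝ) :
    HasDerivAt (fun s' => ∫ t in (0 : ℝ)..1, C.cutoffForm χ (u s' t) ((u s').dt t))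
      (∫ t in (0 : ℝ)..1, (fderiv ℝ (C.cutoffAlong χ u.map ((0, 1) : ℝ × ℝ)) (s, t) (1, 0)
        - fderiv ℝ (C.cutoffAlong χ u.map ((1, 0) : ℝ × ℝ)) (s, t) (0, 1))) s := by
  have hP := C.contDiff_cutoffAlong hR₀ hχ u.smooth_map ((0, 1) : ℝ × ℝ)
  have hQ := C.contDiff_cutoffAlong hR₀ hχ u.smooth_map ((1, 0) : ℝ × ℝ)
  have hPeq : ∀ s t, C.cutoffForm χ (u s t) ((u s).dt t)
      = C.cutoffAlong χ u.map ((0, 1) : ℝ × ℝ) (s, t) := fun s t => by rw [u.dt_eq]; rfl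
  have hQeq : ∀ s t, C.cutoffForm χ (u s t) (u.ds s t)
      = C.cutoffAlong χ u.map ((1, 0) : ℝ × ℝ) (s, t) := fun s t => by rw [u.ds_eq]; rfl
  have h1 := hasDerivAt_intervalIntegral
    (k := fun s t => C.cutoffAlong χ u.map ((0, 1) : ℝ × ℝ) (s, t))
    (fun s t => hasDerivAt_fst_of_contDiff hP (by simp) s t) hP.continuous
    (continuous_fderiv_apply_of_contDiff hP _) 0 1 s
  have h2 : ∫ t in (0 : ℝ)..1,
      fderiv ℝ (C.cutoffAlong χ u.map ((1, 0) : ℝ × ℝ)) (s, t) (0, 1) = 0 := by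
    rw [intervalIntegral.integral_eq_sub_of_hasDerivAt
      (fun t _ => hasDerivAt_snd_of_contDiff hQ (by simp) s t)
      ((continuous_fderiv_section hQ _ s).intervalIntegrable _ _)]
    have h3 := u.ds_periodic C χ s 0
    rw [zero_add, hQeq, hQeq] at h3
    rw [h3, sub_self]
  simp only [hPeq]
  rw [intervalIntegral.integral_sub
    ((continuous_fderiv_section hP _ s).intervalIntegrable _ _)
    ((continuous_fderiv_section hQ _ s).intervalIntegrable _ _), h2, sub_zero]
  exact h1

section

variable [FiniteDimensional ℝ E]

/-- `η(v, X_H) = df(v)`. -/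
theorem eta_sub_XH (hR₀ : C.c < R₀) (hχ : IsWeight χ R₀) (p : M)
    (v w : TangentSpace 𝓘(ℝ, E) p) :
    C.eta χ p v (w - A.XH p) = C.eta χ p v w - deriv (A.f χ) (C.R p) * C.dR p v := by
  simp only [A.deriv_f hχ]
  rcases le_total (C.R p) R₀ with hp | hp
  · rw [C.eta_eq_zero hχ hp, C.eta_eq_zero hχ hp, hχ.deriv_eq_zero hp]; ring
  · have hpt : p ∈ C.ψ.target := C.mem_target (hR₀.trans_le hp)
    obtain ⟨h1, h2, h3⟩ := A.XH_collar hR₀ hp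
    have h4 : C.delta p v (A.XH p) = 0 := h3 _
    have h5 : w - A.XH p = w + (-1 : ℝ) • A.XH p := by rw [neg_one_smul, sub_eq_add_neg]
    rw [h5, C.eta_eq hpt, C.eta_eq hpt, C.delta_add_right, C.delta_smul_right, C.theta_add,
      C.theta_smul, C.dR_add, C.dR_smul, h1, h2, h4]
    ring

variable [IsManifold 𝓘(ℝ, E') ∞ S]

/-- The integrand of `Ω_η(∂_s u)`, as a combination of derivatives of smooth functions on the
plane. -/
theorem eta_ds_eq (hR₀ : C.c < R₀) (hχ : IsWeight χ R₀) (u : LoopCurve E M) (s t : ℝ) :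
    C.eta χ (u s t) (u.ds s t) ((u s).dt t - A.XH (u s t))
      = fderiv ℝ (C.cutoffAlong χ u.map ((0, 1) : ℝ × ℝ)) (s, t) (1, 0)
        - fderiv ℝ (C.cutoffAlong χ u.map ((1, 0) : ℝ × ℝ)) (s, t) (0, 1)
        - fderiv ℝ (A.f χ ∘ C.R ∘ u.map) (s, t) (1, 0) := by
  have h1 := C.fderiv_cutoffAlong hR₀ hχ u.smooth_map ((1, 0) : ℝ × ℝ) ((0, 1) : ℝ × ℝ) (s, t)
  rw [h1, A.eta_sub_XH hR₀ hχ, u.ds_eq, u.dt_eq]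
  congr 1
  have hfd := (A.contDiff_f hχ).differentiable (by simp)
  have hf0 := A.f_eq_zero hR₀ hχ
  have h2 := mfderiv_comp (s, t)
    ((C.contMDiff_comp_R hR₀ (n := ⊤) (A.contDiff_f hχ) hf0 (u.map (s, t))).mdifferentiableAt
      (by simp))
    ((u.smooth_map (s, t)).mdifferentiableAt (by simp))
  rw [mfderiv_eq_fderiv] at h2
  rw [← u.ds_eq, ← C.mfderiv_comp_R hR₀ hfd hf0, u.ds_eq]
  exact (congrArg (fun L : ℝ × ℝ →L[ℝ] ℝ => L (1, 0)) h2).symm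

theorem continuous_eta_ds (hR₀ : C.c < R₀) (hχ : IsWeight χ R₀) (u : LoopCurve E M) :
    Continuous fun q : ℝ × ℝ =>
      C.eta χ (u q.1 q.2) (u.ds q.1 q.2) ((u q.1).dt q.2 - A.XH (u q.1 q.2)) := by
  simp only [A.eta_ds_eq hR₀ hχ u]
  exact ((continuous_fderiv_apply_of_contDiff
    (C.contDiff_cutoffAlong hR₀ hχ u.smooth_map _) _).sub (continuous_fderiv_apply_of_contDiff
    (C.contDiff_cutoffAlong hR₀ hχ u.smooth_map _) _)).sub
    (continuous_fderiv_apply_of_contDiff (A.contDiff_f_comp hR₀ hχ u) _)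

/-- `F` is a primitive of `Ω_η`, for any weight in place of the cut-off function. -/
theorem hasDerivAt_F (hR₀ : C.c < R₀) (hχ : IsWeight χ R₀) (u : LoopCurve E M) (s : ℝ) :
    HasDerivAt (fun s' => A.F χ (u s')) (A.Omega χ (u s) (u.ds s)) s := by
  have hP := C.contDiff_cutoffAlong hR₀ hχ u.smooth_map ((0, 1) : ℝ × ℝ)
  have hQ := C.contDiff_cutoffAlong hR₀ hχ u.smooth_map ((1, 0) : ℝ × ℝ)
  have hf := A.contDiff_f_comp hR₀ hχ u
  have h1 := hasDerivAt_integral_cutoffForm hR₀ hχ u s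
  have h2 := hasDerivAt_intervalIntegral
    (k := fun s t => A.f χ (C.R (u s t)))
    (fun s t => hasDerivAt_fst_of_contDiff hf (by simp) s t) hf.continuous
    (continuous_fderiv_apply_of_contDiff hf _) 0 1 s
  refine (h1.neg.add h2).congr_deriv ?_
  unfold Omega
  have h3 : ∀ t, C.eta χ (u s t) (u.ds s t) ((u s).dt t - hamiltonianField C.om A.H (u s t)) = _ :=
    fun t => A.eta_ds_eq hR₀ hχ u s t
  simp only [h3]
  have hPQ : Continuous fun t => fderiv ℝ (C.cutoffAlong χ u.map ((0, 1) : ℝ × ℝ)) (s, t) (1, 0)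
      - fderiv ℝ (C.cutoffAlong χ u.map ((1, 0) : ℝ × ℝ)) (s, t) (0, 1) :=
    (continuous_fderiv_section hP _ s).sub (continuous_fderiv_section hQ _ s)
  rw [intervalIntegral.integral_sub (hPQ.intervalIntegrable _ _)
    ((continuous_fderiv_section hf _ s).intervalIntegrable _ _)]
  ring

end

end AdmissiblePair

/-! ### Negativity -/

namespace ConvexSymplecticManifold

variable (C : ConvexSymplecticManifold E E' M S) {R₀ : ℝ}

theorem eta_swap (χ : ℝ → ℝ) (p : M) (v w : TangentSpace 𝓘(ℝ, E) p) :
    C.eta χ p v w = -C.eta χ p w v := by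
  unfold eta
  split_ifs
  · rw [C.α.d_swap (C.proj p) (C.dProj p v)]; ring
  · simp

theorem eta_neg_left (χ : ℝ → ℝ) (p : M) (v w : TangentSpace 𝓘(ℝ, E) p) :
    C.eta χ p (-v) w = -C.eta χ p v w := by
  by_cases hp : p ∈ C.ψ.target
  · rw [← neg_one_smul ℝ v, C.eta_eq hp, C.eta_eq hp, C.delta_smul_left, C.theta_smul, C.dR_smul]
    ring
  · unfold eta
    rw [if_neg hp, if_neg hp, neg_zero]

theorem continuous_cutoffForm_loop [IsManifold 𝓘(ℝ, E') ∞ S] (hR₀ : C.c < R₀) {χ : ℝ → ℝ}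
    (hχ : IsWeight χ R₀) (x : Loop E M) :
    Continuous fun t => C.cutoffForm χ (x t) (x.dt t) :=
  (C.contDiff_cutoffAlong hR₀ hχ x.smooth (1 : ℝ)).continuous

end ConvexSymplecticManifold

namespace AdmissiblePair

variable {C : ConvexSymplecticManifold E E' M S} {R₀ : ℝ} (A : AdmissiblePair C R₀)
  {χ : ℝ → ℝ}

/-- The Floer equation at time `s`. -/
def FloerAt (u : LoopCurve E M) (s : ℝ) : Prop :=
  ∀ t, u.ds s t + A.J (u s t) ((u s).dt t - A.XH (u s t)) = 0

section

variable [FiniteDimensional ℝ E]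

theorem eta_of_floer (hR₀ : C.c < R₀) (χ : ℝ → ℝ) {p : M} (hp : R₀ ≤ C.R p)
    {v w : TangentSpace 𝓘(ℝ, E) p} (h : v + A.J p w = 0) :
    C.eta χ p v w = χ (C.R p) * C.delta p w (A.J p w)
      + deriv χ (C.R p) * (C.dR p w ^ 2 / C.R p + C.R p * C.theta p w ^ 2) := by
  rw [eq_neg_of_add_eq_zero_left h, C.eta_neg_left, C.eta_swap, neg_neg,
    C.eta_eq (C.mem_target (hR₀.trans_le hp)), (A.J_collar hR₀ hp w).1]

theorem le_eta_of_floer (hR₀ : C.c < R₀) (hχ : IsWeight χ R₀) {p : M}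
    {v w : TangentSpace 𝓘(ℝ, E) p} (h : v + A.J p w = 0) :
    R₀ * (deriv χ (C.R p) * C.theta p w ^ 2) ≤ C.eta χ p v w := by
  rcases le_total (C.R p) R₀ with hp | hp
  · rw [C.eta_eq_zero hχ hp, hχ.deriv_eq_zero hp]; simp
  · rw [A.eta_of_floer hR₀ χ hp h]
    have h1 := mul_nonneg (hχ.nonneg (C.R p)) (A.J_collar hR₀ hp w).2.1
    have h0 : 0 < C.R p := (C.c_pos.trans hR₀).trans_le hp
    have h2 : R₀ * C.theta p w ^ 2 ≤ C.dR p w ^ 2 / C.R p + C.R p * C.theta p w ^ 2 := by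
      have := div_nonneg (sq_nonneg (C.dR p w)) h0.le
      have := mul_le_mul_of_nonneg_right hp (sq_nonneg (C.theta p w))
      linarith
    have h3 := mul_le_mul_of_nonneg_left h2 (hχ.deriv_nonneg (C.R p))
    linarith

theorem eta_nonneg_of_floer (hR₀ : C.c < R₀) (hχ : IsWeight χ R₀) {p : M}
    {v w : TangentSpace 𝓘(ℝ, E) p} (h : v + A.J p w = 0) : 0 ≤ C.eta χ p v w :=
  (mul_nonneg (C.c_pos.trans hR₀).le (mul_nonneg (hχ.deriv_nonneg _) (sq_nonneg _))).trans
    (A.le_eta_of_floer hR₀ hχ h)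

theorem Omega_nonpos (hR₀ : C.c < R₀) (hχ : IsWeight χ R₀) {u : LoopCurve E M} {s : ℝ}
    (hu : A.FloerAt u s) : A.Omega χ (u s) (u.ds s) ≤ 0 := by
  unfold Omega
  rw [neg_nonpos]
  exact intervalIntegral.integral_nonneg zero_le_one
    fun t _ => A.eta_nonneg_of_floer hR₀ hχ (hu t)

variable [IsManifold 𝓘(ℝ, E') ∞ S]

theorem continuous_eta_section (hR₀ : C.c < R₀) (hχ : IsWeight χ R₀) (u : LoopCurve E M) (s : ℝ) :
    Continuous fun t => C.eta χ (u s t) (u.ds s t) ((u s).dt t - A.XH (u s t)) :=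
  (A.continuous_eta_ds hR₀ hχ u).comp (by fun_prop : Continuous fun t : ℝ => (s, t))

theorem antitone_F (hR₀ : C.c < R₀) (hχ : IsWeight χ R₀) {u : LoopCurve E M}
    (hu : ∀ s, A.FloerAt u s) : Antitone fun s => A.F χ (u s) :=
  antitone_of_hasDerivAt_nonpos (A.hasDerivAt_F hR₀ hχ u) fun s => A.Omega_nonpos hR₀ hχ (hu s)

end

/-! ### The functional on 1-orbits -/

/-- The integrand of `F` on 1-orbits, as a function of the radial coordinate. -/
def reduced (χ : ℝ → ℝ) (r : ℝ) : ℝ := A.f χ r - χ r * deriv A.h r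

theorem continuous_reduced (hχ : IsWeight χ R₀) : Continuous (A.reduced χ) :=
  (A.contDiff_f hχ).continuous.sub (hχ.smooth.continuous.mul A.continuous_deriv_h)

theorem continuous_R_loop (x : Loop E M) : Continuous fun t => C.R (x t) :=
  C.continuous_R.comp x.smooth.continuous

/-- The integral of a function of the radial coordinate is continuous for uniform convergence of
loops. -/
theorem tendsto_integral_R {u : ℝ → Loop E M} {l : Filter ℝ} [l.IsCountablyGenerated]
    {x : Loop E M} (hu : LoopTendsto u l x) {g : ℝ → ℝ} (hg : Continuous g) :
    Tendsto (fun s => ∫ t in (0 : ℝ)..1, g (C.R (u s t))) l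
      (𝓝 (∫ t in (0 : ℝ)..1, g (C.R (x t)))) := by
  refine TendstoUniformlyOn.tendsto_intervalIntegral_of_continuousOn
    (Eventually.of_forall fun s => (hg.comp (continuous_R_loop (u s))).continuousOn) ?_
  rw [← tendstoLocallyUniformlyOn_iff_tendstoUniformlyOn_of_compact isCompact_uIcc,
    tendstoLocallyUniformlyOn_iff_forall_tendsto]
  intro t _
  have h1 : Tendsto (fun q : ℝ × ℝ => g (C.R (u q.1 q.2))) (l ×ˢ 𝓝[uIcc 0 1] t)
      (𝓝 (g (C.R (x t)))) :=
    (((hg.comp C.continuous_R).tendsto (x t)).comp (hu t)).mono_left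
      (Filter.prod_mono le_rfl nhdsWithin_le_nhds)
  have h2 : Tendsto (fun q : ℝ × ℝ => g (C.R (x q.2))) (l ×ˢ 𝓝[uIcc 0 1] t)
      (𝓝 (g (C.R (x t)))) :=
    (((hg.comp (continuous_R_loop x)).tendsto t).mono_left nhdsWithin_le_nhds).comp tendsto_snd
  have h3 := h2.prodMk_nhds h1
  exact h3.mono_right (nhds_le_uniformity _)

theorem eventually_R_le {u : ℝ → Loop E M} {l : Filter ℝ} {x : Loop E M}
    (hu : LoopTendsto u l x) :
    ∃ b, ∀ᶠ s in l, ∀ t ∈ Icc (0 : ℝ) 1, C.R (u s t) ≤ b := by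
  obtain ⟨b, hb⟩ := (isCompact_Icc (a := (0 : ℝ)) (b := 1)).bddAbove_image
    (continuous_R_loop (C := C) x).continuousOn
  refine ⟨b + 1, ?_⟩
  have h1 : ∀ t ∈ Icc (0 : ℝ) 1, ∀ᶠ q in l ×ˢ 𝓝 t, C.R (u q.1 q.2) < b + 1 := by
    intro t ht
    have h2 : C.R (x t) < b + 1 := (hb ⟨t, ht, rfl⟩).trans_lt (lt_add_one b)
    exact (hu t).eventually (C.eventually_R_lt h2)
  have h3 : ∀ᶠ q in l ×ˢ 𝓝ˢ (Icc (0 : ℝ) 1), C.R (u q.1 q.2) < b + 1 := by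
    rw [isCompact_Icc.prod_nhdsSet_eq_biSup]
    simpa using h1
  obtain ⟨p, hp, q, hq, hpq⟩ := eventually_prod_iff.1 h3
  filter_upwards [hp] with s hs t ht
  exact (hpq hs (hq.self_of_nhdsSet t ht)).le

section

variable [FiniteDimensional ℝ E]

theorem cutoffForm_sub_XH (hR₀ : C.c < R₀) (hχ : IsWeight χ R₀) (p : M)
    (v : TangentSpace 𝓘(ℝ, E) p) :
    C.cutoffForm χ p (v - A.XH p) = C.cutoffForm χ p v - χ (C.R p) * deriv A.h (C.R p) := by
  rcases le_total (C.R p) R₀ with hp | hp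
  · rw [C.cutoffForm_eq_zero hχ.eq_zero hp, C.cutoffForm_eq_zero hχ.eq_zero hp,
      hχ.eq_zero _ hp]; ring
  · have hpt : p ∈ C.ψ.target := C.mem_target (hR₀.trans_le hp)
    rw [C.cutoffForm_eq hpt, C.cutoffForm_eq hpt, sub_eq_add_neg, ← neg_one_smul ℝ (A.XH p),
      C.theta_add, C.theta_smul, (A.XH_collar hR₀ hp).1]
    ring

variable [IsManifold 𝓘(ℝ, E') ∞ S]

theorem continuous_cutoffForm_sub_XH (hR₀ : C.c < R₀) (hχ : IsWeight χ R₀) (x : Loop E M) :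
    Continuous fun t => C.cutoffForm χ (x t) (x.dt t - A.XH (x t)) := by
  simp only [A.cutoffForm_sub_XH hR₀ hχ]
  exact (C.continuous_cutoffForm_loop hR₀ hχ x).sub
    ((hχ.smooth.continuous.mul A.continuous_deriv_h).comp (continuous_R_loop x))

theorem F_eq (hR₀ : C.c < R₀) (hχ : IsWeight χ R₀) (x : Loop E M) :
    A.F χ x = -(∫ t in (0 : ℝ)..1, C.cutoffForm χ (x t) (x.dt t - A.XH (x t)))
      + ∫ t in (0 : ℝ)..1, A.reduced χ (C.R (x t)) := by
  have h1 := (C.continuous_cutoffForm_loop hR₀ hχ x).intervalIntegrable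
    (μ := MeasureTheory.volume) 0 1
  have h2 := ((hχ.smooth.continuous.mul A.continuous_deriv_h).comp
    (continuous_R_loop (C := C) x)).intervalIntegrable (μ := MeasureTheory.volume) 0 1
  have h3 := ((A.contDiff_f hχ).continuous.comp
    (continuous_R_loop (C := C) x)).intervalIntegrable (μ := MeasureTheory.volume) 0 1
  have e1 := intervalIntegral.integral_sub h1 h2
  have e2 := intervalIntegral.integral_sub h3 h2
  simp only [A.cutoffForm_sub_XH hR₀ hχ, reduced, F]
  simp only [Function.comp_apply, Pi.mul_apply] at e1 e2
  rw [e1, e2]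
  ring

theorem F_orbit (hR₀ : C.c < R₀) (hχ : IsWeight χ R₀) {x : Loop E M} (hx : C.IsOneOrbit A.H x) :
    A.F χ x = ∫ t in (0 : ℝ)..1, A.reduced χ (C.R (x t)) := by
  have h0 : ∀ p, C.cutoffForm χ p (0 : TangentSpace 𝓘(ℝ, E) p) = 0 := by
    intro p
    by_cases hp : p ∈ C.ψ.target
    · have := C.theta_smul p 0 0
      rw [zero_smul, zero_mul] at this
      rw [C.cutoffForm_eq hp, this, mul_zero]
    · exact if_neg hp
  have h1 : ∀ t, C.cutoffForm χ (x t) (x.dt t - A.XH (x t)) = 0 := by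
    intro t
    have h2 : x.dt t = A.XH (x t) := hx t
    rw [h2, sub_self, h0]
  rw [A.F_eq hR₀ hχ]
  simp [h1]

end

end AdmissiblePair

/-! ### A differential inequality -/

theorem sub_le_of_hasDerivAt_le {D D' : ℝ → ℝ} {a k : ℝ}
    (hD : ∀ s, a ≤ s → HasDerivAt D (D' s) s) (hk : ∀ s, a ≤ s → D' s ≤ k) {s : ℝ} (hs : a ≤ s) :
    D s - D a ≤ k * (s - a) := by
  refine (convex_Ici a).image_sub_le_mul_sub_of_deriv_le
    (fun s hs => (hD s hs).continuousAt.continuousWithinAt)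
    (fun s hs => (hD s (interior_subset hs)).differentiableAt.differentiableWithinAt)
    (fun s hs => ?_) a self_mem_Ici s hs hs
  rw [(hD s (interior_subset hs)).deriv]
  exact hk s (interior_subset hs)

/-- If `D' ≤ -c m²` and `|D - e| ≤ K m` with `e` convergent, then `m` takes arbitrarily small values:
otherwise `D` tends to `-∞`, so `D' ≤ -c' D²`, and `D` would tend to `-∞` in finite time. -/
theorem frequently_lt_of_differential_inequality {D D' m e : ℝ → ℝ} {c K e₀ : ℝ} (hc : 0 < c)
    (hK : 0 < K) (hD : ∀ᶠ s in atTop, HasDerivAt D (D' s) s)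
    (hD' : ∀ᶠ s in atTop, D' s ≤ -c * m s ^ 2) (hm : ∀ᶠ s in atTop, |D s - e s| ≤ K * m s)
    (he : Tendsto e atTop (𝓝 e₀)) {δ : ℝ} (hδ : 0 < δ) : ∃ᶠ s in atTop, m s < δ := by
  intro hcon
  have hB : ∀ᶠ s in atTop, |e s| < |e₀| + 1 := he.abs.eventually (gt_mem_nhds (lt_add_one _))
  set B := |e₀| + 1 with hBdef
  have hB0 : 0 < B := by positivity
  obtain ⟨a, ha⟩ := eventually_atTop.1 (hcon.and (hD.and (hD'.and (hm.and hB))))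
  have hlin : ∀ s, a ≤ s → D s - D a ≤ (-c * δ ^ 2) * (s - a) := by
    intro s hs
    refine sub_le_of_hasDerivAt_le (fun s hs => (ha s hs).2.1) (fun s hs => ?_) hs
    obtain ⟨h1, -, h2, -⟩ := ha s hs
    rw [not_lt] at h1
    have h3 : δ ^ 2 ≤ m s ^ 2 := pow_le_pow_left₀ hδ.le h1 2
    nlinarith
  -- from `b` on, `D` is so negative that `e` is negligible
  obtain ⟨b, hab, hb⟩ : ∃ b, a ≤ b ∧ ∀ s, b ≤ s → D s ≤ -(2 * B) := by
    have hcδ : 0 < c * δ ^ 2 := by positivity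
    refine ⟨a + |D a + 2 * B| / (c * δ ^ 2), by
      have : 0 ≤ |D a + 2 * B| / (c * δ ^ 2) := by positivity
      linarith, fun s hs => ?_⟩
    have h0 : 0 ≤ |D a + 2 * B| / (c * δ ^ 2) := by positivity
    have h1 := hlin s (by linarith)
    have h2 : |D a + 2 * B| ≤ c * δ ^ 2 * (s - a) := by
      have h3 : |D a + 2 * B| / (c * δ ^ 2) ≤ s - a := by linarith
      rw [div_le_iff₀ hcδ] at h3
      linarith
    have h4 := le_abs_self (D a + 2 * B)
    linarith
  have hneg : ∀ s, b ≤ s → D s < 0 := fun s hs => by linarith [hb s hs]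
  set c' := c / (4 * K ^ 2) with hc'
  have hc'0 : 0 < c' := by positivity
  have hquad : ∀ s, b ≤ s → D' s ≤ -c' * D s ^ 2 := by
    intro s hs
    obtain ⟨-, -, h2, h3, h4⟩ := ha s (hab.trans hs)
    have h5 := hb s hs
    have h6 : -D s ≤ 2 * (K * m s) := by
      have h7 := (abs_le.1 h3).1
      have h8 := (abs_lt.1 h4).1
      linarith
    have h9 : D s ^ 2 ≤ 4 * K ^ 2 * m s ^ 2 := by
      have h10 : 0 ≤ -D s := by linarith
      have := pow_le_pow_left₀ h10 h6 2
      nlinarith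
    have h11 : c' * D s ^ 2 ≤ c * m s ^ 2 := by
      rw [hc', div_mul_eq_mul_div, div_le_iff₀ (by positivity)]
      nlinarith
    linarith
  have hinv : ∀ s, b ≤ s → -(D s)⁻¹ - -(D b)⁻¹ ≤ -c' * (s - b) := by
    intro s hs
    refine sub_le_of_hasDerivAt_le (D := fun s => -(D s)⁻¹)
      (fun s hs => ((ha s (hab.trans hs)).2.1.inv (hneg s hs).ne).neg) (fun s hs => ?_) hs
    have h1 : 0 < D s ^ 2 := sq_pos_of_neg (hneg s hs)
    rw [neg_div, neg_neg, div_le_iff₀ h1]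
    exact hquad s hs
  have h1 := hinv (b + (-(D b)⁻¹) / c') (by
    have : 0 < -(D b)⁻¹ := neg_pos.2 (inv_lt_zero.2 (hneg b le_rfl))
    have : 0 < (-(D b)⁻¹) / c' := by positivity
    linarith)
  have h2 : 0 < -(D b)⁻¹ / c' :=
    div_pos (neg_pos.2 (inv_lt_zero.2 (hneg b le_rfl))) hc'0
  have h3 : 0 < -(D (b + -(D b)⁻¹ / c'))⁻¹ :=
    neg_pos.2 (inv_lt_zero.2 (hneg _ (by linarith)))
  have h4 : -c' * (b + -(D b)⁻¹ / c' - b) = (D b)⁻¹ := by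
    field_simp; ring
  rw [h4] at h1
  linarith

theorem sq_integral_le {g : ℝ → ℝ} (hg : Continuous g) :
    (∫ t in (0 : ℝ)..1, g t) ^ 2 ≤ ∫ t in (0 : ℝ)..1, g t ^ 2 := by
  set I := ∫ t in (0 : ℝ)..1, g t with hI
  have h1 : 0 ≤ ∫ t in (0 : ℝ)..1, (g t - I) ^ 2 :=
    intervalIntegral.integral_nonneg zero_le_one fun t _ => sq_nonneg _
  have h2 : ∀ t, (g t - I) ^ 2 = (g t ^ 2 - 2 * I * g t) + I ^ 2 := fun t => by ring
  have h3 : Continuous fun t => g t ^ 2 - 2 * I * g t := by fun_prop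
  have h4 : Continuous fun t => 2 * I * g t := by fun_prop
  have h5 : Continuous fun t => g t ^ 2 := by fun_prop
  simp only [h2] at h1
  rw [intervalIntegral.integral_add (h3.intervalIntegrable _ _) intervalIntegrable_const,
    intervalIntegral.integral_sub (h5.intervalIntegrable _ _)
      (h4.intervalIntegrable _ _), intervalIntegral.integral_const_mul, ← hI] at h1
  simp at h1
  nlinarith

/-! ### Limits of the functional along half-infinite Floer trajectories -/

/-- The primitive `∫_{R₀}^r φ` of a weight `φ`. -/
def primitiveWeight (φ : ℝ → ℝ) (R₀ r : ℝ) : ℝ := ∫ τ in R₀..r, φ τ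

section PrimitiveWeight

variable {φ : ℝ → ℝ} {R₀ : ℝ}

theorem hasDerivAt_primitiveWeight (hφ : IsWeight φ R₀) (r : ℝ) :
    HasDerivAt (primitiveWeight φ R₀) (φ r) r :=
  hφ.smooth.continuous.integral_hasStrictDerivAt R₀ r |>.hasDerivAt

theorem deriv_primitiveWeight (hφ : IsWeight φ R₀) : deriv (primitiveWeight φ R₀) = φ :=
  funext fun r => (hasDerivAt_primitiveWeight hφ r).deriv

theorem isWeight_primitiveWeight (hφ : IsWeight φ R₀) : IsWeight (primitiveWeight φ R₀) R₀ where
  smooth := by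
    rw [contDiff_infty_iff_deriv, deriv_primitiveWeight hφ]
    exact ⟨fun r => (hasDerivAt_primitiveWeight hφ r).differentiableAt, hφ.smooth⟩
  monotone := monotone_of_hasDerivAt_nonneg (hasDerivAt_primitiveWeight hφ) hφ.nonneg
  eq_zero r hr := by
    unfold primitiveWeight
    rw [intervalIntegral.integral_congr (g := fun _ => (0 : ℝ))]
    · simp
    · intro τ hτ
      exact hφ.eq_zero τ (hτ.2.trans (max_le le_rfl hr))

theorem primitiveWeight_le (hφ : IsWeight φ R₀) {r : ℝ} (hr : R₀ ≤ r) :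
    primitiveWeight φ R₀ r ≤ (r - R₀) * φ r := by
  have h := intervalIntegral.integral_mono_on hr
    (hφ.smooth.continuous.intervalIntegrable (μ := MeasureTheory.volume) _ _)
    (intervalIntegrable_const (c := φ r)) fun τ hτ => hφ.monotone hτ.2
  simpa [primitiveWeight] using h

end PrimitiveWeight

namespace AdmissiblePair

variable {C : ConvexSymplecticManifold E E' M S} {R₀ : ℝ} (A : AdmissiblePair C R₀)
  {φ : ℝ → ℝ}

/-- The defect `∫ |φ α(∂_t x - X_H)| dt` of a loop `x`, which vanishes on 1-orbits. -/
def defect (φ : ℝ → ℝ) (x : Loop E M) : ℝ :=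
  ∫ t in (0 : ℝ)..1, |C.cutoffForm φ (x t) (x.dt t - A.XH (x t))|

section

variable [FiniteDimensional ℝ E]

theorem sq_cutoffForm_le_eta (hR₀ : C.c < R₀) (hφ : IsCutoff φ R₀) {p : M}
    {v w : TangentSpace 𝓘(ℝ, E) p} (h : v + A.J p w = 0) :
    R₀ * |C.cutoffForm φ p w| ^ 2 ≤ C.eta (primitiveWeight φ R₀) p v w := by
  have h1 := A.le_eta_of_floer hR₀ (isWeight_primitiveWeight hφ.isWeight) h
  have h0 : 0 < R₀ := C.c_pos.trans hR₀
  rw [deriv_primitiveWeight hφ.isWeight] at h1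
  refine le_trans (mul_le_mul_of_nonneg_left ?_ h0.le) h1
  rw [sq_abs]
  obtain ⟨h2, h3⟩ := hφ.mem_Icc (C.R p)
  by_cases hp : p ∈ C.ψ.target
  · rw [C.cutoffForm_eq hp, mul_pow]
    refine mul_le_mul_of_nonneg_right ?_ (sq_nonneg _)
    nlinarith
  · have h4 : C.cutoffForm φ p w = 0 := if_neg hp
    rw [h4]
    have := mul_nonneg h2 (sq_nonneg (C.theta p w))
    simpa using this

variable [IsManifold 𝓘(ℝ, E') ∞ S]

theorem Omega_primitiveWeight_le (hR₀ : C.c < R₀) (hφ : IsCutoff φ R₀) {u : LoopCurve E M} {s : ℝ}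
    (hu : A.FloerAt u s) :
    A.Omega (primitiveWeight φ R₀) (u s) (u.ds s) ≤ -R₀ * A.defect φ (u s) ^ 2 := by
  have hw := isWeight_primitiveWeight hφ.isWeight
  have hc := (A.continuous_cutoffForm_sub_XH hR₀ hφ.isWeight (u s)).abs
  have hc2 : Continuous fun t =>
      R₀ * |C.cutoffForm φ (u s t) ((u s).dt t - A.XH (u s t))| ^ 2 := (hc.pow 2).const_mul R₀
  have h0 : 0 < R₀ := C.c_pos.trans hR₀
  have h1 := intervalIntegral.integral_mono_on (μ := MeasureTheory.volume) zero_le_one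
    (hc2.intervalIntegrable 0 1)
    ((A.continuous_eta_section hR₀ hw u s).intervalIntegrable 0 1)
    fun t _ => A.sq_cutoffForm_le_eta hR₀ hφ (hu t)
  rw [intervalIntegral.integral_const_mul] at h1
  have h2 := mul_le_mul_of_nonneg_left (sq_integral_le hc) h0.le
  have h3 : A.Omega (primitiveWeight φ R₀) (u s) (u.ds s) = -∫ t in (0 : ℝ)..1,
    C.eta (primitiveWeight φ R₀) (u s t) (u.ds s t) ((u s).dt t - A.XH (u s t)) := rfl
  rw [h3]
  unfold defect
  linarith

theorem abs_F_sub_le (hR₀ : C.c < R₀) (hφ : IsWeight φ R₀) (x : Loop E M) :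
    |A.F φ x - ∫ t in (0 : ℝ)..1, A.reduced φ (C.R (x t))| ≤ A.defect φ x := by
  rw [A.F_eq hR₀ hφ, add_sub_cancel_right, abs_neg]
  exact intervalIntegral.abs_integral_le_integral_abs zero_le_one

theorem defect_primitiveWeight_le (hR₀ : C.c < R₀) (hφ : IsWeight φ R₀) {x : Loop E M} {K : ℝ}
    (hx : ∀ t ∈ Icc (0 : ℝ) 1, C.R (x t) ≤ R₀ + K) :
    A.defect (primitiveWeight φ R₀) x ≤ K * A.defect φ x := by
  have hw := isWeight_primitiveWeight hφ
  have hc := (A.continuous_cutoffForm_sub_XH hR₀ hφ x).abs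
  have hc' := (A.continuous_cutoffForm_sub_XH hR₀ hw x).abs
  unfold defect
  rw [← intervalIntegral.integral_const_mul]
  refine intervalIntegral.integral_mono_on zero_le_one (hc'.intervalIntegrable _ _)
    ((hc.const_mul K).intervalIntegrable _ _) fun t ht => ?_
  rcases le_total (C.R (x t)) R₀ with hp | hp
  · rw [C.cutoffForm_eq_zero hw.eq_zero hp, C.cutoffForm_eq_zero hφ.eq_zero hp]; simp
  · have hpt := C.mem_target (hR₀.trans_le hp)
    rw [C.cutoffForm_eq hpt, C.cutoffForm_eq hpt, abs_mul, abs_mul, ← mul_assoc,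
      abs_of_nonneg (hw.nonneg _), abs_of_nonneg (hφ.nonneg _)]
    refine mul_le_mul_of_nonneg_right ((primitiveWeight_le hφ hp).trans ?_) (abs_nonneg _)
    exact mul_le_mul_of_nonneg_right (by linarith [hx t ht]) (hφ.nonneg _)

/-- Along a Floer half-trajectory converging uniformly to a loop, the defect takes arbitrarily small
values, although nothing is assumed on the convergence of the derivatives. The differential
inequality is that of the functional with weight `∫ φ`. -/
theorem frequently_defect_lt (hR₀ : C.c < R₀) (hφ : IsCutoff φ R₀) {u : LoopCurve E M}
    {x : Loop E M} {δ : ℝ} (hδ : 0 < δ) :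
    ((∀ᶠ s in atTop, A.FloerAt u s) → LoopTendsto u atTop x →
      ∃ᶠ s in atTop, A.defect φ (u s) < δ) ∧
    ((∀ᶠ s in atBot, A.FloerAt u s) → LoopTendsto u atBot x →
      ∃ᶠ s in atBot, A.defect φ (u s) < δ) := by
  have hφw := hφ.isWeight
  have hw := isWeight_primitiveWeight hφw
  set χ := primitiveWeight φ R₀ with hχ
  have h0 : 0 < R₀ := C.c_pos.trans hR₀
  have hbound : ∀ l : Filter ℝ, LoopTendsto u l x → ∃ K, 0 < K ∧ ∀ᶠ s in l,
      |A.F χ (u s) - ∫ t in (0 : ℝ)..1, A.reduced χ (C.R (u s t))| ≤ K * A.defect φ (u s) := by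
    intro l hl
    obtain ⟨b, hb⟩ := eventually_R_le (C := C) hl
    refine ⟨|b - R₀| + 1, by positivity, hb.mono fun s hs => ?_⟩
    refine (A.abs_F_sub_le hR₀ hw (u s)).trans
      (A.defect_primitiveWeight_le hR₀ hφw fun t ht => ?_)
    have := le_abs_self (b - R₀)
    linarith [hs t ht]
  constructor
  · intro hu hl
    obtain ⟨K, hK0, hK⟩ := hbound _ hl
    exact frequently_lt_of_differential_inequality h0 hK0
      (Eventually.of_forall fun s => A.hasDerivAt_F hR₀ hw u s)
      (hu.mono fun s hs => A.Omega_primitiveWeight_le hR₀ hφ hs) hK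
      (tendsto_integral_R (C := C) hl (A.continuous_reduced hw)) hδ
  · intro hu hl
    obtain ⟨K, hK0, hK⟩ := hbound _ hl
    -- the reflection `s ↦ -s`, together with a change of sign
    have h1 : ∃ᶠ s in atTop, A.defect φ (u (-s)) < δ := by
      refine frequently_lt_of_differential_inequality (D := fun s => -A.F χ (u (-s)))
        (D' := fun s => A.Omega χ (u (-s)) (u.ds (-s)))
        (e := fun s => -∫ t in (0 : ℝ)..1, A.reduced χ (C.R (u (-s) t))) h0 hK0
        (Eventually.of_forall fun s => ?_)
        ((tendsto_neg_atTop_atBot.eventually hu).mono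
          fun s hs => A.Omega_primitiveWeight_le hR₀ hφ hs)
        ((tendsto_neg_atTop_atBot.eventually hK).mono fun s hs => ?_)
        ((tendsto_integral_R (C := C) hl (A.continuous_reduced hw)).comp tendsto_neg_atTop_atBot).neg hδ
      · have h2 := ((A.hasDerivAt_F hR₀ hw u (-s)).scomp s (hasDerivAt_neg s)).neg
        exact h2.congr_deriv (by simp)
      · rw [← neg_sub', abs_neg]
        exact hs
    exact tendsto_neg_atTop_atBot.frequently h1

theorem frequently_abs_F_sub_lt {u : LoopCurve E M} {l : Filter ℝ} [l.IsCountablyGenerated]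
    (hR₀ : C.c < R₀) (hφ : IsCutoff φ R₀) {x : Loop E M} (hx : C.IsOneOrbit A.H x)
    (hl : LoopTendsto u l x) (hd : ∀ δ > 0, ∃ᶠ s in l, A.defect φ (u s) < δ) {δ : ℝ}
    (hδ : 0 < δ) : ∃ᶠ s in l, |A.F φ (u s) - A.F φ x| < δ := by
  have hφw := hφ.isWeight
  have h1 := tendsto_integral_R (C := C) hl (A.continuous_reduced hφw)
  rw [← A.F_orbit hR₀ hφw hx] at h1
  have h2 := (Metric.tendsto_nhds.1 h1) (δ / 2) (half_pos hδ)
  refine ((hd (δ / 2) (half_pos hδ)).and_eventually h2).mono fun s hs => ?_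
  have h3 := (A.abs_F_sub_le hR₀ hφw (u s)).trans_lt hs.1
  have h4 := hs.2
  rw [Real.dist_eq] at h4
  have h5 := abs_add_le (A.F φ (u s) - ∫ t in (0 : ℝ)..1, A.reduced φ (C.R (u s t)))
    ((∫ t in (0 : ℝ)..1, A.reduced φ (C.R (u s t))) - A.F φ x)
  rw [sub_add_sub_cancel] at h5
  linarith

theorem frequently_abs_F_sub_lt_atTop {u : LoopCurve E M} (hR₀ : C.c < R₀) (hφ : IsCutoff φ R₀)
    (hu : ∀ᶠ s in atTop, A.FloerAt u s) {x : Loop E M} (hx : C.IsOneOrbit A.H x)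
    (hl : LoopTendsto u atTop x) {δ : ℝ} (hδ : 0 < δ) :
    ∃ᶠ s in atTop, |A.F φ (u s) - A.F φ x| < δ :=
  A.frequently_abs_F_sub_lt hR₀ hφ hx hl
    (fun _ h => (A.frequently_defect_lt hR₀ hφ h).1 hu hl) hδ

theorem frequently_abs_F_sub_lt_atBot {u : LoopCurve E M} (hR₀ : C.c < R₀) (hφ : IsCutoff φ R₀)
    (hu : ∀ᶠ s in atBot, A.FloerAt u s) {x : Loop E M} (hx : C.IsOneOrbit A.H x)
    (hl : LoopTendsto u atBot x) {δ : ℝ} (hδ : 0 < δ) :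
    ∃ᶠ s in atBot, |A.F φ (u s) - A.F φ x| < δ :=
  A.frequently_abs_F_sub_lt hR₀ hφ hx hl
    (fun _ h => (A.frequently_defect_lt hR₀ hφ h).2 hu hl) hδ

end

end AdmissiblePair

theorem Antitone.le_of_frequently_atTop {D : ℝ → ℝ} (hD : Antitone D) {L : ℝ}
    (h : ∀ δ > 0, ∃ᶠ s in atTop, |D s - L| < δ) (s : ℝ) : L ≤ D s := by
  refine le_of_forall_pos_le_add fun δ hδ => ?_
  obtain ⟨s', hs', hss'⟩ := ((h δ hδ).and_eventually (eventually_ge_atTop s)).exists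
  have := (abs_lt.1 hs').1
  linarith [hD hss']

theorem Antitone.le_of_frequently_atBot {D : ℝ → ℝ} (hD : Antitone D) {L : ℝ}
    (h : ∀ δ > 0, ∃ᶠ s in atBot, |D s - L| < δ) (s : ℝ) : D s ≤ L := by
  refine le_of_forall_pos_le_add fun δ hδ => ?_
  obtain ⟨s', hs', hss'⟩ := ((h δ hδ).and_eventually (eventually_le_atBot s)).exists
  have := (abs_lt.1 hs').2
  linarith [hD hss']

namespace AdmissiblePair

variable {C : ConvexSymplecticManifold E E' M S} {R₀ : ℝ} (A : AdmissiblePair C R₀)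
  {φ : ℝ → ℝ} [FiniteDimensional ℝ E] [IsManifold 𝓘(ℝ, E') ∞ S]

theorem F_mem_Icc_of_joins {u : LoopCurve E M} (hR₀ : C.c < R₀) (hφ : IsCutoff φ R₀)
    (hu : A.IsFloerTrajectory u) {x y : A.Orbit} (hxy : Joins u x.1 y.1) (s : ℝ) :
    A.F φ (u s) ∈ Icc (A.F φ y.1) (A.F φ x.1) := by
  have ha := A.antitone_F hR₀ hφ.isWeight hu
  exact ⟨Antitone.le_of_frequently_atTop ha (fun _ h => A.frequently_abs_F_sub_lt_atTop hR₀ hφ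
      (Eventually.of_forall hu) y.2 hxy.2 h) s,
    Antitone.le_of_frequently_atBot ha (fun _ h => A.frequently_abs_F_sub_lt_atBot hR₀ hφ
      (Eventually.of_forall hu) x.2 hxy.1 h) s⟩

end AdmissiblePair

/-! ### Separation -/

theorem eventually_eq_of_hasDerivAt_zero {G : Type*} [NormedAddCommGroup G] [NormedSpace ℝ G]
    {y : ℝ → G} {s₀ : ℝ} (h : ∀ᶠ s in 𝓝 s₀, HasDerivAt y 0 s) : ∀ᶠ s in 𝓝 s₀, y s = y s₀ := by
  obtain ⟨ε, hε, hball⟩ := Metric.eventually_nhds_iff_ball.1 h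
  filter_upwards [Metric.ball_mem_nhds s₀ hε] with s hs
  exact Metric.isOpen_ball.is_const_of_deriv_eq_zero (convex_ball s₀ ε).isPreconnected
    (fun s hs => (hball s hs).differentiableAt.differentiableWithinAt)
    (fun s hs => (hball s hs).deriv) hs (Metric.mem_ball_self hε)

/-- A curve in a T₁ space that is locally constant wherever it lies in the set `V` is
constant if it meets `V`. -/
theorem eq_of_locally_const {X : Type*} [TopologicalSpace X] [T1Space X] {γ : ℝ → X}
    (hγ : Continuous γ) {V : Set X} (h : ∀ s, γ s ∈ V → ∀ᶠ s' in 𝓝 s, γ s' = γ s) {s₁ : ℝ}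
    (hs₁ : γ s₁ ∈ V) (s : ℝ) : γ s = γ s₁ := by
  have hclopen : IsClopen {s | γ s = γ s₁} := by
    refine ⟨isClosed_singleton.preimage hγ, isOpen_iff_mem_nhds.2 fun s hs => ?_⟩
    have hs' : γ s = γ s₁ := hs
    filter_upwards [h s (hs' ▸ hs₁)] with s' h'
    exact h'.trans hs'
  have huniv := hclopen.eq_univ ⟨s₁, rfl⟩
  exact huniv.ge (mem_univ s)

namespace AdmissiblePair

variable {C : ConvexSymplecticManifold E E' M S} {R₀ : ℝ} (A : AdmissiblePair C R₀)

theorem F_eq_zero (hR₀ : C.c < R₀) {χ : ℝ → ℝ} (hχ : IsWeight χ R₀) {x : Loop E M}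
    (hx : ∀ t, C.R (x t) ≤ R₀) : A.F χ x = 0 := by
  simp [F, C.cutoffForm_eq_zero hχ.eq_zero (hx _), A.f_eq_zero hR₀ hχ _ (hx _)]

theorem reduced_eq (hR₀ : C.c < R₀) {χ : ℝ → ℝ} (hχ : IsWeight χ R₀) (r : ℝ) :
    A.reduced χ r = -∫ τ in (0 : ℝ)..r, χ τ * deriv (deriv A.h) τ := by
  have h0 : (0 : ℝ) ≤ R₀ := (C.c_pos.trans hR₀).le
  have h1 := intervalIntegral.integral_mul_deriv_eq_deriv_mul (a := 0) (b := r)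
    (fun τ _ => (hχ.smooth.differentiable (by simp) τ).hasDerivAt)
    (fun τ _ => (A.contDiff_deriv_h.differentiable (by simp) τ).hasDerivAt)
    ((hχ.smooth.continuous_deriv (by simp)).intervalIntegrable _ _)
    ((A.contDiff_deriv_h.continuous_deriv (by simp)).intervalIntegrable _ _)
  rw [h1, hχ.eq_zero 0 h0, reduced, f]
  ring

theorem reduced_neg (hR₀ : C.c < R₀) {φ : ℝ → ℝ} (hφ : IsCutoff φ R₀) {r : ℝ} (hr : R₀ < r) :
    A.reduced φ r < 0 := by
  have h0 : (0 : ℝ) < R₀ := C.c_pos.trans hR₀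
  have hcont : Continuous (deriv (deriv A.h)) := A.contDiff_deriv_h.continuous_deriv (by simp)
  rw [A.reduced_eq hR₀ hφ.isWeight, neg_lt_zero]
  -- a point at which the integrand is positive
  have h1 : ∀ᶠ τ in 𝓝[>] R₀, 0 < deriv (deriv A.h) τ :=
    (hcont.continuousAt.eventually (lt_mem_nhds A.convex_pos)).filter_mono nhdsWithin_le_nhds
  obtain ⟨τ, hτ1, hτ2⟩ := (h1.and (Ioo_mem_nhdsGT hr)).exists
  refine intervalIntegral.integral_pos (h0.trans hr) (hφ.smooth.continuous.mul hcont).continuousOn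
    (fun σ _ => ?_) ⟨τ, ⟨(h0.trans hτ2.1).le, hτ2.2.le⟩, mul_pos (hφ.pos τ hτ2.1) hτ1⟩
  rcases le_total σ R₀ with h | h
  · rw [hφ.eq_zero σ h, zero_mul]
  · exact mul_nonneg (hφ.mem_Icc σ).1 (A.convex σ h)

section

variable [FiniteDimensional ℝ E]

/-- The radial coordinate is constant on a 1-orbit that meets the region `R > R₀`. -/
theorem R_orbit_const (hR₀ : C.c < R₀) {x : Loop E M} (hx : C.IsOneOrbit A.H x) {t₀ : ℝ}
    (ht₀ : R₀ < C.R (x t₀)) (t : ℝ) : C.R (x t) = C.R (x t₀) := by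
  refine eq_of_locally_const (γ := fun t => C.R (x t)) (continuous_R_loop x) (V := Ioi R₀)
    (fun t ht => eventually_eq_of_hasDerivAt_zero ?_) ht₀ t
  filter_upwards [(continuous_R_loop x).continuousAt.eventually (lt_mem_nhds ht)] with s hs
  have hst : x s ∈ C.ψ.target := C.mem_target (hR₀.trans hs)
  have h1 : DifferentiableAt ℝ (C.R ∘ x.toFun) s :=
    (C.contDiffAt_R_comp x.smooth hst).differentiableAt (by simp)
  have h2 := C.fderiv_R_comp x.smooth hst (1 : ℝ)
  have h3 : mfderiv 𝓘(ℝ, ℝ) 𝓘(ℝ, E) x.toFun s (1 : ℝ) = A.XH (x s) := hx s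
  rw [h3, (A.XH_collar hR₀ hs.le).2.1] at h2
  have h4 := h1.hasDerivAt
  rw [← fderiv_apply_one_eq_deriv, h2] at h4
  exact h4

/-- On a level set of `R` the 1-orbits are reparametrized Reeb orbits. -/
theorem isReebPeriod_orbit (hR₀ : C.c < R₀) {x : Loop E M} (hx : C.IsOneOrbit A.H x) {r : ℝ}
    (hr : R₀ ≤ r) (hxr : ∀ t, C.R (x t) = r) : IsReebPeriod C.α (deriv A.h r) := by
  set k := deriv A.h r with hk
  have hk0 : 0 < k := A.deriv_h_pos hr
  have hmem : ∀ t, x t ∈ C.ψ.target := fun t =>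
    C.mem_target (by rw [hxr]; exact hR₀.trans_le hr)
  have hpx : ContMDiff 𝓘(ℝ, ℝ) 𝓘(ℝ, E') ∞ (C.proj ∘ x.toFun) := fun t =>
    (C.contMDiffAt_proj (hmem t)).comp t (x.smooth t)
  have hlin : ContDiff ℝ ∞ fun τ : ℝ => k⁻¹ * τ := by fun_prop
  refine ⟨hk0, (C.proj ∘ x.toFun) ∘ fun τ => k⁻¹ * τ, hpx.comp hlin.contMDiff, fun τ => ?_,
    fun τ => ?_⟩
  · have h1 := A.isReebVector_XH hR₀ (p := x (k⁻¹ * τ)) (by rw [hxr]; exact hr)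
    rw [hxr, ← hk] at h1
    have h2 := mfderiv_comp τ ((hpx (k⁻¹ * τ)).mdifferentiableAt (by simp))
      (hlin.differentiable (by simp) τ).mdifferentiableAt
    have h3 : HasFDerivAt (fun τ : ℝ => k⁻¹ * τ) _ τ :=
      ((hasDerivAt_id τ).const_mul k⁻¹).hasFDerivAt
    rw [mfderiv_eq_fderiv, h3.fderiv] at h2
    have h4 := C.mfderiv_proj_comp x.smooth (hmem (k⁻¹ * τ)) (1 : ℝ)
    have h5 : mfderiv 𝓘(ℝ, ℝ) 𝓘(ℝ, E) x.toFun (k⁻¹ * τ) (1 : ℝ) = A.XH (x (k⁻¹ * τ)) :=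
      hx (k⁻¹ * τ)
    rw [h5] at h4
    have h6 : velocity ((C.proj ∘ x.toFun) ∘ fun τ => k⁻¹ * τ) τ
        = k⁻¹ • C.dProj (x (k⁻¹ * τ)) (A.XH (x (k⁻¹ * τ))) := by
      rw [← h4]
      have h7 := congrArg (fun L : ℝ →L[ℝ] E' => L 1) h2
      refine h7.trans ?_
      have h8 := (mfderiv 𝓘(ℝ, ℝ) 𝓘(ℝ, E') (C.proj ∘ x.toFun) (k⁻¹ * τ)).map_smul k⁻¹ (1 : ℝ)
      refine Eq.trans ?_ h8
      refine congrArg (mfderiv 𝓘(ℝ, ℝ) 𝓘(ℝ, E') (C.proj ∘ x.toFun) (k⁻¹ * τ) : ℝ → E') ?_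
      change (1 : ℝ) • (k⁻¹ * 1) = k⁻¹ • (1 : ℝ)
      simp
    rw [h6]
    exact h1
  · have h1 : k⁻¹ * (τ + k) = k⁻¹ * τ + 1 := by field_simp
    simp only [Function.comp_apply]
    rw [h1, x.periodic]

/-- A 1-orbit in `R ≥ R₀` lies in a level set of `R` above `R₀`, as `h'(R₀)` is smaller than every
Reeb period. -/
theorem exists_R_orbit_eq (hR₀ : C.c < R₀) {x : Loop E M} (hx : C.IsOneOrbit A.H x)
    (hxR : ∀ t, R₀ ≤ C.R (x t)) : ∃ r, R₀ < r ∧ ∀ t, C.R (x t) = r := by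
  by_cases h : ∃ t₀, R₀ < C.R (x t₀)
  · obtain ⟨t₀, ht₀⟩ := h
    exact ⟨_, ht₀, A.R_orbit_const hR₀ hx ht₀⟩
  · push Not at h
    have h1 := A.isReebPeriod_orbit hR₀ hx le_rfl fun t => le_antisymm (h t) (hxR t)
    exact absurd (A.slope_lt _ h1) (lt_irrefl _)

theorem F_orbit_neg [IsManifold 𝓘(ℝ, E') ∞ S] (hR₀ : C.c < R₀) {φ : ℝ → ℝ}
    (hφ : IsCutoff φ R₀) {x : Loop E M} (hx : C.IsOneOrbit A.H x)
    (hxR : ∀ t, R₀ ≤ C.R (x t)) : A.F φ x < 0 := by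
  obtain ⟨r, hr, hxr⟩ := A.exists_R_orbit_eq hR₀ hx hxR
  rw [A.F_orbit hR₀ hφ.isWeight hx]
  simpa [hxr] using A.reduced_neg hR₀ hφ hr

/-! ### Strictness -/

theorem R_orbit_lt_of_isStrictCutoff (hR₀ : C.c < R₀) {x : Loop E M} (hx : C.IsOneOrbit A.H x)
    {r R₁ κ : ℝ} (hr : R₀ ≤ r) (hxr : ∀ t, C.R (x t) = r) (hκ : ∀ r, R₁ ≤ r → deriv A.h r = κ) :
    r < R₁ := by
  by_contra hle
  rw [not_lt] at hle
  have h1 : HasDerivWithinAt (deriv A.h) 0 (Ici r) r :=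
    (hasDerivWithinAt_const r (Ici r) κ).congr (fun τ hτ => hκ τ (hle.trans hτ)) (hκ r hle)
  have h2 := (uniqueDiffWithinAt_Ici r).eq_deriv _
    (A.contDiff_deriv_h.differentiable (by simp) r).hasDerivAt.hasDerivWithinAt h1
  exact A.slope_not_period r hr h2 (A.isReebPeriod_orbit hR₀ hx hr hxr)

end

end AdmissiblePair

/-- A curve with vanishing velocity near `s₀` is constant near `s₀`. -/
theorem eventually_eq_of_velocity_eq_zero [IsManifold 𝓘(ℝ, E) ∞ M] {γ : ℝ → M}
    (hγ : ContMDiff 𝓘(ℝ, ℝ) 𝓘(ℝ, E) ∞ γ) {s₀ : ℝ}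
    (h : ∀ᶠ s in 𝓝 s₀, velocity γ s = (0 : TangentSpace 𝓘(ℝ, E) (γ s))) :
    ∀ᶠ s in 𝓝 s₀, γ s = γ s₀ := by
  have hsrc : ∀ᶠ s in 𝓝 s₀, γ s ∈ (extChartAt 𝓘(ℝ, E) (γ s₀)).source :=
    hγ.continuous.continuousAt.eventually (extChartAt_source_mem_nhds (γ s₀))
  have hder : ∀ᶠ s in 𝓝 s₀, HasDerivAt (extChartAt 𝓘(ℝ, E) (γ s₀) ∘ γ) 0 s := by
    filter_upwards [h, hsrc] with s hs hss
    have h1 : MDifferentiableAt 𝓘(ℝ, E) 𝓘(ℝ, E) (extChartAt 𝓘(ℝ, E) (γ s₀)) (γ s) :=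
      (contMDiffAt_extChartAt' (n := ∞) (by simpa using hss)).mdifferentiableAt (by simp)
    have h2 := mfderiv_comp s h1 ((hγ s).mdifferentiableAt (by simp))
    have h3 := (h1.comp s ((hγ s).mdifferentiableAt (by simp))).differentiableAt.hasDerivAt
    have h4 : fderiv ℝ (extChartAt 𝓘(ℝ, E) (γ s₀) ∘ γ) s 1 = 0 := by
      rw [mfderiv_eq_fderiv] at h2
      have h5 := congrArg (fun L : ℝ →L[ℝ] E => L 1) h2
      refine h5.trans ?_
      have h6 : mfderiv 𝓘(ℝ, ℝ) 𝓘(ℝ, E) γ s (1 : ℝ) = 0 := hs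
      have h7 := congrArg
        (mfderiv 𝓘(ℝ, E) 𝓘(ℝ, E) (extChartAt 𝓘(ℝ, E) (γ s₀)) (γ s) : E →L[ℝ] E) h6
      exact h7.trans (map_zero _)
    rwa [← fderiv_apply_one_eq_deriv, h4] at h3
  filter_upwards [eventually_eq_of_hasDerivAt_zero hder, hsrc] with s h1 h2
  exact (extChartAt 𝓘(ℝ, E) (γ s₀)).injOn h2 (mem_extChartAt_source (γ s₀)) h1

theorem LoopCurve.smooth_fst (u : LoopCurve E M) (t : ℝ) :
    ContMDiff 𝓘(ℝ, ℝ) 𝓘(ℝ, E) ∞ fun s => u s t := by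
  have h : ContDiff ℝ ∞ fun s : ℝ => (s, t) := by fun_prop
  exact u.smooth_map.comp h.contMDiff

theorem LoopTendsto.tendsto_apply {u : ℝ → Loop E M} {l : Filter ℝ} {x : Loop E M}
    (h : LoopTendsto u l x) (t : ℝ) : Tendsto (fun s => u s t) l (𝓝 (x t)) :=
  (h t).comp (tendsto_id.prodMk (tendsto_const_nhds (x := t)))

theorem Loop.ext_of_eqOn {x y : Loop E M} (h : ∀ t ∈ Icc (0 : ℝ) 1, x t = y t) : x = y := by
  have hx : Function.Periodic x.toFun 1 := x.periodic
  have hy : Function.Periodic y.toFun 1 := y.periodic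
  have h1 : x.toFun = y.toFun := by
    funext t
    rw [← hx.sub_zsmul_eq ⌊t⌋, ← hy.sub_zsmul_eq ⌊t⌋]
    have h2 : t - ⌊t⌋ • (1 : ℝ) = Int.fract t := by simp
    rw [h2]
    exact h _ ⟨Int.fract_nonneg t, (Int.fract_lt_one t).le⟩
  cases x; cases y
  cases h1
  rfl

namespace AdmissiblePair

variable {C : ConvexSymplecticManifold E E' M S} {R₀ : ℝ} (A : AdmissiblePair C R₀)
  [FiniteDimensional ℝ E] [IsManifold 𝓘(ℝ, E') ∞ S]

/-- If `Ω_η(∂_s u)` vanishes, then `∂_s u = 0` wherever `φ > 0` and `φ' > 0`. -/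
theorem ds_eq_zero_of_Omega_eq_zero (hR₀ : C.c < R₀) {φ : ℝ → ℝ} (hφ : IsCutoff φ R₀)
    {u : LoopCurve E M} {s : ℝ} (hu : A.FloerAt u s) (h0 : A.Omega φ (u s) (u.ds s) = 0) {t : ℝ}
    (ht : t ∈ Icc (0 : ℝ) 1) (hR : R₀ < C.R (u s t)) (hφ' : 0 < deriv φ (C.R (u s t))) :
    u.ds s t = 0 := by
  have hφw := hφ.isWeight
  have hη : C.eta φ (u s t) (u.ds s t) ((u s).dt t - A.XH (u s t)) = 0 := by
    refine le_antisymm ?_ (A.eta_nonneg_of_floer hR₀ hφw (hu t))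
    by_contra hlt
    rw [not_le] at hlt
    have h1 := intervalIntegral.integral_pos zero_lt_one
      (A.continuous_eta_section hR₀ hφw u s).continuousOn
      (fun t _ => A.eta_nonneg_of_floer hR₀ hφw (hu t)) ⟨t, ht, hlt⟩
    have h2 : A.Omega φ (u s) (u.ds s) = -∫ t in (0 : ℝ)..1,
      C.eta φ (u s t) (u.ds s t) ((u s).dt t - A.XH (u s t)) := rfl
    linarith
  set w := (u s).dt t - A.XH (u s t) with hw
  have hRpos : 0 < C.R (u s t) := (C.c_pos.trans hR₀).trans hR
  rw [A.eta_of_floer hR₀ φ hR.le (hu t), ← hw] at hη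
  obtain ⟨-, hδ, hzero⟩ := A.J_collar hR₀ hR.le w
  have h1 : 0 ≤ C.dR (u s t) w ^ 2 / C.R (u s t) := by positivity
  have h2 : 0 ≤ C.R (u s t) * C.theta (u s t) w ^ 2 := by positivity
  have h3 := mul_nonneg (hφ.pos _ hR).le hδ
  have h4 := mul_nonneg hφ'.le (add_nonneg h1 h2)
  have h5 : C.delta (u s t) w (A.J (u s t) w) = 0 :=
    (mul_eq_zero.1 (by linarith : φ (C.R (u s t)) * C.delta (u s t) w (A.J (u s t) w) = 0)
      ).resolve_left (hφ.pos _ hR).ne'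
  have h6 := (mul_eq_zero.1 (by linarith : deriv φ (C.R (u s t)) *
    (C.dR (u s t) w ^ 2 / C.R (u s t) + C.R (u s t) * C.theta (u s t) w ^ 2) = 0)
      ).resolve_left hφ'.ne'
  have h7 : C.dR (u s t) w = 0 := by
    have : C.dR (u s t) w ^ 2 / C.R (u s t) = 0 := by linarith
    simpa [hRpos.ne'] using this
  have h8 : C.theta (u s t) w = 0 := by
    have : C.R (u s t) * C.theta (u s t) w ^ 2 = 0 := by linarith
    simpa [hRpos.ne'] using this
  have h9 : u.ds s t + A.J (u s t) w = 0 := hu t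
  rwa [hzero h5 h7 h8, map_zero, add_zero] at h9

/-- Equality in the negativity estimate forces `∂_s u = 0` in `R₀ < R < R₁`. Since `x₊` lies there,
`u(s, t)` is constant in `s` for each `t`. -/
theorem F_lt_of_joins [T2Space M] [IsManifold 𝓘(ℝ, E) ∞ M] (hR₀ : C.c < R₀) {φ : ℝ → ℝ}
    (hφ : IsCutoff φ R₀) (hstrict : IsStrictCutoff φ R₀ A.h) {u : LoopCurve E M}
    (hu : A.IsFloerTrajectory u) {x y : A.Orbit} (hxy : Joins u x.1 y.1) (hne : x ≠ y)
    (hy : ∀ t, R₀ ≤ C.R (y.1 t)) : A.F φ y.1 < A.F φ x.1 := by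
  by_contra hle
  rw [not_lt] at hle
  obtain ⟨R₁, hφ', κ, hκ⟩ := hstrict
  obtain ⟨r, hr, hyr⟩ := A.exists_R_orbit_eq hR₀ y.2 hy
  have hr₁ := A.R_orbit_lt_of_isStrictCutoff hR₀ y.2 hr.le hyr hκ
  have hconst : ∀ s, A.F φ (u s) = A.F φ x.1 := fun s => by
    have h := A.F_mem_Icc_of_joins hR₀ hφ hu hxy s
    exact le_antisymm h.2 (hle.trans h.1)
  have hΩ : ∀ s, A.Omega φ (u s) (u.ds s) = 0 := fun s => by
    have h1 := A.hasDerivAt_F hR₀ hφ.isWeight u s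
    simp only [hconst] at h1
    exact h1.unique (hasDerivAt_const s _)
  refine hne (Subtype.ext (Loop.ext_of_eqOn fun t ht => ?_))
  set V : Set M := C.R ⁻¹' Ioo R₀ R₁ with hV
  have hVo : IsOpen V := isOpen_Ioo.preimage C.continuous_R
  have hyV : y.1 t ∈ V := by
    rw [hV, mem_preimage, hyr]
    exact ⟨hr, hr₁⟩
  have hγ := u.smooth_fst t
  have hloc : ∀ s, u s t ∈ V → ∀ᶠ s' in 𝓝 s, u s' t = u s t := by
    intro s hs
    refine eventually_eq_of_velocity_eq_zero hγ ?_
    filter_upwards [hγ.continuous.continuousAt.eventually (hVo.mem_nhds hs)] with s' hs'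
    exact A.ds_eq_zero_of_Omega_eq_zero hR₀ hφ (hu s') (hΩ s') ht hs'.1 (hφ' _ hs'.1 hs'.2)
  obtain ⟨s₁, hs₁⟩ := ((hxy.2.tendsto_apply t).eventually (hVo.mem_nhds hyV)).exists
  have hall := eq_of_locally_const hγ.continuous hloc hs₁
  have h1 := hxy.1.tendsto_apply t
  have h2 := hxy.2.tendsto_apply t
  simp only [hall] at h1 h2
  exact (tendsto_nhds_unique h1 tendsto_const_nhds).trans
    (tendsto_nhds_unique tendsto_const_nhds h2)

end AdmissiblePair

/-! ### Compatibility with homotopies -/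

theorem hasDerivAt_sub_mul_of_continuousAt {ρ W : ℝ → ℝ} {ρ' s₀ : ℝ} (hρ : HasDerivAt ρ ρ' s₀)
    (hW : ContinuousAt W s₀) : HasDerivAt (fun s => (ρ s - ρ s₀) * W s) (ρ' * W s₀) s₀ := by
  rw [hasDerivAt_iff_tendsto_slope] at hρ ⊢
  refine (hρ.mul (hW.tendsto.mono_left nhdsWithin_le_nhds)).congr fun s => ?_
  simp only [slope_def_field, sub_self, zero_mul, sub_zero]
  ring

/-- The Leibniz rule for an integral with a variable upper limit. -/
theorem hasDerivAt_integral_param {c : ℝ × ℝ → ℝ} (hc : ContDiff ℝ ∞ c) {ρ : ℝ → ℝ}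
    (hρc : Continuous ρ) {ρ' s₀ : ℝ} (hρ : HasDerivAt ρ ρ' s₀) :
    HasDerivAt (fun s => ∫ τ in (0 : ℝ)..ρ s, c (s, τ))
      ((∫ τ in (0 : ℝ)..ρ s₀, fderiv ℝ c (s₀, τ) (1, 0)) + ρ' * c (s₀, ρ s₀)) s₀ := by
  have hsec : ∀ s, Continuous fun τ => c (s, τ) := fun s => hc.continuous.comp (by fun_prop)
  have h1 := hasDerivAt_intervalIntegral (k := fun s τ => c (s, τ))
    (fun s t => hasDerivAt_fst_of_contDiff hc (by simp) s t) hc.continuous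
    (continuous_fderiv_apply_of_contDiff hc _) 0 (ρ s₀) s₀
  set W : ℝ → ℝ := fun s => ∫ θ in (0 : ℝ)..1, c (s, (ρ s - ρ s₀) * θ + ρ s₀) with hW
  have hWc : Continuous W := by
    refine intervalIntegral.continuous_parametric_intervalIntegral_of_continuous'
      (f := fun s θ => c (s, (ρ s - ρ s₀) * θ + ρ s₀)) ?_ 0 1
    exact hc.continuous.comp (by fun_prop)
  have h2 := hasDerivAt_sub_mul_of_continuousAt hρ hWc.continuousAt
  have h3 : W s₀ = c (s₀, ρ s₀) := by simp [hW]
  rw [h3] at h2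
  refine (h1.add h2).congr_of_eventuallyEq (Eventually.of_forall fun s => ?_)
  have h4 := intervalIntegral.mul_integral_comp_mul_add (a := 0) (b := 1)
    (f := fun τ => c (s, τ)) (ρ s - ρ s₀) (ρ s₀)
  simp only [mul_zero, zero_add, mul_one, sub_add_cancel] at h4
  simp only [Pi.add_apply, hW]
  rw [h4, intervalIntegral.integral_add_adjacent_intervals ((hsec s).intervalIntegrable _ _)
    ((hsec s).intervalIntegrable _ _)]

namespace AdmissibleHomotopy

variable {C : ConvexSymplecticManifold E E' M S} {R₀ : ℝ} (B : AdmissibleHomotopy C R₀)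
  {φ : ℝ → ℝ}

/-- The integrand `φ'(τ) h_s'(τ)` of `f_s`, as a function of `(s, τ)`. -/
def fIntegrand (φ : ℝ → ℝ) (q : ℝ × ℝ) : ℝ := deriv φ q.2 * deriv (B.pair q.1).h q.2

theorem contDiff_deriv_h :
    ContDiff ℝ ∞ fun q : ℝ × ℝ => deriv (B.pair q.1).h q.2 := by
  have h1 : ∀ q : ℝ × ℝ, deriv (B.pair q.1).h q.2
      = fderiv ℝ (fun q : ℝ × ℝ => (B.pair q.1).h q.2) q (0, 1) := fun q =>
    (hasDerivAt_snd_of_contDiff B.smooth_h (by simp) q.1 q.2).deriv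
  simp only [h1]
  exact (B.smooth_h.fderiv_right (m := ∞) (by simp)).clm_apply contDiff_const

theorem contDiff_fIntegrand (hφ : IsWeight φ R₀) : ContDiff ℝ ∞ (B.fIntegrand φ) :=
  (hφ.smooth.deriv'.comp contDiff_snd).mul B.contDiff_deriv_h

theorem fderiv_fIntegrand_nonpos (hφ : IsWeight φ R₀) (s τ : ℝ) :
    fderiv ℝ (B.fIntegrand φ) (s, τ) (1, 0) ≤ 0 := by
  have h1 := hasDerivAt_fst_of_contDiff (B.contDiff_fIntegrand hφ) (by simp) s τ
  have h2 := (hasDerivAt_fst_of_contDiff B.contDiff_deriv_h (by simp) s τ).differentiableAt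
  have h3 := h1.unique (h2.hasDerivAt.const_mul (deriv φ τ))
  rw [h3]
  rcases le_total τ R₀ with h | h
  · rw [hφ.deriv_eq_zero h, zero_mul]
  · exact mul_nonpos_of_nonneg_of_nonpos (hφ.deriv_nonneg τ) (B.slope_antitone s τ h)

theorem fderiv_fIntegrand_eq_zero (hφ : IsWeight φ R₀) (s : ℝ) {τ : ℝ} (hτ : τ ≤ R₀) :
    fderiv ℝ (B.fIntegrand φ) (s, τ) (1, 0) = 0 := by
  have h1 := hasDerivAt_fst_of_contDiff (B.contDiff_fIntegrand hφ) (by simp) s τ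
  simp only [fIntegrand, hφ.deriv_eq_zero hτ, zero_mul] at h1
  exact h1.unique (hasDerivAt_const s 0)

/-- The derivative `(∂_s f_s)(r)`. -/
def dsf (φ : ℝ → ℝ) (s r : ℝ) : ℝ :=
  ∫ τ in (0 : ℝ)..r, fderiv ℝ (B.fIntegrand φ) (s, τ) (1, 0)

theorem dsf_nonpos (hφ : IsWeight φ R₀) (s : ℝ) {r : ℝ} (hr : 0 ≤ r) : B.dsf φ s r ≤ 0 := by
  have h := intervalIntegral.integral_nonneg (μ := MeasureTheory.volume) hr fun τ _ =>
    neg_nonneg.2 (B.fderiv_fIntegrand_nonpos hφ s τ)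
  rw [intervalIntegral.integral_neg] at h
  exact neg_nonneg.1 h

/-- The derivative in `s` of `f_s(R(u(s, t)))`. -/
theorem hasDerivAt_f_R (hR₀ : C.c < R₀) (hφ : IsWeight φ R₀) (u : LoopCurve E M) (s t : ℝ) :
    HasDerivAt (fun s' => (B.pair s').f φ (C.R (u s' t)))
      (B.dsf φ s (C.R (u s t))
        + deriv φ (C.R (u s t)) * C.dR (u s t) (u.ds s t) * deriv (B.pair s).h (C.R (u s t))) s := by
  have hcont : Continuous fun s' => C.R (u s' t) :=
    C.continuous_R.comp (u.smooth_fst t).continuous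
  by_cases hp : u s t ∈ C.ψ.target
  · have h1 : DifferentiableAt ℝ (C.R ∘ u.map) (s, t) :=
      (C.contDiffAt_R_comp u.smooth_map (q₀ := (s, t)) hp).differentiableAt (by simp)
    have h2 : HasDerivAt (fun s' => C.R (u s' t)) (C.dR (u s t) (u.ds s t)) s := by
      have h3 := h1.hasFDerivAt.comp_hasDerivAt s
        ((hasDerivAt_id s).prodMk (hasDerivAt_const s t))
      have h4 := C.fderiv_R_comp u.smooth_map (q := (s, t)) hp ((1, 0) : ℝ × ℝ)
      rw [← u.ds_eq] at h4
      exact h3.congr_deriv h4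
    refine (hasDerivAt_integral_param (B.contDiff_fIntegrand hφ) hcont h2).congr_deriv ?_
    unfold dsf fIntegrand
    ring
  · have hR : C.R (u s t) < R₀ := by rwa [ConvexSymplecticManifold.R, if_neg hp]
    have h1 : B.dsf φ s (C.R (u s t)) = 0 := by
      unfold dsf
      rw [intervalIntegral.integral_congr (g := fun _ => (0 : ℝ))]
      · simp
      · intro τ hτ
        exact B.fderiv_fIntegrand_eq_zero hφ s
          (hτ.2.trans (max_le (C.c_pos.trans hR₀).le hR.le))
    rw [h1, hφ.deriv_eq_zero hR.le]
    simp only [zero_mul, add_zero]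
    refine (hasDerivAt_const s (0 : ℝ)).congr_of_eventuallyEq ?_
    filter_upwards [hcont.continuousAt.eventually (gt_mem_nhds hR)] with s' hs'
    exact (B.pair s').f_eq_zero hR₀ hφ _ hs'.le

theorem continuous_deriv_f_R (hR₀ : C.c < R₀) (hφ : IsWeight φ R₀) (u : LoopCurve E M) :
    Continuous fun q : ℝ × ℝ => B.dsf φ q.1 (C.R (u q.1 q.2))
      + deriv φ (C.R (u q.1 q.2)) * C.dR (u q.1 q.2) (u.ds q.1 q.2)
        * deriv (B.pair q.1).h (C.R (u q.1 q.2)) := by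
  have hRc : Continuous fun q : ℝ × ℝ => C.R (u q.1 q.2) :=
    C.continuous_R.comp u.smooth_map.continuous
  have h1 : Continuous fun q : ℝ × ℝ => B.dsf φ q.1 (C.R (u q.1 q.2)) := by
    refine intervalIntegral.continuous_parametric_intervalIntegral_of_continuous
      (f := fun (q : ℝ × ℝ) τ => fderiv ℝ (B.fIntegrand φ) (q.1, τ) (1, 0)) ?_ hRc
    exact (continuous_fderiv_apply_of_contDiff (B.contDiff_fIntegrand hφ) _).comp (by fun_prop)
  have hφR := C.contMDiff_comp_R hR₀ (n := ⊤) hφ.smooth hφ.eq_zero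
  have hsm : ContDiff ℝ ∞ ((φ ∘ C.R) ∘ u.map) :=
    contMDiff_iff_contDiff.1 (hφR.comp u.smooth_map)
  have h2 : ∀ q : ℝ × ℝ, deriv φ (C.R (u q.1 q.2)) * C.dR (u q.1 q.2) (u.ds q.1 q.2)
      = fderiv ℝ ((φ ∘ C.R) ∘ u.map) q (1, 0) := by
    intro q
    have h3 := mfderiv_comp q ((hφR (u.map q)).mdifferentiableAt (by simp))
      ((u.smooth_map q).mdifferentiableAt (by simp))
    rw [mfderiv_eq_fderiv] at h3
    rw [← C.mfderiv_comp_R hR₀ (hφ.smooth.differentiable (by simp)) hφ.eq_zero, u.ds_eq]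
    exact (congrArg (fun L : ℝ × ℝ →L[ℝ] ℝ => L (1, 0)) h3).symm
  have h4 : Continuous fun q : ℝ × ℝ =>
      deriv φ (C.R (u q.1 q.2)) * C.dR (u q.1 q.2) (u.ds q.1 q.2) := by
    simp only [h2]
    exact continuous_fderiv_apply_of_contDiff hsm _
  exact h1.add (h4.mul (B.contDiff_deriv_h.continuous.comp (continuous_fst.prodMk hRc)))

section

variable [FiniteDimensional ℝ E] [IsManifold 𝓘(ℝ, E') ∞ S]

/-- The functionals `F_s` do not increase along a continuation solution: to the derivative at fixed
`s` the homotopy adds `∫ (∂_s f_s)(R ∘ u) dt ≤ 0`. -/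
theorem exists_hasDerivAt_F (hR₀ : C.c < R₀) (hφ : IsWeight φ R₀) {u : LoopCurve E M}
    (hu : B.IsContinuationSolution u) (s : ℝ) :
    ∃ m ≤ 0, HasDerivAt (fun s' => (B.pair s').F φ (u s')) m s := by
  have hP := C.contDiff_cutoffAlong hR₀ hφ u.smooth_map ((0, 1) : ℝ × ℝ)
  have hQ := C.contDiff_cutoffAlong hR₀ hφ u.smooth_map ((1, 0) : ℝ × ℝ)
  have h1 := AdmissiblePair.hasDerivAt_integral_cutoffForm hR₀ hφ u s
  have hRc : Continuous fun q : ℝ × ℝ => C.R (u q.1 q.2) :=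
    C.continuous_R.comp u.smooth_map.continuous
  have hkc : Continuous fun q : ℝ × ℝ => (B.pair q.1).f φ (C.R (u q.1 q.2)) := by
    refine intervalIntegral.continuous_parametric_intervalIntegral_of_continuous
      (f := fun (q : ℝ × ℝ) τ => B.fIntegrand φ (q.1, τ)) ?_ hRc
    exact (B.contDiff_fIntegrand hφ).continuous.comp (by fun_prop)
  have hkc' := B.continuous_deriv_f_R hR₀ hφ u
  have h2 := hasDerivAt_intervalIntegral (k := fun s t => (B.pair s).f φ (C.R (u s t)))
    (fun s t => B.hasDerivAt_f_R hR₀ hφ u s t) hkc hkc' 0 1 s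
  refine ⟨_, ?_, h1.neg.add h2⟩
  have hX : Continuous fun t => fderiv ℝ (C.cutoffAlong φ u.map ((0, 1) : ℝ × ℝ)) (s, t) (1, 0)
      - fderiv ℝ (C.cutoffAlong φ u.map ((1, 0) : ℝ × ℝ)) (s, t) (0, 1) :=
    (continuous_fderiv_section hP _ s).sub (continuous_fderiv_section hQ _ s)
  rw [neg_add_nonpos_iff]
  refine intervalIntegral.integral_mono_on zero_le_one
    ((hkc'.comp (by fun_prop : Continuous fun t : ℝ => (s, t))).intervalIntegrable _ _)
    (hX.intervalIntegrable _ _) fun t _ => ?_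
  have h3 := C.fderiv_cutoffAlong hR₀ hφ u.smooth_map ((1, 0) : ℝ × ℝ) ((0, 1) : ℝ × ℝ) (s, t)
  rw [← u.ds_eq, ← u.dt_eq] at h3
  have h4 := (B.pair s).eta_sub_XH hR₀ hφ (u s t) (u.ds s t) ((u s).dt t)
  have h5 := (B.pair s).eta_nonneg_of_floer hR₀ hφ (hu s t)
  have h6 := B.dsf_nonpos hφ s (C.c_pos.le.trans (C.le_R (u s t)))
  rw [(B.pair s).deriv_f hφ] at h4
  have h7 : 0 ≤ C.eta φ (u s t) (u.ds s t) ((u s).dt t - (B.pair s).XH (u s t)) := h5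
  rw [h4] at h7
  rw [h3]
  have h8 : C.eta φ (u.map (s, t)) (u.ds s t) ((u s).dt t)
    = C.eta φ (u s t) (u.ds s t) ((u s).dt t) := rfl
  rw [h8]
  linarith

theorem F_le_of_joins (hR₀ : C.c < R₀) (hφ : IsCutoff φ R₀) {u : LoopCurve E M}
    (hu : B.IsContinuationSolution u) {An Ap : AdmissiblePair C R₀} (hB : B.Connects An Ap)
    {x : An.Orbit} {y : Ap.Orbit} (hxy : Joins u x.1 y.1) : Ap.F φ y.1 ≤ An.F φ x.1 := by
  obtain ⟨K, hn, hp⟩ := hB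
  choose m hm hD using B.exists_hasDerivAt_F hR₀ hφ.isWeight hu
  have hanti : Antitone fun s => (B.pair s).F φ (u s) := antitone_of_hasDerivAt_nonpos hD hm
  have hFl : ∀ s, (B.pair s).FloerAt u s := hu
  have h1 : ∀ δ > 0, ∃ᶠ s in atTop, |(B.pair s).F φ (u s) - Ap.F φ y.1| < δ := by
    intro δ hδ
    have h2 : ∀ᶠ s in atTop, B.pair s = Ap := (eventually_ge_atTop K).mono hp
    refine ((Ap.frequently_abs_F_sub_lt_atTop hR₀ hφ (h2.mono fun s hs => hs ▸ hFl s) y.2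
      hxy.2 hδ).and_eventually h2).mono fun s hs => ?_
    rw [hs.2]
    exact hs.1
  have h2 : ∀ δ > 0, ∃ᶠ s in atBot, |(B.pair s).F φ (u s) - An.F φ x.1| < δ := by
    intro δ hδ
    have h2 : ∀ᶠ s in atBot, B.pair s = An := (eventually_le_atBot (-K)).mono hn
    refine ((An.frequently_abs_F_sub_lt_atBot hR₀ hφ (h2.mono fun s hs => hs ▸ hFl s) x.2
      hxy.1 hδ).and_eventually h2).mono fun s hs => ?_
    rw [hs.2]
    exact hs.1
  exact (Antitone.le_of_frequently_atTop hanti h1 0).trans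
    (Antitone.le_of_frequently_atBot hanti h2 0)

end

end AdmissibleHomotopy

/-! ### Cascades and the filtration -/

section Cascades

variable {C : ConvexSymplecticManifold E E' M S} {R₀ : ℝ} {A : AdmissiblePair C R₀}
  {φ : ℝ → ℝ}

theorem filtrationStep_antitone (Λ : Type*) [CommRing Λ] (Ψ : OrbitFlow A) (φ : ℝ → ℝ) :
    Antitone (filtrationStep Λ Ψ φ) := by
  rintro a b hab
  refine Submodule.span_mono ?_
  rintro ξ ⟨p, hp, rfl⟩
  exact ⟨p, hab.trans hp, rfl⟩

theorem mem_filtrationStep {Λ : Type*} [CommRing Λ] {Ψ : OrbitFlow A} {a : ℝ} {ξ : CF Λ Ψ}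
    (h : ∀ p, ξ p ≠ 0 → a ≤ A.F φ p.1.1) : ξ ∈ filtrationStep Λ Ψ φ a := by
  rw [← Finsupp.sum_single ξ]
  refine Submodule.sum_mem _ fun p hp => ?_
  rw [← mul_one (ξ p), ← smul_eq_mul, ← Finsupp.smul_single]
  exact Submodule.smul_mem _ _ (Submodule.subset_span ⟨p, h p (Finsupp.mem_support_iff.1 hp), rfl⟩)

theorem iSup_filtrationStep (Λ : Type*) [CommRing Λ] (Ψ : OrbitFlow A) (φ : ℝ → ℝ) :
    ⨆ a, filtrationStep Λ Ψ φ a = ⊤ := by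
  classical
  refine eq_top_iff.2 fun ξ _ => ?_
  -- a finite sum of generators lies in the step at the least of their levels
  obtain ⟨a, ha⟩ := (ξ.support.image fun p => A.F φ p.1.1).bddBelow
  refine le_iSup (filtrationStep Λ Ψ φ) a (mem_filtrationStep fun p hp => ha ?_)
  exact Finset.mem_coe.2 (Finset.mem_image_of_mem _ (Finsupp.mem_support_iff.2 hp))

/-- A linear map whose matrix entries vanish unless the level does not decrease respects the
filtrations. -/
theorem map_filtrationStep_le {Λ : Type*} [CommRing Λ] {An Ap : AdmissiblePair C R₀}
    {Ψn : OrbitFlow An} {Ψp : OrbitFlow Ap} {d : CF Λ Ψp →ₗ[Λ] CF Λ Ψn}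
    (h : ∀ p q, d (Finsupp.single q 1) p ≠ 0 → Ap.F φ q.1.1 ≤ An.F φ p.1.1) (a : ℝ) :
    (filtrationStep Λ Ψp φ a).map d ≤ filtrationStep Λ Ψn φ a := by
  refine (Submodule.map_span_le _ _ _).2 ?_
  rintro _ ⟨q, hq, rfl⟩
  exact mem_filtrationStep fun p hp => hq.trans (h p q hp)

variable [FiniteDimensional ℝ E] [IsManifold 𝓘(ℝ, E') ∞ S]

/-- `F` is constant along the auxiliary flow, since `Ω_η` vanishes at 1-orbits. -/
theorem OrbitFlow.F_toFun (Ψ : OrbitFlow A) (hR₀ : C.c < R₀) (hφ : IsWeight φ R₀) (τ : ℝ)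
    (y : A.Orbit) : A.F φ (Ψ.toFun τ y).1 = A.F φ y.1 := by
  let u : LoopCurve E M := ⟨fun τ => (Ψ.toFun τ y).1, Ψ.smooth y⟩
  have h1 : ∀ s, HasDerivAt (fun τ => A.F φ (u τ)) 0 s := by
    intro s
    refine (A.hasDerivAt_F hR₀ hφ u s).congr_deriv ?_
    have h2 : ∀ t, C.eta φ (u s t) (u.ds s t) ((u s).dt t - A.XH (u s t)) = 0 := by
      intro t
      have h3 : (u s).dt t = A.XH (u s t) := (Ψ.toFun s y).2 t
      rw [h3, sub_self, C.eta_swap, ← neg_zero, C.eta_neg_left]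
      have h4 := C.eta_neg_left φ (u s t) 0 (u.ds s t)
      rw [neg_zero] at h4
      linarith
    have h3 : A.Omega φ (u s) (u.ds s) = -∫ t in (0 : ℝ)..1,
      C.eta φ (u s t) (u.ds s t) ((u s).dt t - A.XH (u s t)) := rfl
    rw [h3]
    simp [h2]
  have h2 := is_const_of_deriv_eq_zero (fun s => (h1 s).differentiableAt)
    (fun s => (h1 s).deriv) τ 0
  have h3 : A.F φ (u 0) = A.F φ y.1 := by
    change A.F φ (Ψ.toFun 0 y).1 = _
    rw [Ψ.zero]
  exact h2.trans h3

theorem OrbitFlow.F_eq_of_loopTendsto (Ψ : OrbitFlow A) (hR₀ : C.c < R₀) (hφ : IsWeight φ R₀)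
    {l : Filter ℝ} [l.NeBot] [l.IsCountablyGenerated] {x y : A.Orbit}
    (h : LoopTendsto (fun τ => (Ψ.toFun τ y).1) l x.1) : A.F φ y.1 = A.F φ x.1 := by
  have h1 := AdmissiblePair.tendsto_integral_R (C := C) h (A.continuous_reduced hφ)
  rw [← A.F_orbit hR₀ hφ x.2] at h1
  refine tendsto_nhds_unique (tendsto_const_nhds.congr fun τ => ?_) h1
  rw [← A.F_orbit hR₀ hφ (Ψ.toFun τ y).2, Ψ.F_toFun hR₀ hφ]

theorem Moduli.F_le (hR₀ : C.c < R₀) (hφ : IsCutoff φ R₀) {x y : A.Orbit} (u : Moduli A x y) :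
    A.F φ y.1 ≤ A.F φ x.1 := by
  obtain ⟨v, -⟩ := Quotient.exists_rep u
  have h := A.F_mem_Icc_of_joins hR₀ hφ v.2.1 v.2.2 0
  exact h.1.trans h.2

theorem LeftLeg.F_le (hR₀ : C.c < R₀) (hφ : IsCutoff φ R₀) {Ψ : OrbitFlow A} {p : Ψ.Generator}
    {y : A.Orbit} (l : LeftLeg Ψ p y) : A.F φ y.1 ≤ A.F φ p.1.1 := by
  induction l with
  | start y hy => exact (Ψ.F_eq_of_loopTendsto hR₀ hφ.isWeight hy).le
  | step x y l u τ hτ ih =>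
    rw [Ψ.F_toFun hR₀ hφ.isWeight]
    exact (u.F_le hR₀ hφ).trans ih

theorem RightLeg.F_le (hR₀ : C.c < R₀) (hφ : IsCutoff φ R₀) {Ψ : OrbitFlow A} {q : Ψ.Generator}
    {x : A.Orbit} (l : RightLeg Ψ q x) : A.F φ q.1.1 ≤ A.F φ x.1 := by
  induction l with
  | finish y hy => exact (Ψ.F_eq_of_loopTendsto hR₀ hφ.isWeight hy).ge
  | step x y τ hτ u l ih =>
    have h := ih.trans (u.F_le hR₀ hφ)
    rwa [Ψ.F_toFun hR₀ hφ.isWeight] at h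

theorem Cascade.F_le (hR₀ : C.c < R₀) (hφ : IsCutoff φ R₀) {Ψ : OrbitFlow A}
    {p q : Ψ.Generator} (k : Cascade Ψ p q) : A.F φ q.1.1 ≤ A.F φ p.1.1 := by
  cases k with
  | flowLine L hL =>
    obtain ⟨x, -, hp, hq⟩ := hL
    rw [← Ψ.F_eq_of_loopTendsto hR₀ hφ.isWeight hp, ← Ψ.F_eq_of_loopTendsto hR₀ hφ.isWeight hq]
  | broken x y l u hy =>
    rw [← Ψ.F_eq_of_loopTendsto hR₀ hφ.isWeight hy]
    exact (u.F_le hR₀ hφ).trans (l.F_le hR₀ hφ)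

theorem ContCascade.F_le (hR₀ : C.c < R₀) (hφ : IsCutoff φ R₀) {B : AdmissibleHomotopy C R₀}
    {An Ap : AdmissiblePair C R₀} (hB : B.Connects An Ap) {Ψn : OrbitFlow An}
    {Ψp : OrbitFlow Ap} {p : Ψn.Generator} {q : Ψp.Generator} (k : ContCascade B Ψn Ψp p q) :
    Ap.F φ q.1.1 ≤ An.F φ p.1.1 :=
  (k.right.F_le hR₀ hφ).trans
    ((B.F_le_of_joins hR₀ hφ k.u.2.1 hB k.u.2.2).trans (k.left.F_le hR₀ hφ))

end Cascades

end FloerFiltration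

end

theorem mainTheorem6
    {E : Type*} [NormedAddCommGroup E] [NormedSpace ℝ E] [FiniteDimensional ℝ E]
    {E' : Type*} [NormedAddCommGroup E'] [NormedSpace ℝ E'] [FiniteDimensional ℝ E']
    {M : Type*} [TopologicalSpace M] [T2Space M] [SecondCountableTopology M]
    [ChartedSpace E M] [IsManifold 𝓘(ℝ, E) ∞ M]
    {S : Type*} [TopologicalSpace S] [T2Space S] [CompactSpace S]
    [ChartedSpace E' S] [IsManifold 𝓘(ℝ, E') ∞ S]
    (C : FloerFiltration.ConvexSymplecticManifold E E' M S)
    (R₀ : ℝ) (hR₀ : C.c < R₀) (φ : ℝ → ℝ) (hφ : FloerFiltration.IsCutoff φ R₀)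
    (A : FloerFiltration.AdmissiblePair C R₀)
    {Λ : Type*} [CommRing Λ] [TopologicalSpace Λ] :
    -- exactness
    FloerFiltration.IsPrimitive (A.F φ) (A.Omega φ) ∧
    -- negativity
    (∀ u : FloerFiltration.LoopCurve E M, A.IsFloerTrajectory u →
      (∀ s, HasDerivAt (fun s' => A.F φ (u s')) (A.Omega φ (u s) (u.ds s)) s ∧
        A.Omega φ (u s) (u.ds s) ≤ 0) ∧
      ∀ x y : A.Orbit, FloerFiltration.Joins u x.1 y.1 → A.F φ y.1 ≤ A.F φ x.1) ∧
    -- separation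
    ((∀ x : FloerFiltration.Loop E M, (∀ t, C.R (x t) ≤ R₀) → A.F φ x = 0) ∧
      ∀ x : A.Orbit, (∀ t, R₀ ≤ C.R (x.1 t)) → A.F φ x.1 < 0) ∧
    -- compatibility
    (∀ (B : FloerFiltration.AdmissibleHomotopy C R₀) (u : FloerFiltration.LoopCurve E M),
      B.IsContinuationSolution u →
        (∀ s, ∃ m ≤ 0, HasDerivAt (fun s' => (B.pair s').F φ (u s')) m s) ∧
        ∀ An Ap : FloerFiltration.AdmissiblePair C R₀, B.Connects An Ap →
          ∀ (x : An.Orbit) (y : Ap.Orbit), FloerFiltration.Joins u x.1 y.1 →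
            Ap.F φ y.1 ≤ An.F φ x.1) ∧
    -- strictness
    (FloerFiltration.IsStrictCutoff φ R₀ A.h →
      ∀ u : FloerFiltration.LoopCurve E M, A.IsFloerTrajectory u →
        ∀ x y : A.Orbit, FloerFiltration.Joins u x.1 y.1 → x ≠ y →
          (∀ t, R₀ ≤ C.R (y.1 t)) → A.F φ y.1 < A.F φ x.1) ∧
    -- filtration of the Floer complex
    (∀ (Ψ : FloerFiltration.OrbitFlow A)
      (w : ∀ p q : Ψ.Generator, FloerFiltration.Cascade Ψ p q → Λ)
      (d : FloerFiltration.CF Λ Ψ →ₗ[Λ] FloerFiltration.CF Λ Ψ),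
      FloerFiltration.IsFloerDifferential Ψ w d →
        Antitone (FloerFiltration.filtrationStep Λ Ψ φ) ∧
        (⨆ a, FloerFiltration.filtrationStep Λ Ψ φ a) = ⊤ ∧
        ∀ a, (FloerFiltration.filtrationStep Λ Ψ φ a).map d
          ≤ FloerFiltration.filtrationStep Λ Ψ φ a) ∧
    -- continuation maps respect the filtrations
    (∀ (B : FloerFiltration.AdmissibleHomotopy C R₀) (An Ap : FloerFiltration.AdmissiblePair C R₀),
      B.Connects An Ap →
      ∀ (Ψn : FloerFiltration.OrbitFlow An) (Ψp : FloerFiltration.OrbitFlow Ap)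
        (w : ∀ p q, FloerFiltration.ContCascade B Ψn Ψp p q → Λ)
        (κ : FloerFiltration.CF Λ Ψp →ₗ[Λ] FloerFiltration.CF Λ Ψn),
        FloerFiltration.IsContinuationMap B Ψn Ψp w κ →
          ∀ a, (FloerFiltration.filtrationStep Λ Ψp φ a).map κ
            ≤ FloerFiltration.filtrationStep Λ Ψn φ a) := by
  exact ⟨A.hasDerivAt_F hR₀ hφ.isWeight,
    fun u hu => ⟨fun s => ⟨A.hasDerivAt_F hR₀ hφ.isWeight u s,
        A.Omega_nonpos hR₀ hφ.isWeight (hu s)⟩,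
      fun x y hxy =>
        have h := A.F_mem_Icc_of_joins hR₀ hφ hu hxy 0
        h.1.trans h.2⟩,
    ⟨fun x hx => A.F_eq_zero hR₀ hφ.isWeight hx, fun x hx => A.F_orbit_neg hR₀ hφ x.2 hx⟩,
    fun B u hu => ⟨B.exists_hasDerivAt_F hR₀ hφ.isWeight hu,
      fun An Ap hB x y hxy => B.F_le_of_joins hR₀ hφ hu hB hxy⟩,
    fun hstrict u hu x y hxy hne hy => A.F_lt_of_joins hR₀ hφ hstrict hu hxy hne hy,
    fun Ψ w d hd => ⟨FloerFiltration.filtrationStep_antitone Λ Ψ φ,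
      FloerFiltration.iSup_filtrationStep Λ Ψ φ,
      FloerFiltration.map_filtrationStep_le fun p q hpq => by
        obtain ⟨k⟩ : Nonempty (FloerFiltration.Cascade Ψ p q) := by
          by_contra hempty
          rw [not_nonempty_iff] at hempty
          exact hpq (by rw [hd p q, tsum_empty])
        exact k.F_le hR₀ hφ⟩,
    fun B An Ap hB Ψn Ψp w κ hκ => FloerFiltration.map_filtrationStep_le fun p q hpq => by
      obtain ⟨k⟩ : Nonempty (FloerFiltration.ContCascade B Ψn Ψp p q) := by
        by_contra hempty
        rw [not_nonempty_iff] at hempty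
        exact hpq (by rw [hκ p q, tsum_empty])
      exact k.F_le hR₀ hφ hB⟩
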